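/- **Setting.** Consider vacuum AdS$_{2+1}$ with AdS length $1$ and metric $ds^2=-\cosh^2\!\rho\,dt^2+d\rho^2+\sinh^2\!\rho\,d\phi^2$; its conformal boundary is the cylinder with coordinates $(t,\phi)$. For a boundary region $A$ that is a finite union of closed arcs at a fixed time, an extremal surface $\gamma$ homologous to $A$ is a finite union of complete spacelike geodesics with pairwise different end points such that $A\cup\gamma$ bounds a region $\Sigma[\gamma]$ of the time slice; its outer wedge is the domain of dependence $D(\Sigma[\gamma])$. Areas (lengths) are regularised by keeping only the part with $r=\sinh\rho\le 1/\epsilon$, and area differences are taken in the limit $\epsilon\to0^+$. The Ryu–Takayanagi (RT) surface is the homologous extremal surface of least area, $S(A)=A[\gamma_{RT}]/(4G_N)$, $I(A:B)=S(A)+S(B)-S(A\cup B)$, and the entanglement wedge $E_A$ is the outer wedge of the RT surface. A homologous extremal surface is outer minimal if no homologous extremal surface in its outer wedge has smaller area; the appetizer is the outermost outer minimal surface, and the easy wedge $E_A^{\rm easy}$ is its outer wedge. The bulge $\gamma_{\rm bulge}$ and the appetizer $\gamma_{\rm app}$ are the pair of nested homologous extremal surfaces in $E_A$ maximising (area of the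 inner one) $-$ (area of the outer one), and $\Delta A_{PL}=A[\gamma_{\rm bulge}]-A[\gamma_{\rm app}]$. All wedges are taken closed, and a prime denotes the (closed) spacelike complement. Let $\hat R=\hat R_1\cup\hat R_2$ at $t=0$, with $\hat R_1=[-\tfrac\mu2,\tfrac\mu2]$, $\hat R_2=[\pi-\tfrac\mu2,\pi+\tfrac\mu2]$, let $c_1=(-\tau,-\tfrac\mu2)$, $c_2=(-\tau,\tfrac\mu2)$ be the input points, and let $\hat V_1=[-\tfrac{\mu+\tau}2,-\tfrac{\mu-\tau}2]$, $\hat V_2=[\tfrac{\mu-\tau}2,\tfrac{\mu+\tau}2]$ at $t=-\tfrac\tau2$. The bulk scattering region is $J=J^+(E_{\hat V_1})\cap J^+(E^{\rm easy}_{\hat V_2})\cap J^-(E^{\rm easy}_{\hat R})\cap J^-((E^{\rm easy}_{\hat R})')$. Put $\Delta A_{MI}=4G_N\,I(\hat V_1:\hat V_2)$ and $\tau_*=\arccos(\cos^2(\mu/2))$, where $G_N>0$ is arbitrary. Assume throughout that $\mu\ge\pi/2$. **Theorem.** 1. If $0<\tau<\pi-\mu$, then for $i=1,2$ the boundary decision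 region $\hat J^+(c_i)\cap\hat J^-(D(\hat R))\cap\hat J^-(D(\hat R)')$ is the boundary domain of dependence of $\hat V_i$. 2. If $0<\tau\le\pi-\mu$, then $J\neq\emptyset$ if and only if $\cos\tau\le\cos^2(\mu/2)$. 3. If $0<\tau\le\pi-\mu$ and $\tau<\mu$, then $$\Delta A_{MI}=2\ln\frac{\sin^2(\tau/2)}{\sin\frac{\mu-\tau}2\,\sin\frac{\mu+\tau}2}\quad\text{if }\cos\tau\le\cos^2(\mu/2),\qquad \Delta A_{MI}=0\quad\text{otherwise.}$$ 4. If $\mu<\pi$, then for $\hat R$ we have $\Delta A_{PL}=2\ln\csc^2(\mu/2)>0$; in particular it does not depend on $\tau$. 5. If $\tau_*<\pi-\mu$ (for example $\mu=\pi/2$), then $2\ln\frac{\sin^2(\tau/2)}{\sin\frac{\mu-\tau}2\sin\frac{\mu+\tau}2}\to0$ and $\Delta A_{MI}\to0$ as $\tau\to\tau_*$. 6. Consequently, if $\tau_*<\pi-\mu$ then for every $\alpha_0>0$ and all $\tau>\tau_*$ close enough to $\tau_*$ (so that $\tau<\pi-\mu$ and $J\ne\emptyset$) we have $I(\hat V_1:\hat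 V_2)<\alpha_0\,\Delta A_{PL}/(4G_N)$. Hence there is no constant $\alpha_0>0$ such that $I(\hat V_1:\hat V_2)\ge\alpha_0\,\Delta A_{PL}/(4G_N)$ holds for all $\mu\in[\pi/2,\pi)$ and $0<\tau<\pi-\mu$ with $J\ne\emptyset$. -/

import Mathlib

open Filter Topology MeasureTheory

noncomputable section

namespace TwoIntervals

/-! # Vacuum AdS in 2+1 dimensions (with AdS length 1) and its conformal boundary

The global metric `-cosh² ρ dt² + dρ² + sinh² ρ dφ²` equals `z⁻² (-dt² + |dx|²)`, where
`x = (tanh ρ cos φ, tanh ρ sin φ, 1 / cosh ρ)` runs over the open upper unit hemisphere and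
`z = 1 / cosh ρ` is its height; see `metric_eq` below. The conformal boundary is the
equator `z = 0`. -/

/-- A constant-time slice of AdS together with its conformal boundary circle. -/
abbrev Slice : Type := {x : EuclideanSpace ℝ (Fin 3) // ‖x‖ = 1 ∧ 0 ≤ x 2}

/-- Conformally compactified AdS: pairs (global time, point of the slice). -/
abbrev Spacetime : Type := ℝ × Slice

/-- Interior points of the slice. -/
def bulk : Set Slice := {x | 0 < x.1 2}

/-- Points of the conformal boundary circle. -/
def bdry : Set Slice := {x | x.1 2 = 0}

lemma norm_sq_fin3 (a b c : ℝ) (h : a ^ 2 + b ^ 2 + c ^ 2 = 1) :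
    ‖(!₂[a, b, c] : EuclideanSpace ℝ (Fin 3))‖ = 1 := by
  rw [EuclideanSpace.norm_eq, Fin.sum_univ_three]
  simp [h]

/-- The slice point with global coordinates `(ρ, φ)`. -/
def bulkPoint (ρ φ : ℝ) : Slice :=
  ⟨!₂[Real.tanh ρ * Real.cos φ, Real.tanh ρ * Real.sin φ, 1 / Real.cosh ρ], by
    have hc : Real.cosh ρ ≠ 0 := (Real.cosh_pos ρ).ne'
    constructor
    · apply norm_sq_fin3
      rw [Real.tanh_eq_sinh_div_cosh]
      field_simp
      nlinarith [Real.cosh_sq ρ, Real.sin_sq_add_cos_sq φ]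
    · have := Real.cosh_pos ρ
      simp only [Matrix.cons_val]
      positivity⟩

/-- The boundary point at angle `φ`. -/
def bdryPoint (φ : ℝ) : Slice :=
  ⟨!₂[Real.cos φ, Real.sin φ, 0], by
    constructor
    · apply norm_sq_fin3
      nlinarith [Real.sin_sq_add_cos_sq φ]
    · simp⟩

/-- In the coordinates `(ρ, φ)`, the slice metric `dρ² + sinh² ρ dφ²` is `z⁻² |dx|²`, and
`-cosh² ρ dt²` is `-z⁻² dt²`. -/
theorem metric_eq (ρ φ : ℝ → ℝ) (ρ' φ' t' s : ℝ)
    (hρ : HasDerivAt ρ ρ' s) (hφ : HasDerivAt φ φ' s) :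
    ∃ x' : Fin 3 → ℝ,
      (∀ i, HasDerivAt (fun u => (bulkPoint (ρ u) (φ u)).1 i) (x' i) s) ∧
      -Real.cosh (ρ s) ^ 2 * t' ^ 2 + ρ' ^ 2 + Real.sinh (ρ s) ^ 2 * φ' ^ 2 =
        ((bulkPoint (ρ s) (φ s)).1 2)⁻¹ ^ 2 *
          (-t' ^ 2 + (x' 0 ^ 2 + x' 1 ^ 2 + x' 2 ^ 2)) := by
  have hc : Real.cosh (ρ s) ≠ 0 := (Real.cosh_pos _).ne'
  have h1 := Real.cosh_sq (ρ s)
  have h2 := Real.sin_sq_add_cos_sq (φ s)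
  have hz : HasDerivAt (fun u => 1 / Real.cosh (ρ u))
      (-(Real.sinh (ρ s) * ρ') / Real.cosh (ρ s) ^ 2) s :=
    ((hρ.cosh).fun_inv hc).congr_of_eventuallyEq (Eventually.of_forall fun u => one_div _)
  have htanh : HasDerivAt (fun u => Real.tanh (ρ u)) (ρ' / Real.cosh (ρ s) ^ 2) s := by
    have h := (hρ.sinh).fun_div (hρ.cosh) hc
    have e : Real.cosh (ρ s) * ρ' * Real.cosh (ρ s) - Real.sinh (ρ s) * (Real.sinh (ρ s) * ρ')
        = ρ' := by linear_combination ρ' * h1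
    rw [e] at h
    exact h.congr_of_eventuallyEq (Eventually.of_forall fun u => Real.tanh_eq_sinh_div_cosh _)
  refine ⟨![ρ' / Real.cosh (ρ s) ^ 2 * Real.cos (φ s)
      + Real.tanh (ρ s) * (-Real.sin (φ s) * φ'),
    ρ' / Real.cosh (ρ s) ^ 2 * Real.sin (φ s) + Real.tanh (ρ s) * (Real.cos (φ s) * φ'),
    -(Real.sinh (ρ s) * ρ') / Real.cosh (ρ s) ^ 2], fun i => ?_, ?_⟩
  · fin_cases i
    · exact htanh.fun_mul hφ.cos
    · exact htanh.fun_mul hφ.sin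
    · exact hz
  · simp only [bulkPoint, Matrix.cons_val]
    rw [Real.tanh_eq_sinh_div_cosh]
    have h3 : Real.cos (φ s) ^ 2 = 1 - Real.sin (φ s) ^ 2 := by linarith
    have h4 : Real.sinh (ρ s) ^ 2 = Real.cosh (ρ s) ^ 2 - 1 := by linarith
    field_simp
    ring_nf
    simp only [h3, h4]
    ring

/-! ## Causal structure -/

/-- Inextendible causal curves inside `M` (`M = univ`: AdS with its boundary; `M = bdry`: the
boundary cylinder). A causal curve, `-dt² + |dx|² ≤ 0`, can be parametrised by global time, and is
then a map with Lipschitz constant 1 (Lipschitz for the chordal distance and for the arc length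
distance agree on curves). -/
def IsCausalCurve (M : Set Slice) (c : ℝ → Slice) : Prop :=
  LipschitzWith 1 c ∧ ∀ t, c t ∈ M

/-- Causal future within `M`. -/
def causalFuture (M : Set Slice) (S : Set Spacetime) : Set Spacetime :=
  {q | ∃ p ∈ S, p.1 ≤ q.1 ∧ ∃ c, IsCausalCurve M c ∧ c p.1 = p.2 ∧ c q.1 = q.2}

/-- Causal past within `M`. -/
def causalPast (M : Set Slice) (S : Set Spacetime) : Set Spacetime :=
  {q | ∃ p ∈ S, q.1 ≤ p.1 ∧ ∃ c, IsCausalCurve M c ∧ c p.1 = p.2 ∧ c q.1 = q.2}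

/-- Domain of dependence within `M`: every inextendible causal curve through the point meets `S`. -/
def domainOfDependence (M : Set Slice) (S : Set Spacetime) : Set Spacetime :=
  {p | p.2 ∈ M ∧ ∀ c, IsCausalCurve M c → c p.1 = p.2 → ∃ t, (t, c t) ∈ S}

/-- Spacelike complement within `M`. All regions are taken closed, so the set of points spacelike
separated from `S` is closed up; it then shares with a closed wedge its edge. -/
def spacelikeComplement (M : Set Slice) (S : Set Spacetime) : Set Spacetime :=
  closure {p | p.2 ∈ M ∧ p ∉ causalFuture M S ∧ p ∉ causalPast M S}

/-- The set `S` placed on the slice at time `t₀`. -/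
def atTime (t₀ : ℝ) (S : Set Slice) : Set Spacetime := {p | p.1 = t₀ ∧ p.2 ∈ S}

/-! ## Extremal surfaces -/

/-- The embedding of AdS in `ℝ^{2,2}`; see `embed_bulkPoint`. -/
def embed (p : Spacetime) : Fin 4 → ℝ :=
  ![Real.cos p.1 / p.2.1 2, Real.sin p.1 / p.2.1 2, p.2.1 0 / p.2.1 2, p.2.1 1 / p.2.1 2]

theorem embed_bulkPoint (t ρ φ : ℝ) :
    embed (t, bulkPoint ρ φ) =
      ![Real.cosh ρ * Real.cos t, Real.cosh ρ * Real.sin t,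
        Real.sinh ρ * Real.cos φ, Real.sinh ρ * Real.sin φ] := by
  have hc : Real.cosh ρ ≠ 0 := (Real.cosh_pos ρ).ne'
  funext i
  fin_cases i <;>
    simp [embed, bulkPoint, Real.tanh_eq_sinh_div_cosh] <;> field_simp

/-- The inner product of `ℝ^{2,2}`. -/
def form22 (X Y : Fin 4 → ℝ) : ℝ := -X 0 * Y 0 - X 1 * Y 1 + X 2 * Y 2 + X 3 * Y 3

/-- `g` is a complete spacelike geodesic of AdS, parametrised by proper length: with `X = embed ∘ g`
we have `X' · X' = 1`, and the acceleration `X''` is normal to the hyperboloid `X · X = -1`, which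
for such a curve says `X'' = X`. -/
def IsSpacelikeGeodesic (g : ℝ → Spacetime) : Prop :=
  Continuous g ∧ (∀ s, (g s).2 ∈ bulk) ∧
    ∃ V : ℝ → Fin 4 → ℝ, ∀ s, HasDerivAt (fun u => embed (g u)) (V s) s ∧
      HasDerivAt V (embed (g s)) s ∧ form22 (V s) (V s) = 1

/-- An extremal surface (of codimension two): finitely many complete spacelike geodesics ending on
the conformal boundary, with pairwise different end points. -/
structure ExtremalSurface where
  n : ℕ
  geo : Fin n → ℝ → Spacetime
  src : Fin n → Spacetime
  tgt : Fin n → Spacetime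
  isGeo : ∀ i, IsSpacelikeGeodesic (geo i)
  src_bdry : ∀ i, (src i).2 ∈ bdry
  tgt_bdry : ∀ i, (tgt i).2 ∈ bdry
  tendsto_src : ∀ i, Tendsto (geo i) atBot (𝓝 (src i))
  tendsto_tgt : ∀ i, Tendsto (geo i) atTop (𝓝 (tgt i))
  ends_injective : Function.Injective (Sum.elim src tgt)

/-- The points of the surface, with its end points on the boundary. -/
def ExtremalSurface.carrier (Γ : ExtremalSurface) : Set Spacetime :=
  (⋃ i, Set.range (Γ.geo i)) ∪ (Set.range Γ.src ∪ Set.range Γ.tgt)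

/-- The radial coordinate `r = sinh ρ`. -/
def radius (x : Slice) : ℝ := √(x.1 0 ^ 2 + x.1 1 ^ 2) / x.1 2

/-- Regularised area (total proper length) of a surface: only the part in `r ≤ 1 / ε` counts. -/
def ExtremalSurface.area (Γ : ExtremalSurface) (ε : ℝ) : ℝ :=
  ∑ i, (volume {s : ℝ | radius (Γ.geo i s).2 ≤ 1 / ε}).toReal

/-- `S` is a homology region between the boundary region `A`, at time `t₀`, and the surface `Γ`:
a (regular closed) region of the slice whose boundary consists of `A` and `Γ`. -/
def IsHomologyRegion (t₀ : ℝ) (A : Set Slice) (Γ : ExtremalSurface) (S : Set Slice) : Prop :=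
  closure (interior S) = S ∧ S ∩ bdry = A ∧ Γ.carrier = atTime t₀ (frontier S)

/-- The extremal surfaces homologous to `A`. -/
def homologous (t₀ : ℝ) (A : Set Slice) : Set ExtremalSurface :=
  {Γ | ∃ S, IsHomologyRegion t₀ A Γ S}

/-- Outer wedge of the surface with homology region `S`. -/
def outerWedge (t₀ : ℝ) (S : Set Slice) : Set Spacetime :=
  domainOfDependence Set.univ (atTime t₀ S)

/-- Ryu–Takayanagi surfaces: homologous extremal surfaces of least area. As areas diverge, they
are compared at all sufficiently small cutoffs. -/
def IsRT (t₀ : ℝ) (A : Set Slice) (Γ : ExtremalSurface) : Prop :=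
  Γ ∈ homologous t₀ A ∧ ∀ Γ' ∈ homologous t₀ A, ∀ᶠ ε in 𝓝[>] 0, Γ.area ε ≤ Γ'.area ε

/-- Entanglement wedge. -/
def entanglementWedge (t₀ : ℝ) (A : Set Slice) : Set Spacetime :=
  {p | ∃ Γ S, IsRT t₀ A Γ ∧ IsHomologyRegion t₀ A Γ S ∧ p ∈ outerWedge t₀ S}

/-- Outer minimal surfaces: no extremal surface in the outer wedge has a smaller area. -/
def IsOuterMinimal (t₀ : ℝ) (A : Set Slice) (Γ : ExtremalSurface) (S : Set Slice) : Prop :=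
  IsHomologyRegion t₀ A Γ S ∧
    ∀ Γ' S', IsHomologyRegion t₀ A Γ' S' → outerWedge t₀ S' ⊆ outerWedge t₀ S →
      ∀ᶠ ε in 𝓝[>] 0, Γ.area ε ≤ Γ'.area ε

/-- The appetizer: the outermost minimal surface. (If there is no lunch, it is the Ryu–Takayanagi
surface.) -/
def IsAppetizer (t₀ : ℝ) (A : Set Slice) (Γ : ExtremalSurface) (S : Set Slice) : Prop :=
  IsOuterMinimal t₀ A Γ S ∧
    ∀ Γ' S', IsOuterMinimal t₀ A Γ' S' → outerWedge t₀ S ⊆ outerWedge t₀ S'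

/-- Easy wedge: the outer wedge of the appetizer. -/
def easyWedge (t₀ : ℝ) (A : Set Slice) : Set Spacetime :=
  {p | ∃ Γ S, IsAppetizer t₀ A Γ S ∧ p ∈ outerWedge t₀ S}

/-- Hard wedge: the spacelike complement of the easy wedge. -/
def hardWedge (t₀ : ℝ) (A : Set Slice) : Set Spacetime :=
  spacelikeComplement Set.univ (easyWedge t₀ A)

/-- Two homologous extremal surfaces in the entanglement wedge, `Γj` outside of `Γi`. -/
def IsOrderedPair (t₀ : ℝ) (A : Set Slice) (Γi Γj : ExtremalSurface) : Prop :=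
  ∃ Si Sj, IsHomologyRegion t₀ A Γi Si ∧ IsHomologyRegion t₀ A Γj Sj ∧
    outerWedge t₀ Sj ⊆ outerWedge t₀ Si ∧ outerWedge t₀ Si ⊆ entanglementWedge t₀ A

/-- Bulge and appetizer: the ordered pair of extremal surfaces that maximises the area difference
(inner minus outer), the outer one being the appetizer. -/
def IsBulgeAppetizer (t₀ : ℝ) (A : Set Slice) (Γb Γa : ExtremalSurface) : Prop :=
  IsOrderedPair t₀ A Γb Γa ∧ (∃ S, IsAppetizer t₀ A Γa S) ∧
    ∀ Γi Γj, IsOrderedPair t₀ A Γi Γj →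
      ∀ᶠ ε in 𝓝[>] 0, Γi.area ε - Γj.area ε ≤ Γb.area ε - Γa.area ε

/-- `Δ` is the python's lunch area difference `ΔA_PL = A[bulge] - A[appetizer]` of the region `A`
(the divergences cancel as the cutoff is removed). -/
def HasLunchArea (t₀ : ℝ) (A : Set Slice) (Δ : ℝ) : Prop :=
  ∃ Γb Γa, IsBulgeAppetizer t₀ A Γb Γa ∧
    Tendsto (fun ε => Γb.area ε - Γa.area ε) (𝓝[>] 0) (𝓝 Δ)

/-- Regularised entropy from the Ryu–Takayanagi formula, `S(A) = min A[γ] / (4 G)`. -/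
def entropy (G t₀ : ℝ) (A : Set Slice) (ε : ℝ) : ℝ :=
  sInf ((fun Γ : ExtremalSurface => Γ.area ε) '' homologous t₀ A) / (4 * G)

/-- `I` is the mutual information `S(A) + S(B) - S(A ∪ B)` (its divergences cancel as the cutoff is
removed). -/
def HasMutualInfo (G t₀ : ℝ) (A B : Set Slice) (I : ℝ) : Prop :=
  Tendsto (fun ε => entropy G t₀ A ε + entropy G t₀ B ε - entropy G t₀ (A ∪ B) ε)
    (𝓝[>] 0) (𝓝 I)

/-! ## The two-interval configuration -/

/-- The closed boundary arc `a ≤ φ ≤ b`. -/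
def arc (a b : ℝ) : Set Slice := bdryPoint '' Set.Icc a b

/-- The referee's region at time `0`: two opposite intervals of width `μ`. -/
def regionR (μ : ℝ) : Set Slice := arc (-(μ / 2)) (μ / 2) ∪ arc (Real.pi - μ / 2) (Real.pi + μ / 2)

/-- The input points, at time `-τ`. -/
def c₁ (μ τ : ℝ) : Spacetime := (-τ, bdryPoint (-(μ / 2)))
def c₂ (μ τ : ℝ) : Spacetime := (-τ, bdryPoint (μ / 2))

/-- The input intervals, at time `-τ/2`. -/
def V₁ (μ τ : ℝ) : Set Slice := arc (-((μ + τ) / 2)) (-((μ - τ) / 2))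
def V₂ (μ τ : ℝ) : Set Slice := arc ((μ - τ) / 2) ((μ + τ) / 2)

/-- The referee's region as a boundary spacetime region. -/
def hatR (μ : ℝ) : Set Spacetime := domainOfDependence bdry (atTime 0 (regionR μ))

/-- The decision region of the input point `c`: where signals from `c` are available and can still
be sent to the referee's region and to its complement (within the boundary). -/
def decisionRegion (μ : ℝ) (c : Spacetime) : Set Spacetime :=
  causalFuture bdry {c} ∩ causalPast bdry (hatR μ) ∩
    causalPast bdry (spacelikeComplement bdry (hatR μ))

/-- The bulk scattering region `J⁺(E_{V₁}) ∩ J⁺(E_{V₂}^easy) ∩ J⁻(E_R^easy) ∩ J⁻((E_R^easy)')`. -/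
def scatteringRegion (μ τ : ℝ) : Set Spacetime :=
  {p | p.2 ∈ bulk ∧
    p ∈ causalFuture Set.univ (entanglementWedge (-(τ / 2)) (V₁ μ τ)) ∧
    p ∈ causalFuture Set.univ (easyWedge (-(τ / 2)) (V₂ μ τ)) ∧
    p ∈ causalPast Set.univ (easyWedge 0 (regionR μ)) ∧
    p ∈ causalPast Set.univ (hardWedge 0 (regionR μ))}

/-- The area difference `ΔA_MI` in the phase where the entanglement wedge of the two input
intervals is connected. -/
def areaMI (μ τ : ℝ) : ℝ :=
  2 * Real.log (Real.sin (τ / 2) ^ 2 / (Real.sin ((μ - τ) / 2) * Real.sin ((μ + τ) / 2)))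

/-- The area difference `ΔA_PL`. -/
def areaPL (μ : ℝ) : ℝ := 2 * Real.log ((Real.sin (μ / 2))⁻¹ ^ 2)

/-- The critical time `arccos (cos² (μ/2))`. -/
def τcrit (μ : ℝ) : ℝ := Real.arccos (Real.cos (μ / 2) ^ 2)

end TwoIntervals

end

open TwoIntervals Filter Topology

namespace TwoIntervals

/-! Conformally, AdS is the static cylinder over a hemisphere, so causal questions become questions
about speed. The great-circle distance `ang` to a fixed boundary point changes at rate at most one
along a causal curve (`IsCausalCurve.ang_le`), and moving along a meridian through that point
realises any such rate (`exists_causalCurve`). Hence a cap of radius w at time t₀ has the domain of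
dependence ang ≤ w − |t − t₀|, with causal future ang ≤ w + (t − t₀). Two opposite caps are a
sublevel and a superlevel set of one such function. The boundary circle obeys the same formulas, and
this settles the decision regions.

Vertical projection of the hemisphere to the disc (the Klein model) turns geodesics of the slice
into straight chords and caps into half-planes. Solving X'' = X shows that the regularised length of
a geodesic depends only on the chordal distance d of its ends, and is 2 log d plus a universal
divergence (`length_eq`, `tendsto_len_sub`). The end points of a homologous surface are exactly
those of the boundary region (`IsHomologyRegion.range_ends`), so one arc leaves a single candidate
and two arcs leave three, the pairings of four points. For the referee's region the chords cutting
off the intervals form the appetizer, those cutting off the gaps are RT because μ ≥ π/2, and the two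
crossing diameters form the bulge; this yields `areaPL`. For the input intervals the crossing
pairing never wins, so 4G times the mutual information is max(0, `areaMI`).

By the causal formulas, scattering at time t requires cos(t + τ) ≤ cos(μ/2 + t) cos(μ/2). The
difference of the two sides is a sinusoid in t, and it can have the right sign for −τ ≤ t ≤ 0 only
if it does at t = 0, that is if cos τ ≤ cos²(μ/2) (`scattering_sinusoid`). The identity sin((μ−τ)/2)
sin((μ+τ)/2) = sin²(μ/2) − sin²(τ/2) shows that `areaMI` is nonnegative under the very same
condition. So the mutual information tends to zero at the scattering threshold, while the lunch area
is a positive constant, and no α₀ can work. -/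

open InnerProductGeometry

/-! ## Angular distance on the slice -/

/-- Great-circle distance on the hemisphere. -/
noncomputable def ang (x y : Slice) : ℝ := angle x.1 y.1

lemma Slice.sq_sum (x : Slice) : x.1 0 ^ 2 + x.1 1 ^ 2 + x.1 2 ^ 2 = 1 := by
  have h := x.2.1
  rw [EuclideanSpace.norm_eq, Fin.sum_univ_three, Real.sqrt_eq_one] at h
  simpa using h

lemma Slice.ext_coords {x y : Slice} (h0 : x.1 0 = y.1 0) (h1 : x.1 1 = y.1 1) : x = y := by
  have hx := x.sq_sum
  have hy := y.sq_sum
  rw [h0, h1] at hx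
  have h2 : x.1 2 = y.1 2 := by
    have h : x.1 2 ^ 2 = y.1 2 ^ 2 := by linarith
    exact (sq_eq_sq₀ x.2.2 y.2.2).1 h
  apply Subtype.ext
  ext i
  fin_cases i <;> assumption

lemma inner_slice (x y : Slice) :
    inner ℝ x.1 y.1 = x.1 0 * y.1 0 + x.1 1 * y.1 1 + x.1 2 * y.1 2 := by
  rw [PiLp.inner_apply, Fin.sum_univ_three]
  simp [mul_comm]

lemma ang_eq_arccos (x y : Slice) :
    ang x y = Real.arccos (x.1 0 * y.1 0 + x.1 1 * y.1 1 + x.1 2 * y.1 2) := by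
  rw [ang, angle, inner_slice, x.2.1, y.2.1]
  simp

lemma cos_ang (x y : Slice) :
    Real.cos (ang x y) = x.1 0 * y.1 0 + x.1 1 * y.1 1 + x.1 2 * y.1 2 := by
  rw [ang, cos_angle, inner_slice, x.2.1, y.2.1]
  simp

lemma ang_nonneg (x y : Slice) : 0 ≤ ang x y := angle_nonneg _ _

lemma ang_le_pi (x y : Slice) : ang x y ≤ Real.pi := angle_le_pi _ _

lemma ang_comm (x y : Slice) : ang x y = ang y x := angle_comm _ _

lemma ang_triangle (x y z : Slice) : ang x z ≤ ang x y + ang y z := angle_le_angle_add_angle _ _ _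

lemma ang_self (x : Slice) : ang x x = 0 := by
  rw [ang_eq_arccos]
  have := x.sq_sum
  rw [show x.1 0 * x.1 0 + x.1 1 * x.1 1 + x.1 2 * x.1 2 = 1 by linarith, Real.arccos_one]

lemma eq_of_cos_ang_eq_one {x y : Slice} (h : Real.cos (ang x y) = 1) : x = y := by
  rw [cos_ang] at h
  have hx := x.sq_sum
  have hy := y.sq_sum
  have h3 : (x.1 0 - y.1 0) ^ 2 + (x.1 1 - y.1 1) ^ 2 + (x.1 2 - y.1 2) ^ 2 = 0 := by nlinarith
  have h0 : (x.1 0 - y.1 0) ^ 2 = 0 := by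
    nlinarith [sq_nonneg (x.1 0 - y.1 0), sq_nonneg (x.1 1 - y.1 1), sq_nonneg (x.1 2 - y.1 2)]
  have h1 : (x.1 1 - y.1 1) ^ 2 = 0 := by
    nlinarith [sq_nonneg (x.1 0 - y.1 0), sq_nonneg (x.1 1 - y.1 1), sq_nonneg (x.1 2 - y.1 2)]
  exact Slice.ext_coords (sub_eq_zero.1 (pow_eq_zero_iff two_ne_zero |>.1 h0))
    (sub_eq_zero.1 (pow_eq_zero_iff two_ne_zero |>.1 h1))

lemma continuous_coord (i : Fin 3) : Continuous fun x : Slice => x.1 i := by fun_prop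

lemma continuous_ang (y : Slice) : Continuous fun x => ang x y := by
  simp only [ang_eq_arccos]
  fun_prop

lemma dist_sq_slice (x y : Slice) :
    dist x y ^ 2 = (x.1 0 - y.1 0) ^ 2 + (x.1 1 - y.1 1) ^ 2 + (x.1 2 - y.1 2) ^ 2 := by
  rw [Subtype.dist_eq, EuclideanSpace.dist_eq, Real.sq_sqrt (by positivity), Fin.sum_univ_three]
  simp [Real.dist_eq, sq_abs]

lemma dist_slice (x y : Slice) : dist x y = 2 * Real.sin (ang x y / 2) := by
  have h0 : 0 ≤ Real.sin (ang x y / 2) :=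
    Real.sin_nonneg_of_nonneg_of_le_pi (by linarith [ang_nonneg x y])
      (by linarith [ang_nonneg x y, ang_le_pi x y])
  rw [← sq_eq_sq₀ dist_nonneg (by positivity), dist_sq_slice]
  have h1 := cos_ang x y
  have h2 : Real.cos (ang x y) = 1 - 2 * Real.sin (ang x y / 2) ^ 2 := by
    have := Real.cos_two_mul (ang x y / 2)
    rw [show 2 * (ang x y / 2) = ang x y by ring] at this
    nlinarith [Real.sin_sq_add_cos_sq (ang x y / 2)]
  nlinarith [x.sq_sum, y.sq_sum]

lemma ang_eq_arcsin (x y : Slice) : ang x y = 2 * Real.arcsin (dist x y / 2) := by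
  rw [dist_slice, mul_div_cancel_left₀ _ two_ne_zero,
    Real.arcsin_sin (by linarith [ang_nonneg x y, Real.pi_pos]) (by linarith [ang_le_pi x y])]
  ring

/-! ## Causal curves -/

/-- The Lipschitz condition bounds chords, and a chord of length h only bounds the arc by 2
arcsin(h/2), which exceeds h. Adding up n short steps and refining removes the excess. -/
lemma IsCausalCurve.ang_le_partition {M : Set Slice} {c : ℝ → Slice} (hc : IsCausalCurve M c)
    (a h : ℝ) (hh : 0 ≤ h) (n : ℕ) :
    ang (c a) (c (a + n * h)) ≤ n * (2 * Real.arcsin (h / 2)) := by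
  induction n with
  | zero => simp [ang_self]
  | succ n ih =>
    have h1 := ang_triangle (c a) (c (a + n * h)) (c (a + (n + 1 : ℕ) * h))
    have h2 : ang (c (a + n * h)) (c (a + (n + 1 : ℕ) * h)) ≤ 2 * Real.arcsin (h / 2) := by
      rw [ang_eq_arcsin]
      have h3 := hc.1.dist_le_mul (a + n * h) (a + (n + 1 : ℕ) * h)
      rw [Real.dist_eq, show a + n * h - (a + (n + 1 : ℕ) * h) = -h by push_cast; ring, abs_neg,
        abs_of_nonneg hh, NNReal.coe_one, one_mul] at h3
      have := Real.monotone_arcsin (show dist (c (a + n * h)) (c (a + (n + 1 : ℕ) * h)) / 2 ≤ h / 2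
        by linarith)
      linarith
    push_cast at *
    linarith

/-- The terms are the slopes at 0 of x ↦ 2 arcsin(hx/2), taken at x = 1/(n+1), and h is its
derivative there. -/
lemma tendsto_mul_arcsin (h : ℝ) :
    Tendsto (fun n : ℕ => ((n + 1 : ℕ) : ℝ) * (2 * Real.arcsin (h / ((n + 1 : ℕ) : ℝ) / 2)))
      atTop (𝓝 h) := by
  have hd : HasDerivAt (fun x : ℝ => 2 * Real.arcsin (h * x / 2)) h 0 := by
    have h1 : HasDerivAt (fun x : ℝ => h * x / 2) (h / 2) 0 := by
      simpa using ((hasDerivAt_id (0 : ℝ)).const_mul h).div_const 2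
    have h2 := Real.hasDerivAt_arcsin (x := h * 0 / 2) (by norm_num) (by norm_num)
    have h3 := (h2.comp (0 : ℝ) h1).const_mul 2
    exact h3.congr_deriv (by rw [mul_zero, zero_div]; norm_num; ring)
  have hs := hd.tendsto_slope_zero_right
  have hn : Tendsto (fun n : ℕ => (((n + 1 : ℕ) : ℝ))⁻¹) atTop (𝓝[>] 0) :=
    tendsto_inv_atTop_nhdsGT_zero.comp
      (tendsto_natCast_atTop_atTop.comp (tendsto_add_atTop_nat 1))
  refine (hs.comp hn).congr fun n => ?_
  simp [div_eq_mul_inv]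

lemma IsCausalCurve.ang_le {M : Set Slice} {c : ℝ → Slice} (hc : IsCausalCurve M c) (a b : ℝ) :
    ang (c a) (c b) ≤ |a - b| := by
  wlog hab : a ≤ b generalizing a b
  · rw [ang_comm, abs_sub_comm]
    exact this b a (by linarith)
  rw [abs_sub_comm, abs_of_nonneg (by linarith)]
  refine ge_of_tendsto' (tendsto_mul_arcsin (b - a)) fun n => ?_
  have h := hc.ang_le_partition a ((b - a) / ((n + 1 : ℕ) : ℝ))
    (div_nonneg (by linarith) (by positivity)) (n + 1)
  rwa [mul_div_cancel₀ _ (by positivity), add_sub_cancel] at h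

/-! ### Meridians and the causal curves along them -/

/-- The meridian through the boundary point at angle `φ`, in the direction given by `β`. -/
noncomputable def meridian (φ β s : ℝ) : Slice :=
  ⟨!₂[Real.cos s * Real.cos φ - Real.sin s * Real.cos β * Real.sin φ,
      Real.cos s * Real.sin φ + Real.sin s * Real.cos β * Real.cos φ,
      -- The absolute value folds the great circle back into the upper hemisphere, so that the
      -- meridian exists for every s.
      |Real.sin s * Real.sin β|], by
    constructor
    · apply norm_sq_fin3
      rw [sq_abs]
      linear_combination (Real.cos s ^ 2 + Real.sin s ^ 2 * Real.cos β ^ 2) *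
        Real.sin_sq_add_cos_sq φ + Real.sin s ^ 2 * Real.sin_sq_add_cos_sq β +
        Real.sin_sq_add_cos_sq s
    · exact abs_nonneg _⟩

lemma meridian_mem_bdry {φ β s : ℝ} (h : Real.sin β = 0) : meridian φ β s ∈ bdry := by
  simp [bdry, meridian, h]

lemma cos_ang_bdryPoint (x : Slice) (φ : ℝ) :
    Real.cos (ang x (bdryPoint φ)) = x.1 0 * Real.cos φ + x.1 1 * Real.sin φ := by
  simp [cos_ang, bdryPoint]

lemma ang_meridian {φ β s : ℝ} (h0 : 0 ≤ s) (h1 : s ≤ Real.pi) :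
    ang (meridian φ β s) (bdryPoint φ) = s := by
  apply Real.injOn_cos ⟨ang_nonneg _ _, ang_le_pi _ _⟩ ⟨h0, h1⟩
  simp only [cos_ang_bdryPoint, meridian, Matrix.cons_val]
  linear_combination Real.cos s * Real.sin_sq_add_cos_sq φ

/-- A great circle is 1-Lipschitz because chords are shorter than arcs, 2 − 2 cos(s − t) ≤ (s − t)²,
and folding does not increase distances. -/
lemma lipschitz_meridian (φ β : ℝ) : LipschitzWith 1 (meridian φ β) := by
  apply LipschitzWith.of_dist_le_mul
  intro s t
  rw [NNReal.coe_one, one_mul, Real.dist_eq, ← sq_le_sq₀ dist_nonneg (abs_nonneg _), sq_abs,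
    dist_sq_slice]
  simp only [meridian, Matrix.cons_val]
  have h1 : (|Real.sin s * Real.sin β| - |Real.sin t * Real.sin β|) ^ 2 ≤
      (Real.sin s * Real.sin β - Real.sin t * Real.sin β) ^ 2 :=
    sq_le_sq.2 (abs_abs_sub_abs_le_abs_sub _ _)
  have h2 : 2 - 2 * Real.cos (s - t) ≤ (s - t) ^ 2 := by
    linarith [Real.one_sub_sq_div_two_le_cos (x := s - t)]
  rw [Real.cos_sub] at h2
  refine le_trans ?_ h2
  refine le_trans (add_le_add_right h1 _) (le_of_eq ?_)
  linear_combination ((Real.cos s - Real.cos t) ^ 2 + (Real.sin s - Real.sin t) ^ 2 *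
    Real.cos β ^ 2) * Real.sin_sq_add_cos_sq φ + (Real.sin s - Real.sin t) ^ 2 *
    Real.sin_sq_add_cos_sq β + Real.sin_sq_add_cos_sq s + Real.sin_sq_add_cos_sq t

lemma exists_meridian (φ : ℝ) (x : Slice) :
    ∃ β, x = meridian φ β (ang x (bdryPoint φ)) ∧ (x ∈ bdry → Real.sin β = 0) := by
  set θ := ang x (bdryPoint φ) with hθ
  have hc := cos_ang_bdryPoint x φ
  rw [← hθ] at hc
  have hs0 : 0 ≤ Real.sin θ := Real.sin_nonneg_of_nonneg_of_le_pi (ang_nonneg _ _) (ang_le_pi _ _)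
  set y := -x.1 0 * Real.sin φ + x.1 1 * Real.cos φ with hy
  have hφ := Real.sin_sq_add_cos_sq φ
  have hx0 : x.1 0 = Real.cos θ * Real.cos φ - y * Real.sin φ := by
    rw [hc, hy]; linear_combination -x.1 0 * hφ
  have hx1 : x.1 1 = Real.cos θ * Real.sin φ + y * Real.cos φ := by
    rw [hc, hy]; linear_combination -x.1 1 * hφ
  have hsq : y ^ 2 + x.1 2 ^ 2 = Real.sin θ ^ 2 := by
    have h1 := x.sq_sum
    rw [hx0, hx1] at h1
    linear_combination h1 - (Real.cos θ ^ 2 + y ^ 2) * hφ - Real.sin_sq_add_cos_sq θ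
  -- Where sin θ = 0 the point is `bdryPoint φ` or its antipode and lies on every meridian.
  -- Elsewhere cos β is the transverse component y divided by sin θ.
  rcases hs0.eq_or_lt with hs | hs
  · rw [← hs] at hsq
    have hy0 : y = 0 := by nlinarith [sq_nonneg (x.1 2)]
    refine ⟨0, Slice.ext_coords ?_ ?_, fun _ => Real.sin_zero⟩
    · simp [meridian, ← hs]; rw [hx0, hy0]; ring
    · simp [meridian, ← hs]; rw [hx1, hy0]; ring
  · have hq : (y / Real.sin θ) ^ 2 ≤ 1 := by
      rw [div_pow, div_le_one (by positivity)]
      nlinarith [sq_nonneg (x.1 2)]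
    have hq' := abs_le.1 ((sq_le_one_iff_abs_le_one _).1 hq)
    have hcos := Real.cos_arccos hq'.1 hq'.2
    refine ⟨Real.arccos (y / Real.sin θ), Slice.ext_coords ?_ ?_, fun hb => ?_⟩
    · simp only [meridian, hcos, Matrix.cons_val]
      rw [hx0]; field_simp
    · simp only [meridian, hcos, Matrix.cons_val]
      rw [hx1]; field_simp
    · have hb' : x.1 2 = 0 := hb
      rw [hb'] at hsq
      rw [Real.sin_arccos, div_pow, ← hsq]
      have : y ^ 2 ≠ 0 := by
        have : 0 < Real.sin θ ^ 2 := by positivity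
        nlinarith
      simp [this]

/-- The whole slice and its boundary circle are both unions of meridians. Besides containing all
boundary points, this is all that is needed of `M`, so bulk and boundary share their causal lemmas.
-/
lemma exists_meridian_mem {M : Set Slice} (hM : M = Set.univ ∨ M = bdry) (φ : ℝ) {x : Slice}
    (hx : x ∈ M) :
    ∃ β, x = meridian φ β (ang x (bdryPoint φ)) ∧ ∀ s, meridian φ β s ∈ M := by
  obtain ⟨β, h1, h2⟩ := exists_meridian φ x
  refine ⟨β, h1, fun s => ?_⟩
  rcases hM with rfl | rfl
  · trivial
  · exact meridian_mem_bdry (h2 hx)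

lemma exists_causalCurve {M : Set Slice} (hM : M = Set.univ ∨ M = bdry) (φ : ℝ) {x : Slice}
    (hx : x ∈ M) {θ t t' : ℝ} (h0 : 0 ≤ θ) (h1 : θ ≤ Real.pi)
    (h : |θ - ang x (bdryPoint φ)| ≤ |t' - t|) :
    ∃ c, IsCausalCurve M c ∧ c t = x ∧ ang (c t') (bdryPoint φ) = θ := by
  obtain ⟨β, hβ, hm⟩ := exists_meridian_mem hM φ hx
  set θ₀ := ang x (bdryPoint φ)
  set k := (θ - θ₀) / (t' - t) with hk
  have hk1 : |k| ≤ 1 := by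
    rw [hk, abs_div]
    exact div_le_one_of_le₀ h (abs_nonneg _)
  refine ⟨fun r => meridian φ β (θ₀ + k * (r - t)), ⟨?_, fun r => hm _⟩, ?_, ?_⟩
  · have h2 : LipschitzWith 1 fun r => θ₀ + k * (r - t) := by
      apply LipschitzWith.of_dist_le_mul
      intro r s
      rw [NNReal.coe_one, one_mul, Real.dist_eq, Real.dist_eq,
        show θ₀ + k * (r - t) - (θ₀ + k * (s - t)) = k * (r - s) by ring, abs_mul]
      exact mul_le_of_le_one_left (abs_nonneg _) hk1
    simpa [Function.comp_def] using (lipschitz_meridian φ β).comp h2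
  · simp only [sub_self, mul_zero, add_zero]
    exact hβ.symm
  · have h3 : θ₀ + k * (t' - t) = θ := by
      -- If the times agree then the speed `k` is a division by zero, but the hypothesis already
      -- forces θ = θ₀.
      by_cases ht : t' - t = 0
      · rw [ht, abs_zero] at h
        have := abs_eq_zero.1 (le_antisymm h (abs_nonneg _))
        rw [ht]; linarith
      · rw [hk, div_mul_cancel₀ _ ht]; ring
    simp only [h3]
    exact ang_meridian h0 h1

lemma eq_of_ang_eq_zero {x y : Slice} (h : ang x y = 0) : x = y :=
  eq_of_cos_ang_eq_one (by rw [h, Real.cos_zero])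

lemma exists_causalCurve_to_bdryPoint {M : Set Slice} (hM : M = Set.univ ∨ M = bdry) (φ : ℝ)
    {x : Slice} (hx : x ∈ M) {t t' : ℝ} (h : ang x (bdryPoint φ) ≤ |t' - t|) :
    ∃ c, IsCausalCurve M c ∧ c t = x ∧ c t' = bdryPoint φ := by
  obtain ⟨c, hc, h1, h2⟩ := exists_causalCurve hM φ hx le_rfl Real.pi_pos.le (t := t) (t' := t')
    (by rwa [zero_sub, abs_neg, abs_of_nonneg (ang_nonneg _ _)])
  exact ⟨c, hc, h1, eq_of_ang_eq_zero h2⟩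

/-- Distances to antipodal points add up to π. This lets two opposite caps be described by the
distance to one centre. -/
lemma ang_bdryPoint_add_pi (x : Slice) (φ : ℝ) :
    ang x (bdryPoint (φ + Real.pi)) = Real.pi - ang x (bdryPoint φ) := by
  apply Real.injOn_cos ⟨ang_nonneg _ _, ang_le_pi _ _⟩
    ⟨by linarith [ang_le_pi x (bdryPoint φ)], by linarith [ang_nonneg x (bdryPoint φ)]⟩
  rw [Real.cos_pi_sub, cos_ang_bdryPoint, cos_ang_bdryPoint, Real.cos_add_pi, Real.sin_add_pi]
  ring

lemma ang_bdryPoint_bdryPoint {a b : ℝ} (h : |a - b| ≤ Real.pi) :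
    ang (bdryPoint a) (bdryPoint b) = |a - b| := by
  apply Real.injOn_cos ⟨ang_nonneg _ _, ang_le_pi _ _⟩ ⟨abs_nonneg _, h⟩
  rw [cos_ang_bdryPoint, Real.cos_abs, Real.cos_sub]
  simp [bdryPoint]

lemma bdryPoint_mem_bdry (φ : ℝ) : bdryPoint φ ∈ bdry := by simp [bdry, bdryPoint]

lemma bdryPoint_mem {M : Set Slice} (hM : M = Set.univ ∨ M = bdry) (φ : ℝ) : bdryPoint φ ∈ M := by
  rcases hM with rfl | rfl
  · trivial
  · exact bdryPoint_mem_bdry φ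

/-! ## Domains of dependence -/

/-- A point deeper in the cap than the elapsed time cannot leave it before t₀, and any other point
can, by receding from the centre at unit speed. -/
lemma mem_domainOfDependence_cap {M S : Set Slice} (hM : M = Set.univ ∨ M = bdry) {φ w t₀ : ℝ}
    (hw : w < Real.pi) (hS : ∀ x ∈ M, x ∈ S ↔ ang x (bdryPoint φ) ≤ w) (p : Spacetime) :
    p ∈ domainOfDependence M (atTime t₀ S) ↔
      p.2 ∈ M ∧ ang p.2 (bdryPoint φ) ≤ w - |p.1 - t₀| := by
  constructor
  · rintro ⟨hp, h⟩
    refine ⟨hp, ?_⟩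
    by_contra! hlt
    have h0 := ang_nonneg p.2 (bdryPoint φ)
    have h1 := ang_le_pi p.2 (bdryPoint φ)
    have h2 := abs_nonneg (p.1 - t₀)
    -- The escape stops at the antipode, distance π, if it is reached early; it lies outside the cap
    -- since w < π.
    obtain ⟨c, hc, hc1, hc2⟩ := exists_causalCurve hM φ hp
      (θ := min (ang p.2 (bdryPoint φ) + |p.1 - t₀|) Real.pi) (t := p.1) (t' := t₀)
      (le_min (by linarith) Real.pi_pos.le) (min_le_right _ _) (by
        rw [abs_sub_comm t₀, abs_of_nonneg (sub_nonneg.2 (le_min (by linarith) h1))]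
        linarith [min_le_left (ang p.2 (bdryPoint φ) + |p.1 - t₀|) Real.pi])
    obtain ⟨t, ht, hmem⟩ := h c hc hc1
    simp only at ht hmem
    rw [ht, hS _ (hc.2 _), hc2] at hmem
    exact absurd hmem (not_le.2 (lt_min (by linarith) hw))
  · rintro ⟨hp, h⟩
    refine ⟨hp, fun c hc hcp => ⟨t₀, rfl, ?_⟩⟩
    rw [hS _ (hc.2 _)]
    have h1 := ang_triangle (c t₀) p.2 (bdryPoint φ)
    have h2 := hc.ang_le t₀ p.1
    rw [hcp, abs_sub_comm] at h2
    linarith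

lemma mem_domainOfDependence_two_caps {M S : Set Slice} (hM : M = Set.univ ∨ M = bdry)
    {φ w t₀ : ℝ} (hw : w < Real.pi / 2)
    (hS : ∀ x ∈ M, x ∈ S ↔ ang x (bdryPoint φ) ≤ w ∨ Real.pi - w ≤ ang x (bdryPoint φ))
    (p : Spacetime) :
    p ∈ domainOfDependence M (atTime t₀ S) ↔ p.2 ∈ M ∧
      (ang p.2 (bdryPoint φ) ≤ w - |p.1 - t₀| ∨
        Real.pi - (w - |p.1 - t₀|) ≤ ang p.2 (bdryPoint φ)) := by
  constructor
  · rintro ⟨hp, h⟩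
    refine ⟨hp, ?_⟩
    have h0 := ang_nonneg p.2 (bdryPoint φ)
    have h1 := ang_le_pi p.2 (bdryPoint φ)
    have h2 := abs_nonneg (p.1 - t₀)
    have key : ∀ θ, 0 ≤ θ → θ ≤ Real.pi → |θ - ang p.2 (bdryPoint φ)| ≤ |p.1 - t₀| →
        θ ≤ w ∨ Real.pi - w ≤ θ := by
      intro θ hθ0 hθ1 hθ
      rw [abs_sub_comm p.1] at hθ
      obtain ⟨c, hc, hc1, hc2⟩ := exists_causalCurve hM φ hp hθ0 hθ1 hθ
      obtain ⟨t, ht, hmem⟩ := h c hc hc1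
      simp only at ht hmem
      rwa [ht, hS _ (hc.2 _), hc2] at hmem
    by_contra! hlt
    have h3 := key (ang p.2 (bdryPoint φ)) h0 h1 (by simp)
    rcases h3 with h3 | h3
    -- The curve leaves its cap towards the equator between the caps and stops there, since going
    -- beyond π/2 could lead into the opposite cap.
    · set θ := min (ang p.2 (bdryPoint φ) + |p.1 - t₀|) (Real.pi / 2) with hθ
      have e1 : θ ≤ ang p.2 (bdryPoint φ) + |p.1 - t₀| := min_le_left _ _
      have e2 : θ ≤ Real.pi / 2 := min_le_right _ _
      have e3 : ang p.2 (bdryPoint φ) ≤ θ := le_min (by linarith) (by linarith)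
      have e4 : w < θ := lt_min (by linarith) hw
      rcases key θ (by linarith) (by linarith)
        (by rw [abs_of_nonneg (by linarith)]; linarith) with h4 | h4 <;> linarith
    · set θ := max (ang p.2 (bdryPoint φ) - |p.1 - t₀|) (Real.pi / 2) with hθ
      have e1 : ang p.2 (bdryPoint φ) - |p.1 - t₀| ≤ θ := le_max_left _ _
      have e2 : Real.pi / 2 ≤ θ := le_max_right _ _
      have e3 : θ ≤ ang p.2 (bdryPoint φ) := max_le (by linarith) (by linarith)
      have e4 : θ < Real.pi - w := max_lt (by linarith) (by linarith)
      rcases key θ (by linarith) (by linarith)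
        (by rw [abs_of_nonpos (by linarith)]; linarith) with h4 | h4 <;> linarith
  · rintro ⟨hp, h⟩
    refine ⟨hp, fun c hc hcp => ⟨t₀, rfl, ?_⟩⟩
    rw [hS _ (hc.2 _)]
    have h1 := ang_triangle (c t₀) p.2 (bdryPoint φ)
    have h1' := ang_triangle p.2 (c t₀) (bdryPoint φ)
    have h2 := hc.ang_le t₀ p.1
    rw [hcp, abs_sub_comm] at h2
    rw [ang_comm p.2 (c t₀)] at h1'
    rcases h with h | h
    · left; linarith
    · right; linarith

/-! ## Causal futures and pasts of domains of dependence -/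

lemma causalFuture_subset_fst {M : Set Slice} {S : Set Spacetime} {p : Spacetime}
    (hp : p ∈ causalFuture M S) : p.2 ∈ M := by
  obtain ⟨q, -, -, c, hc, -, h⟩ := hp
  exact h ▸ hc.2 _

lemma causalPast_subset_fst {M : Set Slice} {S : Set Spacetime} {p : Spacetime}
    (hp : p ∈ causalPast M S) : p.2 ∈ M := by
  obtain ⟨q, -, -, c, hc, -, h⟩ := hp
  exact h ▸ hc.2 _

lemma exists_ang_le_of_mem_causalFuture {M : Set Slice} {S : Set Spacetime} {p : Spacetime}
    (hp : p ∈ causalFuture M S) : ∃ q ∈ S, ang p.2 q.2 ≤ p.1 - q.1 := by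
  obtain ⟨q, hq, hle, c, hc, h1, h2⟩ := hp
  refine ⟨q, hq, ?_⟩
  have := hc.ang_le p.1 q.1
  rwa [h1, h2, abs_of_nonneg (by linarith)] at this

lemma exists_ang_le_of_mem_causalPast {M : Set Slice} {S : Set Spacetime} {p : Spacetime}
    (hp : p ∈ causalPast M S) : ∃ q ∈ S, ang p.2 q.2 ≤ q.1 - p.1 := by
  obtain ⟨q, hq, hle, c, hc, h1, h2⟩ := hp
  refine ⟨q, hq, ?_⟩
  have := hc.ang_le p.1 q.1
  rwa [h1, h2, abs_sub_comm, abs_of_nonneg (by linarith)] at this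

lemma mem_causalFuture_of_bdryPoint {M : Set Slice} (hM : M = Set.univ ∨ M = bdry)
    {S : Set Spacetime} {p : Spacetime} (hp : p.2 ∈ M) {φ t : ℝ} (hS : (t, bdryPoint φ) ∈ S)
    (h : ang p.2 (bdryPoint φ) ≤ p.1 - t) : p ∈ causalFuture M S := by
  have h0 := ang_nonneg p.2 (bdryPoint φ)
  obtain ⟨c, hc, h1, h2⟩ := exists_causalCurve_to_bdryPoint hM φ hp (t := p.1) (t' := t)
    (by rwa [abs_sub_comm, abs_of_nonneg (by linarith)])
  exact ⟨_, hS, by simp only; linarith, c, hc, h2, h1⟩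

lemma mem_causalPast_of_bdryPoint {M : Set Slice} (hM : M = Set.univ ∨ M = bdry)
    {S : Set Spacetime} {p : Spacetime} (hp : p.2 ∈ M) {φ t : ℝ} (hS : (t, bdryPoint φ) ∈ S)
    (h : ang p.2 (bdryPoint φ) ≤ t - p.1) : p ∈ causalPast M S := by
  have h0 := ang_nonneg p.2 (bdryPoint φ)
  obtain ⟨c, hc, h1, h2⟩ := exists_causalCurve_to_bdryPoint hM φ hp (t := p.1) (t' := t)
    (by rwa [abs_of_nonneg (by linarith)])
  exact ⟨_, hS, by simp only; linarith, c, hc, h2, h1⟩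

lemma mem_causalFuture_singleton {M : Set Slice} (hM : M = Set.univ ∨ M = bdry)
    {p : Spacetime} {φ t : ℝ} :
    p ∈ causalFuture M {(t, bdryPoint φ)} ↔ p.2 ∈ M ∧ ang p.2 (bdryPoint φ) ≤ p.1 - t := by
  constructor
  · intro hp
    obtain ⟨q, rfl, hq⟩ := exists_ang_le_of_mem_causalFuture hp
    exact ⟨causalFuture_subset_fst hp, hq⟩
  · rintro ⟨hp, h⟩
    exact mem_causalFuture_of_bdryPoint hM hp rfl h

/-- The past tip (t₀ − w, `bdryPoint φ`) belongs to the domain of dependence, and its light cone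
already is the whole future. -/
lemma mem_causalFuture_cap {M S : Set Slice} (hM : M = Set.univ ∨ M = bdry) {φ w t₀ : ℝ}
    (hw0 : 0 ≤ w) (hw : w < Real.pi) (hS : ∀ x ∈ M, x ∈ S ↔ ang x (bdryPoint φ) ≤ w)
    (p : Spacetime) :
    p ∈ causalFuture M (domainOfDependence M (atTime t₀ S)) ↔
      p.2 ∈ M ∧ ang p.2 (bdryPoint φ) ≤ w + (p.1 - t₀) := by
  constructor
  · intro hp
    refine ⟨causalFuture_subset_fst hp, ?_⟩
    obtain ⟨q, hq, h⟩ := exists_ang_le_of_mem_causalFuture hp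
    rw [mem_domainOfDependence_cap hM hw hS] at hq
    linarith [ang_triangle p.2 q.2 (bdryPoint φ), neg_abs_le (q.1 - t₀), hq.2]
  · rintro ⟨hp, h⟩
    refine mem_causalFuture_of_bdryPoint hM hp (φ := φ) (t := t₀ - w) ?_ (by linarith)
    rw [mem_domainOfDependence_cap hM hw hS]
    refine ⟨bdryPoint_mem hM φ, ?_⟩
    simp only [ang_self]
    rw [show t₀ - w - t₀ = -w by ring, abs_neg, abs_of_nonneg hw0, sub_self]

section TwoCaps

variable {M S : Set Slice} {φ w : ℝ}

/-- Again the tips suffice: the past is the union of the past light cones of the two future tips, at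
time w over the antipodal centres. -/
lemma mem_causalPast_two_caps (hM : M = Set.univ ∨ M = bdry) (hw0 : 0 ≤ w) (hw : w < Real.pi / 2)
    (hS : ∀ x ∈ M, x ∈ S ↔ ang x (bdryPoint φ) ≤ w ∨ Real.pi - w ≤ ang x (bdryPoint φ))
    (p : Spacetime) :
    p ∈ causalPast M (domainOfDependence M (atTime 0 S)) ↔ p.2 ∈ M ∧
      (ang p.2 (bdryPoint φ) ≤ w - p.1 ∨ Real.pi - (w - p.1) ≤ ang p.2 (bdryPoint φ)) := by
  constructor
  · intro hp
    refine ⟨causalPast_subset_fst hp, ?_⟩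
    obtain ⟨q, hq, h⟩ := exists_ang_le_of_mem_causalPast hp
    rw [mem_domainOfDependence_two_caps hM hw hS, sub_zero] at hq
    have h1 := ang_triangle p.2 q.2 (bdryPoint φ)
    have h2 := ang_triangle q.2 p.2 (bdryPoint φ)
    rw [ang_comm q.2 p.2] at h2
    rcases hq.2 with h3 | h3
    · left; linarith [le_abs_self q.1]
    · right; linarith [le_abs_self q.1]
  · rintro ⟨hp, h | h⟩
    · refine mem_causalPast_of_bdryPoint hM hp (φ := φ) (t := w) ?_ h
      rw [mem_domainOfDependence_two_caps hM hw hS]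
      refine ⟨bdryPoint_mem hM φ, Or.inl ?_⟩
      simp only [ang_self, sub_zero]
      rw [abs_of_nonneg hw0, sub_self]
    · refine mem_causalPast_of_bdryPoint hM hp (φ := φ + Real.pi) (t := w) ?_
        (by rw [ang_bdryPoint_add_pi]; linarith)
      rw [mem_domainOfDependence_two_caps hM hw hS]
      refine ⟨bdryPoint_mem hM _, Or.inr ?_⟩
      have := ang_bdryPoint_add_pi (bdryPoint (φ + Real.pi)) φ
      rw [ang_self] at this
      simp only [sub_zero]
      rw [abs_of_nonneg hw0]
      linarith

lemma mem_causalFuture_two_caps (hM : M = Set.univ ∨ M = bdry) (hw0 : 0 ≤ w)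
    (hw : w < Real.pi / 2)
    (hS : ∀ x ∈ M, x ∈ S ↔ ang x (bdryPoint φ) ≤ w ∨ Real.pi - w ≤ ang x (bdryPoint φ))
    (p : Spacetime) :
    p ∈ causalFuture M (domainOfDependence M (atTime 0 S)) ↔ p.2 ∈ M ∧
      (ang p.2 (bdryPoint φ) ≤ w + p.1 ∨ Real.pi - (w + p.1) ≤ ang p.2 (bdryPoint φ)) := by
  constructor
  · intro hp
    refine ⟨causalFuture_subset_fst hp, ?_⟩
    obtain ⟨q, hq, h⟩ := exists_ang_le_of_mem_causalFuture hp
    rw [mem_domainOfDependence_two_caps hM hw hS, sub_zero] at hq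
    have h1 := ang_triangle p.2 q.2 (bdryPoint φ)
    have h2 := ang_triangle q.2 p.2 (bdryPoint φ)
    rw [ang_comm q.2 p.2] at h2
    rcases hq.2 with h3 | h3
    · left; linarith [neg_abs_le q.1]
    · right; linarith [neg_abs_le q.1]
  · rintro ⟨hp, h | h⟩
    · refine mem_causalFuture_of_bdryPoint hM hp (φ := φ) (t := -w) ?_ (by linarith)
      rw [mem_domainOfDependence_two_caps hM hw hS]
      refine ⟨bdryPoint_mem hM φ, Or.inl ?_⟩
      simp only [ang_self, sub_zero]
      rw [abs_neg, abs_of_nonneg hw0, sub_self]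
    · refine mem_causalFuture_of_bdryPoint hM hp (φ := φ + Real.pi) (t := -w) ?_
        (by rw [ang_bdryPoint_add_pi]; linarith)
      rw [mem_domainOfDependence_two_caps hM hw hS]
      refine ⟨bdryPoint_mem hM _, Or.inr ?_⟩
      have := ang_bdryPoint_add_pi (bdryPoint (φ + Real.pi)) φ
      rw [ang_self] at this
      simp only [sub_zero]
      rw [abs_neg, abs_of_nonneg hw0]
      linarith

lemma spacelikeComplement_two_caps (hM : M = Set.univ ∨ M = bdry) (hw0 : 0 ≤ w)
    (hw : w < Real.pi / 2)
    (hS : ∀ x ∈ M, x ∈ S ↔ ang x (bdryPoint φ) ≤ w ∨ Real.pi - w ≤ ang x (bdryPoint φ)) :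
    spacelikeComplement M (domainOfDependence M (atTime 0 S)) =
      closure {p : Spacetime | p.2 ∈ M ∧ w + |p.1| < ang p.2 (bdryPoint φ) ∧
        ang p.2 (bdryPoint φ) < Real.pi - (w + |p.1|)} := by
  rw [spacelikeComplement]
  congr 1
  ext p
  simp only [Set.mem_ofPred_eq, mem_causalFuture_two_caps hM hw0 hw hS,
    mem_causalPast_two_caps hM hw0 hw hS]
  constructor
  · rintro ⟨hp, h1, h2⟩
    have h1' := not_or.1 fun h => h1 ⟨hp, h⟩
    have h2' := not_or.1 fun h => h2 ⟨hp, h⟩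
    simp only [not_le] at h1' h2'
    refine ⟨hp, ?_, ?_⟩ <;> rcases abs_cases p.1 with h | h <;> linarith [h1'.1, h1'.2, h2'.1, h2'.2]
  · rintro ⟨hp, h1, h2⟩
    refine ⟨hp, ?_, ?_⟩ <;> rintro ⟨-, h | h⟩ <;> linarith [le_abs_self p.1, neg_abs_le p.1]

/-- The complement is the diamond over the strip between the caps. Its future tips are at time π/2 −
w and distance π/2 from the centre, and any point satisfying the inequalities reaches one of them
along a meridian. -/
lemma mem_causalPast_spacelikeComplement (hM : M = Set.univ ∨ M = bdry) (hw0 : 0 ≤ w)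
    (hw : w < Real.pi / 2)
    (hS : ∀ x ∈ M, x ∈ S ↔ ang x (bdryPoint φ) ≤ w ∨ Real.pi - w ≤ ang x (bdryPoint φ))
    (p : Spacetime) :
    p ∈ causalPast M (spacelikeComplement M (domainOfDependence M (atTime 0 S))) ↔ p.2 ∈ M ∧
      w + p.1 ≤ ang p.2 (bdryPoint φ) ∧ ang p.2 (bdryPoint φ) ≤ Real.pi - (w + p.1) := by
  rw [spacelikeComplement_two_caps hM hw0 hw hS]
  constructor
  · intro hp
    refine ⟨causalPast_subset_fst hp, ?_⟩
    obtain ⟨q, hq, h⟩ := exists_ang_le_of_mem_causalPast hp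
    have hcl : IsClosed {p : Spacetime | w + |p.1| ≤ ang p.2 (bdryPoint φ) ∧
        ang p.2 (bdryPoint φ) ≤ Real.pi - (w + |p.1|)} := by
      have hc : Continuous fun p : Spacetime => ang p.2 (bdryPoint φ) :=
        (continuous_ang _).comp continuous_snd
      exact (isClosed_le (by fun_prop) hc).inter (isClosed_le hc (by fun_prop))
    have hq' := closure_minimal (t := {p : Spacetime | w + |p.1| ≤ ang p.2 (bdryPoint φ) ∧
        ang p.2 (bdryPoint φ) ≤ Real.pi - (w + |p.1|)}) (fun r hr => ⟨hr.2.1.le, hr.2.2.le⟩) hcl hq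
    have h1 := ang_triangle p.2 q.2 (bdryPoint φ)
    have h2 := ang_triangle q.2 p.2 (bdryPoint φ)
    rw [ang_comm q.2 p.2] at h2
    have := le_abs_self q.1
    exact ⟨by linarith [hq'.1], by linarith [hq'.2]⟩
  · rintro ⟨hp, h1, h2⟩
    obtain ⟨c, hc, hc1, hc2⟩ := exists_causalCurve hM φ hp (θ := Real.pi / 2) (t := p.1)
      (t' := Real.pi / 2 - w) (by linarith [Real.pi_pos]) (by linarith [Real.pi_pos]) (by
        rw [abs_le]
        have := le_abs_self (Real.pi / 2 - w - p.1)
        constructor <;> linarith)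
    refine ⟨(Real.pi / 2 - w, c (Real.pi / 2 - w)), ?_, by simp only; linarith, c, hc, rfl, hc1⟩
    -- The tip itself is not spacelike to the caps; it belongs to the closure as the limit of the
    -- points below it at times in (0, π/2 − w).
    have hmem : Real.pi / 2 - w ∈ closure (Set.Ioo 0 (Real.pi / 2 - w)) := by
      rw [closure_Ioo (by linarith)]
      exact ⟨by linarith, le_rfl⟩
    refine map_mem_closure (f := fun s => ((s, c (Real.pi / 2 - w)) : Spacetime)) (by fun_prop)
      hmem ?_
    rintro s ⟨hs0, hs1⟩
    refine ⟨hc.2 _, ?_, ?_⟩ <;> simp only [hc2, abs_of_pos hs0] <;> linarith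

end TwoCaps

/-! ## Boundary arcs -/

lemma exists_eq_bdryPoint (φ : ℝ) {x : Slice} (hx : x ∈ bdry) :
    ∃ s, x = bdryPoint (φ + s) ∧ |s| = ang x (bdryPoint φ) := by
  obtain ⟨β, h1, h2⟩ := exists_meridian φ x
  have hs := h2 hx
  have h0 := ang_nonneg x (bdryPoint φ)
  set θ := ang x (bdryPoint φ)
  have hc : Real.cos β = 1 ∨ Real.cos β = -1 := by
    have := Real.sin_sq_add_cos_sq β
    rw [hs] at this
    exact sq_eq_sq_iff_eq_or_eq_neg.1 (by linarith)
  rcases hc with hc | hc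
  · refine ⟨θ, ?_, abs_of_nonneg h0⟩
    rw [h1]
    apply Slice.ext_coords <;>
      simp only [meridian, bdryPoint, hc, Matrix.cons_val, Real.cos_add, Real.sin_add] <;> ring
  · refine ⟨-θ, ?_, by rw [abs_neg, abs_of_nonneg h0]⟩
    rw [h1]
    apply Slice.ext_coords <;>
      simp only [meridian, bdryPoint, hc, Matrix.cons_val, Real.cos_add, Real.sin_add,
        Real.cos_neg, Real.sin_neg] <;> ring

lemma mem_arc_iff {φ w : ℝ} (hw : w ≤ Real.pi) {x : Slice} (hx : x ∈ bdry) :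
    x ∈ arc (φ - w) (φ + w) ↔ ang x (bdryPoint φ) ≤ w := by
  constructor
  · rintro ⟨a, ⟨h1, h2⟩, rfl⟩
    have h : |a - φ| ≤ w := abs_le.2 ⟨by linarith, by linarith⟩
    rwa [ang_bdryPoint_bdryPoint (h.trans hw)]
  · intro h
    obtain ⟨s, rfl, hs⟩ := exists_eq_bdryPoint φ hx
    rw [← hs, abs_le] at h
    exact ⟨_, ⟨by linarith, by linarith⟩, rfl⟩

lemma arc_subset_bdry (a b : ℝ) : arc a b ⊆ bdry := by
  rintro _ ⟨s, -, rfl⟩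
  exact bdryPoint_mem_bdry s

lemma V₁_eq (μ τ : ℝ) : V₁ μ τ = arc (-(μ / 2) - τ / 2) (-(μ / 2) + τ / 2) := by
  rw [V₁]; congr 1 <;> ring

lemma V₂_eq (μ τ : ℝ) : V₂ μ τ = arc (μ / 2 - τ / 2) (μ / 2 + τ / 2) := by
  rw [V₂]; congr 1 <;> ring

lemma mem_regionR_iff {μ : ℝ} (hμ : μ ≤ 2 * Real.pi) {x : Slice} (hx : x ∈ bdry) :
    x ∈ regionR μ ↔ ang x (bdryPoint 0) ≤ μ / 2 ∨ Real.pi - μ / 2 ≤ ang x (bdryPoint 0) := by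
  rw [regionR, Set.mem_union, show -(μ / 2) = 0 - μ / 2 by ring]
  nth_rw 2 [show μ / 2 = 0 + μ / 2 by ring]
  rw [mem_arc_iff (by linarith) hx, mem_arc_iff (by linarith) hx]
  have := ang_bdryPoint_add_pi x 0
  rw [zero_add] at this
  rw [this, sub_le_comm]

/-! ## Decision regions -/

lemma ang_bdryPoint_eq_or (a b : ℝ) (h : |a - b| ≤ 2 * Real.pi) :
    (|a - b| ≤ Real.pi ∧ ang (bdryPoint a) (bdryPoint b) = |a - b|) ∨
    ang (bdryPoint a) (bdryPoint b) = 2 * Real.pi - |a - b| := by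
  rcases le_total |a - b| Real.pi with h1 | h1
  · exact Or.inl ⟨h1, ang_bdryPoint_bdryPoint h1⟩
  · right
    apply Real.injOn_cos ⟨ang_nonneg _ _, ang_le_pi _ _⟩ ⟨by linarith, by linarith⟩
    rw [cos_ang_bdryPoint, Real.cos_two_pi_sub, Real.cos_abs, Real.cos_sub]
    simp [bdryPoint]

/-- With s the signed angle of the point, the conditions say |s − α| ≤ τ + t and that |s| differs
from |α| = μ/2 by at most −t. As τ < μ, the angles s and α have the same sign, so |s − α| ≤ −t, and
min(τ + t, −t) = τ/2 − |t + τ/2|. Sending to the opposite interval is too slow because τ < π − μ. -/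
lemma decisionRegion_eq {μ τ α : ℝ} (h0 : 0 < τ)
    (h1 : τ < Real.pi - μ) (h2 : τ < μ) (hα : |α| = μ / 2) :
    decisionRegion μ (-τ, bdryPoint α) =
      domainOfDependence bdry (atTime (-(τ / 2)) (arc (α - τ / 2) (α + τ / 2))) := by
  have hM : (bdry : Set Slice) = Set.univ ∨ (bdry : Set Slice) = bdry := Or.inr rfl
  ext p
  rw [mem_domainOfDependence_cap hM (by linarith) fun x hx => mem_arc_iff (by linarith) hx]
  simp only [decisionRegion, Set.mem_inter_iff, hatR]
  rw [mem_causalFuture_singleton hM,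
    mem_causalPast_two_caps hM (by linarith) (by linarith)
      (fun x hx => mem_regionR_iff (by linarith) hx),
    mem_causalPast_spacelikeComplement hM (by linarith) (by linarith)
      (fun x hx => mem_regionR_iff (by linarith) hx)]
  have hαang : ang (bdryPoint α) (bdryPoint 0) = μ / 2 := by
    rw [ang_bdryPoint_bdryPoint] <;> rw [sub_zero, hα]
    linarith
  constructor
  · rintro ⟨⟨⟨hp, h3⟩, -, h4⟩, -, h5, h6⟩
    refine ⟨hp, ?_⟩
    obtain ⟨s, hs, hs'⟩ := exists_eq_bdryPoint 0 hp
    have hpi := ang_le_pi p.2 (bdryPoint 0)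
    rw [zero_add] at hs
    have h7 := ang_triangle p.2 (bdryPoint α) (bdryPoint 0)
    have h7' := ang_triangle (bdryPoint α) p.2 (bdryPoint 0)
    rw [ang_comm (bdryPoint α) p.2] at h7'
    have ht : p.1 ≤ 0 := by rcases h4 with h4 | h4 <;> linarith
    rcases h4 with h4 | h4
    · have h8 := ang_bdryPoint_eq_or s α (by
        have := abs_sub s α; linarith)
      rw [← hs] at h8
      rw [← hs'] at h4 h5 h6 hpi
      rcases h8 with ⟨h9, h8⟩ | h8
      · rw [h8] at h3 ⊢
        rcases abs_cases s with e1 | e1 <;> rcases abs_cases α with e2 | e2 <;>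
          rcases abs_cases (s - α) with e3 | e3 <;>
          rcases abs_cases (p.1 - -(τ / 2)) with e4 | e4 <;> linarith
      · have := abs_sub s α
        linarith
    · linarith
  · rintro ⟨hp, h3⟩
    have h7 := ang_triangle p.2 (bdryPoint α) (bdryPoint 0)
    have h7' := ang_triangle (bdryPoint α) p.2 (bdryPoint 0)
    rw [ang_comm (bdryPoint α) p.2] at h7'
    have h8 := le_abs_self (p.1 - -(τ / 2))
    have h9 := neg_abs_le (p.1 - -(τ / 2))
    refine ⟨⟨⟨hp, by linarith⟩, hp, Or.inl (by linarith)⟩, hp, by linarith, by linarith⟩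

/-! ## Bulk scattering -/

/-- The function f(t) = cos(m + t) cos m − cos(t + τ) satisfies f'' = −f, so `key` expresses it
through f(0) and f(−τ) with weights sin(t + τ) and sin(−t), nonnegative and not both zero. Since
f(−τ) < 0, having f(0) < 0 as well would make f negative throughout. -/
lemma scattering_sinusoid {m τ t : ℝ} (h0 : 0 < τ) (hτ : τ < Real.pi) (ht0 : -τ ≤ t) (ht : t ≤ 0)
    (hm : 0 < m) (hm2 : m < Real.pi / 2) (h : Real.cos (t + τ) ≤ Real.cos (m + t) * Real.cos m) :
    Real.cos τ ≤ Real.cos m ^ 2 := by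
  by_contra! hlt
  have hs : 0 < Real.sin τ := Real.sin_pos_of_pos_of_lt_pi h0 hτ
  have h1 : 0 ≤ Real.sin (t + τ) := Real.sin_nonneg_of_nonneg_of_le_pi (by linarith) (by linarith)
  have h2 : 0 ≤ Real.sin (-t) := Real.sin_nonneg_of_nonneg_of_le_pi (by linarith) (by linarith)
  have hcm : 0 < Real.cos m := Real.cos_pos_of_mem_Ioo ⟨by linarith, by linarith⟩
  have hcm1 : Real.cos m < 1 := by
    rw [← Real.cos_zero]
    exact Real.cos_lt_cos_of_nonneg_of_le_pi le_rfl (by linarith) hm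
  have h3 : Real.cos (m - τ) * Real.cos m < 1 := by
    nlinarith [Real.cos_le_one (m - τ)]
  have key : Real.sin τ * (Real.cos (m + t) * Real.cos m - Real.cos (t + τ)) =
      Real.sin (t + τ) * (Real.cos m ^ 2 - Real.cos τ) +
      Real.sin (-t) * (Real.cos (m - τ) * Real.cos m - 1) := by
    simp only [Real.cos_add, Real.sin_add, Real.sin_neg, Real.cos_sub]
    linear_combination Real.sin t * Real.sin_sq_add_cos_sq τ
  have h4 : 0 ≤ Real.sin τ * (Real.cos (m + t) * Real.cos m - Real.cos (t + τ)) :=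
    mul_nonneg hs.le (by linarith)
  rw [key] at h4
  have h5 : 0 < Real.sin (t + τ) ∨ 0 < Real.sin (-t) := by
    rcases ht0.eq_or_lt with h | h
    · right; rw [← h, neg_neg]; exact hs
    · left; exact Real.sin_pos_of_pos_of_lt_pi (by linarith) (by linarith)
  rcases h5 with h5 | h5
  · nlinarith [mul_pos h5 (sub_pos.2 hlt), mul_nonneg h2 (sub_pos.2 h3).le]
  · nlinarith [mul_nonneg h1 (sub_pos.2 hlt).le, mul_pos h5 (sub_pos.2 h3)]

/-- The hemisphere point above the axis of the region `R`. -/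
noncomputable def axisPoint (m : ℝ) : Slice :=
  ⟨!₂[Real.cos m, 0, |Real.sin m|], by
    constructor
    · apply norm_sq_fin3
      rw [sq_abs]
      linarith [Real.sin_sq_add_cos_sq m]
    · exact abs_nonneg _⟩

/-- The spherical cap of radius `w` about a boundary point: a half-plane of the slice. -/
def cap (φ w : ℝ) : Set Slice := {x | ang x (bdryPoint φ) ≤ w}

lemma mem_cap {φ w : ℝ} {x : Slice} : x ∈ cap φ w ↔ ang x (bdryPoint φ) ≤ w := Iff.rfl

lemma mem_cap_union_cap {φ w : ℝ} {x : Slice} : x ∈ cap φ w ∪ cap (φ + Real.pi) w ↔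
    ang x (bdryPoint φ) ≤ w ∨ Real.pi - w ≤ ang x (bdryPoint φ) := by
  rw [Set.mem_union, mem_cap, mem_cap, ang_bdryPoint_add_pi, sub_le_comm]

/-- Averaging the conditions from the two inputs eliminates the coordinate x₁, and the condition
from the complement bounds x₀ by cos(μ/2 + t). What remains is the sinusoidal inequality in t. -/
lemma scatteringRegion_nonempty_iff {μ τ : ℝ} (hμ : Real.pi / 2 ≤ μ) (h0 : 0 < τ)
    (hτ : τ ≤ Real.pi - μ)
    (hE : entanglementWedge (-(τ / 2)) (V₁ μ τ) = domainOfDependence Set.univ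
      (atTime (-(τ / 2)) (cap (-(μ / 2)) (τ / 2))))
    (hE₂ : easyWedge (-(τ / 2)) (V₂ μ τ) = domainOfDependence Set.univ
      (atTime (-(τ / 2)) (cap (μ / 2) (τ / 2))))
    (hR : easyWedge 0 (regionR μ) = domainOfDependence Set.univ
      (atTime 0 (cap 0 (μ / 2) ∪ cap (0 + Real.pi) (μ / 2)))) :
    (scatteringRegion μ τ).Nonempty ↔ Real.cos τ ≤ Real.cos (μ / 2) ^ 2 := by
  have hM : (Set.univ : Set Slice) = Set.univ ∨ (Set.univ : Set Slice) = bdry := Or.inl rfl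
  have hpi := Real.pi_pos
  have hmem : ∀ p, p ∈ scatteringRegion μ τ ↔ p.2 ∈ bulk ∧
      ang p.2 (bdryPoint (-(μ / 2))) ≤ τ + p.1 ∧ ang p.2 (bdryPoint (μ / 2)) ≤ τ + p.1 ∧
      (ang p.2 (bdryPoint 0) ≤ μ / 2 - p.1 ∨ Real.pi - (μ / 2 - p.1) ≤ ang p.2 (bdryPoint 0)) ∧
      μ / 2 + p.1 ≤ ang p.2 (bdryPoint 0) ∧ ang p.2 (bdryPoint 0) ≤ Real.pi - (μ / 2 + p.1) := by
    intro p
    rw [scatteringRegion, Set.mem_ofPred_eq, hardWedge, hE, hE₂, hR,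
      mem_causalFuture_cap hM (by linarith) (by linarith) (fun x _ => mem_cap),
      mem_causalFuture_cap hM (by linarith) (by linarith) (fun x _ => mem_cap),
      mem_causalPast_two_caps hM (by linarith) (by linarith) (fun x _ => mem_cap_union_cap),
      mem_causalPast_spacelikeComplement hM (by linarith) (by linarith)
        (fun x _ => mem_cap_union_cap),
      show τ / 2 + (p.1 - -(τ / 2)) = τ + p.1 by ring]
    simp
  constructor
  · rintro ⟨p, hp⟩
    rw [hmem] at hp
    obtain ⟨-, h1, h2, h3, h4, h5⟩ := hp
    have ht : p.1 ≤ 0 := by rcases h3 with h3 | h3 <;> linarith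
    have ht0 : 0 ≤ τ + p.1 := (ang_nonneg _ _).trans h1
    have c1 := Real.cos_le_cos_of_nonneg_of_le_pi (ang_nonneg _ _) (by linarith) h1
    have c2 := Real.cos_le_cos_of_nonneg_of_le_pi (ang_nonneg _ _) (by linarith) h2
    rw [cos_ang_bdryPoint] at c1 c2
    rw [Real.cos_neg, Real.sin_neg] at c1
    have c3 : Real.cos (τ + p.1) ≤ p.2.1 0 * Real.cos (μ / 2) := by linarith
    have hc : 0 ≤ Real.cos (μ / 2) := Real.cos_nonneg_of_mem_Icc ⟨by linarith, by linarith⟩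
    have hx0 : p.2.1 0 = Real.cos (ang p.2 (bdryPoint 0)) := by simp [cos_ang_bdryPoint]
    -- Monotonicity of the cosine needs this sign. If t < −μ/2, then τ + t ≥ μ/2 would give τ > μ,
    -- against τ ≤ π − μ ≤ μ.
    have h6 : 0 ≤ μ / 2 + p.1 := by
      by_contra! hneg
      have h7 : Real.cos (τ + p.1) ≤ Real.cos (μ / 2) := by
        have := Real.cos_le_one (ang p.2 (bdryPoint 0))
        rw [← hx0] at this
        nlinarith
      have h8 := (Real.strictAntiOn_cos.le_iff_ge (show τ + p.1 ∈ Set.Icc 0 Real.pi from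
        ⟨ht0, by linarith⟩) (show μ / 2 ∈ Set.Icc 0 Real.pi from ⟨by linarith, by linarith⟩)).1 h7
      linarith
    have c4 := Real.cos_le_cos_of_nonneg_of_le_pi h6 (ang_le_pi _ _) h4
    rw [← hx0] at c4
    refine scattering_sinusoid h0 (by linarith) (by linarith) ht (by linarith) (by linarith)
      (t := p.1) ?_
    rw [add_comm]
    exact c3.trans (mul_le_mul_of_nonneg_right c4 hc)
  · intro h
    have hsin : 0 < Real.sin (μ / 2) := Real.sin_pos_of_pos_of_lt_pi (by linarith) (by linarith)
    have e : ∀ φ, Real.cos (ang (axisPoint (μ / 2)) (bdryPoint φ)) =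
        Real.cos (μ / 2) * Real.cos φ := by
      intro φ
      simp [cos_ang_bdryPoint, axisPoint]
    have e0 : ang (axisPoint (μ / 2)) (bdryPoint 0) = μ / 2 := by
      apply Real.injOn_cos ⟨ang_nonneg _ _, ang_le_pi _ _⟩ ⟨by linarith, by linarith⟩
      rw [e, Real.cos_zero, mul_one]
    have e1 : ∀ φ, Real.cos φ = Real.cos (μ / 2) →
        ang (axisPoint (μ / 2)) (bdryPoint φ) ≤ τ := by
      intro φ hφ
      apply (Real.strictAntiOn_cos.le_iff_ge (show τ ∈ Set.Icc 0 Real.pi from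
        ⟨h0.le, by linarith⟩) ⟨ang_nonneg _ _, ang_le_pi _ _⟩).1
      rw [e, hφ, ← sq]
      exact h
    -- At t = 0 this point lies on the appetizer, the common edge of the easy and hard wedges,
    -- midway between the two inputs.
    refine ⟨(0, axisPoint (μ / 2)), (hmem _).2 ⟨?_, ?_, ?_, ?_, ?_, ?_⟩⟩
    · simp [bulk, axisPoint, hsin.ne']
    · simpa using e1 (-(μ / 2)) (Real.cos_neg _)
    · simpa using e1 (μ / 2) rfl
    · left; simp [e0]
    · simp [e0]
    · simp only [e0]; linarith

/-! ## The Klein model of the slice -/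

/-- The slice point over a point of the closed unit disc (with a continuous extension to the
plane). -/
noncomputable def kleinLift (p : ℝ × ℝ) : Slice :=
  ⟨!₂[p.1 / max 1 √(p.1 ^ 2 + p.2 ^ 2), p.2 / max 1 √(p.1 ^ 2 + p.2 ^ 2),
      √(1 - (p.1 ^ 2 + p.2 ^ 2) / max 1 √(p.1 ^ 2 + p.2 ^ 2) ^ 2)], by
    have h1 : (0 : ℝ) < max 1 √(p.1 ^ 2 + p.2 ^ 2) := lt_max_of_lt_left one_pos
    have h2 : (p.1 ^ 2 + p.2 ^ 2) / max 1 √(p.1 ^ 2 + p.2 ^ 2) ^ 2 ≤ 1 := by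
      rw [div_le_one (by positivity), ← Real.sqrt_le_left h1.le]
      exact le_max_right _ _
    constructor
    · apply norm_sq_fin3
      rw [Real.sq_sqrt (by linarith), div_pow, div_pow]
      ring
    · exact Real.sqrt_nonneg _⟩

lemma continuous_kleinLift : Continuous kleinLift := by
  have h (p : ℝ × ℝ) : max 1 √(p.1 ^ 2 + p.2 ^ 2) ≠ 0 := (lt_max_of_lt_left one_pos).ne'
  have h' (p : ℝ × ℝ) : max 1 √(p.1 ^ 2 + p.2 ^ 2) ^ 2 ≠ 0 := pow_ne_zero _ (h p)
  refine Continuous.subtype_mk ?_ _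
  refine (PiLp.continuous_toLp 2 _).comp (continuous_pi fun i => ?_)
  fin_cases i
  · exact Continuous.div (by fun_prop) (by fun_prop) h
  · exact Continuous.div (by fun_prop) (by fun_prop) h
  · exact Real.continuous_sqrt.comp
      (continuous_const.sub (Continuous.div (by fun_prop) (by fun_prop) h'))

lemma kleinLift_zero {a b : ℝ} (h : a ^ 2 + b ^ 2 ≤ 1) : (kleinLift (a, b)).1 0 = a := by
  have : max 1 √(a ^ 2 + b ^ 2) = 1 := max_eq_left (Real.sqrt_le_one.2 h)
  simp [kleinLift, this]

lemma kleinLift_one {a b : ℝ} (h : a ^ 2 + b ^ 2 ≤ 1) : (kleinLift (a, b)).1 1 = b := by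
  have : max 1 √(a ^ 2 + b ^ 2) = 1 := max_eq_left (Real.sqrt_le_one.2 h)
  simp [kleinLift, this]

lemma Slice.sq_le_one (x : Slice) : x.1 0 ^ 2 + x.1 1 ^ 2 ≤ 1 := by
  linarith [x.sq_sum, sq_nonneg (x.1 2)]

lemma kleinLift_coords (x : Slice) : kleinLift (x.1 0, x.1 1) = x :=
  Slice.ext_coords (kleinLift_zero x.sq_le_one) (kleinLift_one x.sq_le_one)

/-- The straight segment of the Klein model from `x` (at `r = 0`) to `y` (at `r = 1`). -/
noncomputable def seg (x y : Slice) (r : ℝ) : Slice :=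
  kleinLift ((1 - r) * x.1 0 + r * y.1 0, (1 - r) * x.1 1 + r * y.1 1)

lemma continuous_seg (x y : Slice) : Continuous (seg x y) :=
  continuous_kleinLift.comp (by fun_prop)

lemma seg_aux (x y : Slice) {r : ℝ} (h0 : 0 ≤ r) (h1 : r ≤ 1) :
    ((1 - r) * x.1 0 + r * y.1 0) ^ 2 + ((1 - r) * x.1 1 + r * y.1 1) ^ 2 ≤ 1 := by
  have hx := x.sq_le_one
  have hy := y.sq_le_one
  have h2 : 0 ≤ r * (1 - r) := mul_nonneg h0 (by linarith)
  nlinarith [mul_nonneg h2 (add_nonneg (sq_nonneg (x.1 0 - y.1 0)) (sq_nonneg (x.1 1 - y.1 1))),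
    mul_nonneg h0 (sub_nonneg.2 hy), mul_nonneg (sub_nonneg.2 h1) (sub_nonneg.2 hx)]

lemma seg_coord_zero (x y : Slice) {r : ℝ} (h0 : 0 ≤ r) (h1 : r ≤ 1) :
    (seg x y r).1 0 = (1 - r) * x.1 0 + r * y.1 0 := kleinLift_zero (seg_aux x y h0 h1)

lemma seg_coord_one (x y : Slice) {r : ℝ} (h0 : 0 ≤ r) (h1 : r ≤ 1) :
    (seg x y r).1 1 = (1 - r) * x.1 1 + r * y.1 1 := kleinLift_one (seg_aux x y h0 h1)

lemma seg_zero (x y : Slice) : seg x y 0 = x := by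
  simp [seg, kleinLift_coords]

lemma seg_one (x y : Slice) : seg x y 1 = y := by
  simp [seg, kleinLift_coords]

lemma seg_symm (x y : Slice) (r : ℝ) : seg x y (1 - r) = seg y x r := by
  rw [seg, seg]
  congr 2 <;> ring

/-- The value of the linear form of the Klein model in the direction `φ`. -/
noncomputable def lin (φ : ℝ) (x : Slice) : ℝ := x.1 0 * Real.cos φ + x.1 1 * Real.sin φ

lemma continuous_lin (φ : ℝ) : Continuous (lin φ) := by
  unfold lin
  fun_prop

lemma lin_eq_cos_ang (φ : ℝ) (x : Slice) : lin φ x = Real.cos (ang x (bdryPoint φ)) :=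
  (cos_ang_bdryPoint x φ).symm

lemma lin_seg (φ : ℝ) (x y : Slice) {r : ℝ} (h0 : 0 ≤ r) (h1 : r ≤ 1) :
    lin φ (seg x y r) = (1 - r) * lin φ x + r * lin φ y := by
  simp only [lin, seg_coord_zero x y h0 h1, seg_coord_one x y h0 h1]
  ring

lemma lin_bdryPoint (φ ψ : ℝ) : lin φ (bdryPoint ψ) = Real.cos (ψ - φ) := by
  simp [lin, bdryPoint, Real.cos_sub]

/-- The cosine reverses order on [0, π], so caps are half-planes of the Klein model. This links the
causal description by `ang` with the extremal one by `lin`. -/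
lemma mem_cap_iff_lin {φ w : ℝ} (h0 : 0 ≤ w) (h1 : w ≤ Real.pi) {x : Slice} :
    x ∈ cap φ w ↔ Real.cos w ≤ lin φ x := by
  rw [mem_cap, lin_eq_cos_ang]
  exact (Real.strictAntiOn_cos.le_iff_ge ⟨h0, h1⟩ ⟨ang_nonneg _ _, ang_le_pi _ _⟩).symm

lemma mem_closure_of_seg {U : Set Slice} {x y : Slice} (h : ∀ᶠ r in 𝓝[>] 0, seg x y r ∈ U) :
    x ∈ closure U := by
  have h1 : Tendsto (seg x y) (𝓝[>] 0) (𝓝 x) := by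
    have := (continuous_seg x y).tendsto 0
    rw [seg_zero] at this
    exact this.mono_left nhdsWithin_le_nhds
  exact mem_closure_of_tendsto h1 h

/-! ### Convexity and connectedness in the Klein model -/

/-- Sets that are convex in the Klein model. -/
def KleinConvex (U : Set Slice) : Prop :=
  ∀ x ∈ U, ∀ y ∈ U, ∀ r ∈ Set.Icc (0 : ℝ) 1, seg x y r ∈ U

lemma KleinConvex.isPreconnected {U : Set Slice} (hU : KleinConvex U) : IsPreconnected U := by
  apply isPreconnected_of_forall_pair
  intro x hx y hy
  refine ⟨seg x y '' Set.Icc 0 1, ?_, ⟨0, by simp, seg_zero x y⟩, ⟨1, by simp, seg_one x y⟩,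
    isPreconnected_Icc.image _ (continuous_seg x y).continuousOn⟩
  rintro _ ⟨r, hr, rfl⟩
  exact hU x hx y hy r hr

lemma KleinConvex.inter {U V : Set Slice} (hU : KleinConvex U) (hV : KleinConvex V) :
    KleinConvex (U ∩ V) := fun x hx y hy r hr =>
  ⟨hU x hx.1 y hy.1 r hr, hV x hx.2 y hy.2 r hr⟩

lemma kleinConvex_lt_lin (a φ : ℝ) : KleinConvex {x | a < lin φ x} := by
  rintro x hx y hy r ⟨h0, h1⟩
  simp only [Set.mem_ofPred_eq] at *
  rw [lin_seg φ x y h0 h1]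
  rcases h0.eq_or_lt with rfl | h0
  · simpa using hx
  · nlinarith [mul_nonneg (sub_nonneg.2 h1) (sub_pos.2 hx).le, mul_pos h0 (sub_pos.2 hy)]

lemma kleinConvex_lin_lt (a φ : ℝ) : KleinConvex {x | lin φ x < a} := by
  rintro x hx y hy r ⟨h0, h1⟩
  simp only [Set.mem_ofPred_eq] at *
  rw [lin_seg φ x y h0 h1]
  rcases h0.eq_or_lt with rfl | h0
  · simpa using hx
  · nlinarith [mul_nonneg (sub_nonneg.2 h1) (sub_pos.2 hx).le, mul_pos h0 (sub_pos.2 hy)]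

/-- Off the frontier of S the space splits into two open sets, interior and exterior, and a
connected set cannot meet both. This is how homology regions are located. -/
lemma subset_of_disjoint_frontier {X : Type*} [TopologicalSpace X] {U S : Set X}
    (hU : IsPreconnected U) (hd : ∀ x ∈ U, x ∉ frontier S) (hS : ∃ x ∈ U, x ∈ S) :
    U ⊆ interior S := by
  have key : ∀ x ∈ U, x ∈ interior S ∨ x ∈ (closure S)ᶜ := by
    intro x hx
    by_contra! h
    exact hd x hx ⟨not_not.1 h.2, h.1⟩
  obtain ⟨x, hx, hxS⟩ := hS
  refine hU.subset_left_of_subset_union isOpen_interior isClosed_closure.isOpen_compl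
    (Set.disjoint_left.2 fun y hy hy' => hy' (subset_closure (interior_subset hy))) key
    ⟨x, hx, (key x hx).resolve_right fun h => h (subset_closure hxS)⟩

lemma notMem_of_disjoint_frontier {X : Type*} [TopologicalSpace X] {U S : Set X}
    (hU : IsPreconnected U) (hd : ∀ x ∈ U, x ∉ frontier S) (hS : ∃ x ∈ U, x ∉ S) :
    ∀ x ∈ U, x ∉ S := by
  intro x hx hxS
  obtain ⟨y, hy, hyS⟩ := hS
  exact hyS (interior_subset (subset_of_disjoint_frontier hU hd ⟨x, hx, hxS⟩ hy))

/-! ### Regions cut out by an inequality -/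

lemma interior_setOf_nonneg {X : Type*} [TopologicalSpace X] {g : X → ℝ} (hg : Continuous g)
    (hneg : ∀ x, g x = 0 → x ∈ closure {x | g x < 0}) :
    interior {x | 0 ≤ g x} = {x | 0 < g x} := by
  apply Set.Subset.antisymm
  · intro x hx
    have h0 : x ∈ {x | 0 ≤ g x} := interior_subset hx
    refine lt_of_le_of_ne (show 0 ≤ g x from h0) fun h => ?_
    obtain ⟨y, hy, hy'⟩ := mem_closure_iff.1 (hneg x h.symm) _ isOpen_interior hx
    have hy0 : y ∈ {x | 0 ≤ g x} := interior_subset hy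
    exact absurd (show 0 ≤ g y from hy0) (not_le.2 hy')
  · exact interior_maximal (fun x (hx : 0 < g x) => (show 0 ≤ g x from hx.le)) (isOpen_lt continuous_const hg)

/-- The hypothesis on zeros excludes those at which g stays nonnegative nearby; they would be
interior points. -/
lemma frontier_setOf_nonneg {X : Type*} [TopologicalSpace X] {g : X → ℝ} (hg : Continuous g)
    (hneg : ∀ x, g x = 0 → x ∈ closure {x | g x < 0}) :
    frontier {x | 0 ≤ g x} = {x | g x = 0} := by
  rw [(isClosed_le continuous_const hg).frontier_eq, interior_setOf_nonneg hg hneg]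
  ext x
  simp only [Set.mem_sdiff, Set.mem_ofPred_eq, not_lt]
  exact ⟨fun h => le_antisymm h.2 h.1, fun h => ⟨h.ge, h.le⟩⟩

lemma closure_interior_setOf_nonneg {X : Type*} [TopologicalSpace X] {g : X → ℝ}
    (hg : Continuous g) (hpos : ∀ x, g x = 0 → x ∈ closure {x | 0 < g x})
    (hneg : ∀ x, g x = 0 → x ∈ closure {x | g x < 0}) :
    closure (interior {x | 0 ≤ g x}) = {x | 0 ≤ g x} := by
  rw [interior_setOf_nonneg hg hneg]
  apply Set.Subset.antisymm
  · exact closure_minimal (fun x (hx : 0 < g x) => (show 0 ≤ g x from hx.le)) (isClosed_le continuous_const hg)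
  · intro x hx
    rcases (show 0 ≤ g x from hx).eq_or_lt with h | h
    · exact hpos x h.symm
    · exact subset_closure h

/-- Points of a chord are limits of points on which `f (lin φ x - a)` is positive, when `f` does
not vanish there. -/
lemma mem_closure_mul_pos {f : Slice → ℝ} (hf : Continuous f) {φ a : ℝ} (ha : |a| < 1) {x : Slice}
    (hx : lin φ x = a) (hfx : f x ≠ 0) : x ∈ closure {x | 0 < (lin φ x - a) * f x} := by
  obtain ⟨y, hy⟩ : ∃ y, 0 < (lin φ y - a) * f x := by
    rw [abs_lt] at ha
    rcases hfx.lt_or_gt with h | h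
    · refine ⟨bdryPoint (φ + Real.pi), mul_pos_of_neg_of_neg ?_ h⟩
      rw [lin_bdryPoint, add_sub_cancel_left, Real.cos_pi]; linarith
    · refine ⟨bdryPoint φ, mul_pos ?_ h⟩
      rw [lin_bdryPoint, sub_self, Real.cos_zero]; linarith
  -- Along the segment from x to y the first factor is exactly r (lin φ y − a), and f keeps its sign
  -- near x.
  refine mem_closure_of_seg (y := y) ?_
  have h1 : Tendsto (fun r => (lin φ y - a) * f (seg x y r)) (𝓝[>] 0)
      (𝓝 ((lin φ y - a) * f x)) := by
    have h2 : Continuous fun r => (lin φ y - a) * f (seg x y r) :=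
      continuous_const.mul (hf.comp (continuous_seg x y))
    have h3 := h2.tendsto 0
    simp only [seg_zero] at h3
    exact h3.mono_left nhdsWithin_le_nhds
  filter_upwards [h1.eventually_const_lt hy, self_mem_nhdsWithin,
    nhdsWithin_le_nhds (Iio_mem_nhds one_pos)] with r h2 (h3 : 0 < r) (h4 : r < 1)
  rw [lin_seg φ x y h3.le h4.le, hx,
    show ((1 - r) * a + r * lin φ y - a) * f (seg x y r) =
      r * ((lin φ y - a) * f (seg x y r)) by ring]
  exact mul_pos h3 h2

lemma mem_closure_mul_neg {f : Slice → ℝ} (hf : Continuous f) {φ a : ℝ} (ha : |a| < 1) {x : Slice}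
    (hx : lin φ x = a) (hfx : f x ≠ 0) : x ∈ closure {x | (lin φ x - a) * f x < 0} := by
  have := mem_closure_mul_pos hf.neg ha hx (neg_ne_zero.2 hfx)
  simpa using this

/-! ## Chords -/

/-- The chord between two points. -/
noncomputable def chord (u v : Slice) : Set Slice := seg u v '' Set.Icc 0 1

lemma left_mem_chord (u v : Slice) : u ∈ chord u v := ⟨0, by simp, seg_zero u v⟩

lemma right_mem_chord (u v : Slice) : v ∈ chord u v := ⟨1, by simp, seg_one u v⟩

lemma chord_comm (u v : Slice) : chord u v = chord v u := by
  ext x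
  constructor <;> rintro ⟨r, ⟨h0, h1⟩, rfl⟩ <;>
    exact ⟨1 - r, ⟨by linarith, by linarith⟩, seg_symm _ _ _⟩

lemma isClosed_chord (u v : Slice) : IsClosed (chord u v) :=
  (isCompact_Icc.image (continuous_seg u v)).isClosed

lemma chord_subset {U : Set Slice} (hU : KleinConvex U) {u v : Slice} (hu : u ∈ U) (hv : v ∈ U) :
    chord u v ⊆ U := by
  rintro _ ⟨r, hr, rfl⟩
  exact hU u hu v hv r hr

/-- Both ends lie on the line lin φ = cos w, and the coordinate y along this line runs from −sin w
to sin w within the disc; the segment parameter is (y / sin w + 1) / 2. -/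
lemma chord_eq {φ w : ℝ} (h0 : 0 < w) (h1 : w < Real.pi) :
    chord (bdryPoint (φ - w)) (bdryPoint (φ + w)) = {x | lin φ x = Real.cos w} := by
  have hs : 0 < Real.sin w := Real.sin_pos_of_pos_of_lt_pi h0 h1
  have hφ := Real.sin_sq_add_cos_sq φ
  ext x
  simp only [Set.mem_ofPred_eq]
  constructor
  · rintro ⟨r, ⟨hr0, hr1⟩, rfl⟩
    rw [lin_seg _ _ _ hr0 hr1, lin_bdryPoint, lin_bdryPoint, add_sub_cancel_left,
      show φ - w - φ = -w by ring, Real.cos_neg]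
    ring
  · intro hx
    set y := -x.1 0 * Real.sin φ + x.1 1 * Real.cos φ with hy
    rw [lin] at hx
    have hx0 : x.1 0 = Real.cos w * Real.cos φ - y * Real.sin φ := by
      rw [← hx, hy]; linear_combination -x.1 0 * hφ
    have hx1 : x.1 1 = Real.cos w * Real.sin φ + y * Real.cos φ := by
      rw [← hx, hy]; linear_combination -x.1 1 * hφ
    have hsq : y ^ 2 ≤ Real.sin w ^ 2 := by
      have h2 := x.sq_le_one
      rw [hx0, hx1] at h2
      have h3 : (Real.cos w ^ 2 + y ^ 2) * (Real.sin φ ^ 2 + Real.cos φ ^ 2) ≤ 1 := by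
        linarith
      rw [hφ] at h3
      linarith [Real.sin_sq_add_cos_sq w]
    obtain ⟨h2, h3⟩ := abs_le_of_sq_le_sq' hsq hs.le
    have hr0 : 0 ≤ (y / Real.sin w + 1) / 2 := by
      have : -1 ≤ y / Real.sin w := by rw [le_div_iff₀ hs]; linarith
      linarith
    have hr1 : (y / Real.sin w + 1) / 2 ≤ 1 := by
      have : y / Real.sin w ≤ 1 := by rw [div_le_iff₀ hs]; linarith
      linarith
    refine ⟨_, ⟨hr0, hr1⟩, Slice.ext_coords ?_ ?_⟩
    · rw [seg_coord_zero _ _ hr0 hr1, hx0]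
      simp only [bdryPoint, Matrix.cons_val, Real.cos_sub, Real.cos_add]
      field_simp
      ring
    · rw [seg_coord_one _ _ hr0 hr1, hx1]
      simp only [bdryPoint, Matrix.cons_val, Real.sin_sub, Real.sin_add]
      field_simp
      ring

/-! ## Geodesics of a time slice -/

/-- The quantities (f + v) e^(−s) and (f − v) e^s are conserved. -/
lemma exists_exp_of_hasDerivAt {f v : ℝ → ℝ} (hf : ∀ s, HasDerivAt f (v s) s)
    (hv : ∀ s, HasDerivAt v (f s) s) :
    ∃ A B : ℝ, ∀ s, f s = A * Real.exp s + B * Real.exp (-s) ∧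
      v s = A * Real.exp s - B * Real.exp (-s) := by
  have hneg : ∀ s, HasDerivAt (fun s => Real.exp (-s)) (-Real.exp (-s)) s := fun s => by
    simpa using (hasDerivAt_neg s).exp
  have h1 : ∀ s, (f s + v s) * Real.exp (-s) = (f 0 + v 0) * Real.exp (-0) := by
    intro s
    refine is_const_of_deriv_eq_zero (f := fun s => (f s + v s) * Real.exp (-s))
      (fun s => (((hf s).add (hv s)).mul (hneg s)).differentiableAt) (fun s => ?_) s 0
    exact ((((hf s).add (hv s)).mul (hneg s)).congr_deriv
      (by simp only [Pi.add_apply]; ring)).deriv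
  have h2 : ∀ s, (f s - v s) * Real.exp s = (f 0 - v 0) * Real.exp 0 := by
    intro s
    refine is_const_of_deriv_eq_zero (f := fun s => (f s - v s) * Real.exp s)
      (fun s => (((hf s).sub (hv s)).mul (Real.hasDerivAt_exp s)).differentiableAt)
      (fun s => ?_) s 0
    exact ((((hf s).sub (hv s)).mul (Real.hasDerivAt_exp s)).congr_deriv
      (by simp only [Pi.sub_apply]; ring)).deriv
  refine ⟨(f 0 + v 0) / 2, (f 0 - v 0) / 2, fun s => ?_⟩
  have e1 := h1 s
  have e2 := h2 s
  rw [neg_zero, Real.exp_zero, mul_one] at e1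
  rw [Real.exp_zero, mul_one] at e2
  have e : Real.exp s * Real.exp (-s) = 1 := by rw [← Real.exp_add, add_neg_cancel, Real.exp_zero]
  rw [← e1, ← e2]
  constructor
  · linear_combination (-f s) * e
  · linear_combination (-v s) * e

lemma tendsto_exp_ratio_atTop {A B P Q : ℝ} (hP : P ≠ 0) :
    Tendsto (fun s => (A * Real.exp s + B * Real.exp (-s)) / (P * Real.exp s + Q * Real.exp (-s)))
      atTop (𝓝 (A / P)) := by
  have h0 : Tendsto (fun s => Real.exp (-(2 * s))) atTop (𝓝 0) :=
    Real.tendsto_exp_neg_atTop_nhds_zero.comp (tendsto_id.const_mul_atTop two_pos)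
  have h1 : Tendsto (fun s => (A + B * Real.exp (-(2 * s))) / (P + Q * Real.exp (-(2 * s)))) atTop
      (𝓝 ((A + B * 0) / (P + Q * 0))) :=
    ((h0.const_mul B).const_add A).div ((h0.const_mul Q).const_add P) (by simpa)
  simp only [mul_zero, add_zero] at h1
  refine h1.congr fun s => ?_
  have e : Real.exp (-(2 * s)) * Real.exp s = Real.exp (-s) := by
    rw [← Real.exp_add]; congr 1; ring
  rw [← mul_div_mul_right _ _ (Real.exp_pos s).ne', add_mul, add_mul, mul_assoc, mul_assoc, e]

lemma tendsto_exp_ratio_atBot {A B P Q : ℝ} (hQ : Q ≠ 0) :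
    Tendsto (fun s => (A * Real.exp s + B * Real.exp (-s)) / (P * Real.exp s + Q * Real.exp (-s)))
      atBot (𝓝 (B / Q)) := by
  refine ((tendsto_exp_ratio_atTop (A := B) (B := A) (Q := P) hQ).comp
    tendsto_neg_atBot_atTop).congr fun s => ?_
  simp only [Function.comp_apply, neg_neg]
  rw [add_comm, add_comm (Q * _)]

lemma nonneg_of_exp_pos {P Q : ℝ} (h : ∀ s, 0 < P * Real.exp s + Q * Real.exp (-s)) : 0 ≤ P := by
  have h0 : Tendsto (fun s => Real.exp (-(2 * s))) atTop (𝓝 0) :=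
    Real.tendsto_exp_neg_atTop_nhds_zero.comp (tendsto_id.const_mul_atTop two_pos)
  have h1 : Tendsto (fun s => P + Q * Real.exp (-(2 * s))) atTop (𝓝 (P + Q * 0)) :=
    (h0.const_mul Q).const_add P
  rw [mul_zero, add_zero] at h1
  refine ge_of_tendsto' h1 fun s => ?_
  have e : Real.exp (-(2 * s)) * Real.exp s = Real.exp (-s) := by
    rw [← Real.exp_add]; congr 1; ring
  have h2 := h s
  rw [← e, ← mul_assoc, ← add_mul] at h2
  exact (pos_of_mul_pos_left h2 (Real.exp_pos s).le).le

lemma dist_sq_bdry {u v : Slice} (hu : u ∈ bdry) (hv : v ∈ bdry) :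
    dist u v ^ 2 = 2 - 2 * (u.1 0 * v.1 0 + u.1 1 * v.1 1) := by
  have h1 := u.sq_sum
  have h2 := v.sq_sum
  have h3 : u.1 2 = 0 := hu
  have h4 : v.1 2 = 0 := hv
  rw [dist_sq_slice, h3, h4]
  rw [h3] at h1
  rw [h4] at h2
  linear_combination h1 + h2

/-- A spacelike geodesic within a time slice, with its ends on the boundary, in explicit form. -/
lemma geodesic_form {g : ℝ → Spacetime} (hg : IsSpacelikeGeodesic g) {t₀ : ℝ}
    (ht : ∀ s, (g s).1 = t₀) {src tgt : Spacetime} (hs : src.2 ∈ bdry) (ht' : tgt.2 ∈ bdry)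
    (hsrc : Tendsto g atBot (𝓝 src)) (htgt : Tendsto g atTop (𝓝 tgt)) :
    ∃ P Q : ℝ, 0 < P ∧ 0 < Q ∧ P * Q * dist src.2 tgt.2 ^ 2 = 1 ∧ ∀ s,
      ((g s).2.1 2)⁻¹ = P * Real.exp s + Q * Real.exp (-s) ∧
      (g s).2 = seg src.2 tgt.2
        (P * Real.exp s / (P * Real.exp s + Q * Real.exp (-s))) := by
  obtain ⟨-, hb, V, hV⟩ := hg
  have hX : ∀ s i, HasDerivAt (fun u => embed (g u) i) (V s i) s := fun s i =>
    hasDerivAt_pi.1 (hV s).1 i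
  have hVd : ∀ s i, HasDerivAt (fun u => V u i) (embed (g s) i) s := fun s i =>
    hasDerivAt_pi.1 (hV s).2.1 i
  have e0 : ∀ s, embed (g s) 0 = Real.cos t₀ * ((g s).2.1 2)⁻¹ := fun s => by
    simp [embed, ht s, div_eq_mul_inv]
  have e1 : ∀ s, embed (g s) 1 = Real.sin t₀ * ((g s).2.1 2)⁻¹ := fun s => by
    simp [embed, ht s, div_eq_mul_inv]
  have e2 : ∀ s, embed (g s) 2 = (g s).2.1 0 * ((g s).2.1 2)⁻¹ := fun s => by
    simp [embed, div_eq_mul_inv]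
  have e3 : ∀ s, embed (g s) 3 = (g s).2.1 1 * ((g s).2.1 2)⁻¹ := fun s => by
    simp [embed, div_eq_mul_inv]
  have hz : ∀ s, 0 < (g s).2.1 2 := hb
  have ht2 := Real.sin_sq_add_cos_sq t₀
  -- At constant time the velocity has no component along the time circle of ℝ^{2,2}; what is left
  -- of that plane is the single function 1/z.
  have hV01 : ∀ s, Real.sin t₀ * V s 0 - Real.cos t₀ * V s 1 = 0 := by
    intro s
    have h1 := ((hX s 0).const_mul (Real.sin t₀)).sub ((hX s 1).const_mul (Real.cos t₀))
    refine h1.unique ((hasDerivAt_const s (0 : ℝ)).congr_of_eventuallyEq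
      (Eventually.of_forall fun u => ?_))
    simp only [Pi.sub_apply, e0, e1]
    ring
  obtain ⟨P, Q, hW⟩ := exists_exp_of_hasDerivAt
    (f := fun s => Real.cos t₀ * embed (g s) 0 + Real.sin t₀ * embed (g s) 1)
    (v := fun s => Real.cos t₀ * V s 0 + Real.sin t₀ * V s 1)
    (fun s => ((hX s 0).const_mul _).add ((hX s 1).const_mul _))
    (fun s => ((hVd s 0).const_mul _).add ((hVd s 1).const_mul _))
  obtain ⟨A, B, hY⟩ := exists_exp_of_hasDerivAt (fun s => hX s 2) (fun s => hVd s 2)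
  obtain ⟨C, D, hZ⟩ := exists_exp_of_hasDerivAt (fun s => hX s 3) (fun s => hVd s 3)
  have hW' : ∀ s, ((g s).2.1 2)⁻¹ = P * Real.exp s + Q * Real.exp (-s) := by
    intro s
    rw [← (hW s).1]
    simp only [e0, e1]
    linear_combination (-((g s).2.1 2)⁻¹) * ht2
  have hVV : ∀ s, -(P * Real.exp s - Q * Real.exp (-s)) ^ 2 +
      (A * Real.exp s - B * Real.exp (-s)) ^ 2 + (C * Real.exp s - D * Real.exp (-s)) ^ 2 = 1 := by
    intro s
    rw [← (hW s).2, ← (hY s).2, ← (hZ s).2]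
    have h1 := (hV s).2.2
    rw [form22] at h1
    linear_combination h1 - (V s 0 ^ 2 + V s 1 ^ 2) * ht2 +
      (Real.sin t₀ * V s 0 - Real.cos t₀ * V s 1) * hV01 s
  have hXX : ∀ s, -(P * Real.exp s + Q * Real.exp (-s)) ^ 2 +
      (A * Real.exp s + B * Real.exp (-s)) ^ 2 + (C * Real.exp s + D * Real.exp (-s)) ^ 2 = -1 := by
    intro s
    rw [← hW' s, ← (hY s).1, ← (hZ s).1, e2, e3]
    have h1 := (g s).2.sq_sum
    have h2 := (hz s).ne'
    field_simp
    linarith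
  have hE : ∀ s, Real.exp s * Real.exp (-s) = 1 := fun s => by
    rw [← Real.exp_add, add_neg_cancel, Real.exp_zero]
  have hsum : ∀ s, Real.exp s ^ 2 * (-P ^ 2 + A ^ 2 + C ^ 2) +
      Real.exp (-s) ^ 2 * (-Q ^ 2 + B ^ 2 + D ^ 2) = 0 := by
    intro s
    linear_combination (hVV s + hXX s) / 2
  -- Two values of s give independent equations for the coefficients of e^(2s) and e^(−2s), so both
  -- vanish: the two asymptotic directions are null vectors.
  have hs0 := hsum 0
  have hs1 := hsum (Real.log 2)
  rw [Real.exp_neg, Real.exp_log two_pos] at hs1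
  rw [neg_zero, Real.exp_zero] at hs0
  have hAA : P ^ 2 = A ^ 2 + C ^ 2 := by linarith
  have hBB : Q ^ 2 = B ^ 2 + D ^ 2 := by linarith
  have hAB : P * Q - A * B - C * D = 1 / 2 := by
    have := hXX 0
    rw [neg_zero, Real.exp_zero] at this
    linarith
  have hWpos : ∀ s, 0 < P * Real.exp s + Q * Real.exp (-s) := fun s => by
    rw [← hW' s]; exact inv_pos.2 (hz s)
  have hP : 0 < P := by
    refine lt_of_le_of_ne (nonneg_of_exp_pos hWpos) fun h => ?_
    rw [← h] at hAA hAB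
    have hA : A = 0 := by nlinarith [sq_nonneg A, sq_nonneg C]
    have hC : C = 0 := by nlinarith [sq_nonneg A, sq_nonneg C]
    rw [hA, hC] at hAB
    norm_num at hAB
  have hQ : 0 < Q := by
    refine lt_of_le_of_ne (nonneg_of_exp_pos (P := Q) (Q := P) fun s => ?_) fun h => ?_
    · have := hWpos (-s)
      rw [neg_neg] at this
      linarith
    rw [← h] at hBB hAB
    have hB : B = 0 := by nlinarith [sq_nonneg B, sq_nonneg D]
    have hD : D = 0 := by nlinarith [sq_nonneg B, sq_nonneg D]
    rw [hB, hD] at hAB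
    norm_num at hAB
  have hx0 : ∀ s, (g s).2.1 0 = (A * Real.exp s + B * Real.exp (-s)) /
      (P * Real.exp s + Q * Real.exp (-s)) := by
    intro s
    rw [← hW' s, ← (hY s).1, e2, mul_div_assoc, div_self (inv_ne_zero (hz s).ne'), mul_one]
  have hx1 : ∀ s, (g s).2.1 1 = (C * Real.exp s + D * Real.exp (-s)) /
      (P * Real.exp s + Q * Real.exp (-s)) := by
    intro s
    rw [← hW' s, ← (hZ s).1, e3, mul_div_assoc, div_self (inv_ne_zero (hz s).ne'), mul_one]
  have hlim : ∀ i : Fin 3, Continuous fun p : Spacetime => p.2.1 i := fun i =>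
    (continuous_coord i).comp continuous_snd
  -- The prescribed end points are the limits of the ratios of exponentials. This fixes the chord,
  -- and the normalisation `hAB` becomes P Q d² = 1.
  have hA : tgt.2.1 0 = A / P := tendsto_nhds_unique (((hlim 0).tendsto tgt).comp htgt)
    ((tendsto_exp_ratio_atTop hP.ne').congr fun s => (hx0 s).symm)
  have hC : tgt.2.1 1 = C / P := tendsto_nhds_unique (((hlim 1).tendsto tgt).comp htgt)
    ((tendsto_exp_ratio_atTop hP.ne').congr fun s => (hx1 s).symm)
  have hB : src.2.1 0 = B / Q := tendsto_nhds_unique (((hlim 0).tendsto src).comp hsrc)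
    ((tendsto_exp_ratio_atBot hQ.ne').congr fun s => (hx0 s).symm)
  have hD : src.2.1 1 = D / Q := tendsto_nhds_unique (((hlim 1).tendsto src).comp hsrc)
    ((tendsto_exp_ratio_atBot hQ.ne').congr fun s => (hx1 s).symm)
  refine ⟨P, Q, hP, hQ, ?_, fun s => ⟨hW' s, ?_⟩⟩
  · rw [dist_sq_bdry hs ht', hA, hB, hC, hD]
    field_simp
    linarith
  · have hW0 := hWpos s
    have hr0 : 0 ≤ P * Real.exp s / (P * Real.exp s + Q * Real.exp (-s)) := by positivity
    have hr1 : P * Real.exp s / (P * Real.exp s + Q * Real.exp (-s)) ≤ 1 := by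
      rw [div_le_one hW0]
      have := mul_pos hQ (Real.exp_pos (-s))
      linarith
    have hr2 : 1 - P * Real.exp s / (P * Real.exp s + Q * Real.exp (-s)) =
        Q * Real.exp (-s) / (P * Real.exp s + Q * Real.exp (-s)) := by
      field_simp; ring
    apply Slice.ext_coords
    · rw [seg_coord_zero _ _ hr0 hr1, hr2, hA, hB, hx0]
      field_simp
      ring
    · rw [seg_coord_one _ _ hr0 hr1, hr2, hC, hD, hx1]
      field_simp
      ring

/-- The open chord is covered. -/
lemma exists_exp_ratio_eq {P Q r : ℝ} (hP : 0 < P) (hQ : 0 < Q) (h0 : 0 < r) (h1 : r < 1) :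
    ∃ s, P * Real.exp s / (P * Real.exp s + Q * Real.exp (-s)) = r := by
  have h1' : 0 < 1 - r := by linarith
  have hpos : 0 < r * Q / (P * (1 - r)) := by positivity
  refine ⟨Real.log (r * Q / (P * (1 - r))) / 2, ?_⟩
  set s := Real.log (r * Q / (P * (1 - r))) / 2
  have e1 : Real.exp s * Real.exp s = r * Q / (P * (1 - r)) := by
    rw [← Real.exp_add, add_halves, Real.exp_log hpos]
  have e2 : Real.exp s * Real.exp (-s) = 1 := by
    rw [← Real.exp_add, add_neg_cancel, Real.exp_zero]
  have hE := Real.exp_pos s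
  have hF := Real.exp_pos (-s)
  rw [div_eq_iff (by positivity)]
  apply mul_right_cancel₀ hE.ne'
  have e3 : Real.exp s * Real.exp s * (P * (1 - r)) = r * Q := by
    rw [e1]; field_simp
  linear_combination e3 - r * Q * e2

/-! ## Regularised lengths -/

/-- The radial cutoff in terms of `cosh ρ`. -/
noncomputable def cutoff (ε : ℝ) : ℝ := √(1 + (1 / ε) ^ 2)

/-- The regularised length of a geodesic whose ends have chordal distance `d`. -/
noncomputable def len (d ε : ℝ) : ℝ := 2 * Real.arcosh (max 1 (d * cutoff ε / 2))

lemma cutoff_pos (ε : ℝ) : 0 < cutoff ε := Real.sqrt_pos.2 (by positivity)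

lemma len_mono {d d' : ℝ} (h : d ≤ d') (ε : ℝ) : len d ε ≤ len d' ε := by
  have hK := cutoff_pos ε
  have h1 : max 1 (d * cutoff ε / 2) ≤ max 1 (d' * cutoff ε / 2) :=
    max_le_max le_rfl (by gcongr)
  exact mul_le_mul_of_nonneg_left ((Real.arcosh_le_arcosh (lt_max_of_lt_left one_pos)
    (lt_max_of_lt_left one_pos)).2 h1) two_pos.le

lemma tendsto_cutoff : Tendsto cutoff (𝓝[>] 0) atTop := by
  have h1 : Tendsto (fun ε : ℝ => ε⁻¹) (𝓝[>] 0) atTop := tendsto_inv_nhdsGT_zero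
  refine tendsto_atTop_mono (fun ε => ?_) h1
  rw [cutoff, one_div]
  exact Real.le_sqrt_of_sq_le (by linarith)

/-- For large y, arcosh y = log(y + √(y² − 1)) is log(2y) + o(1). The divergence 2 log `cutoff` is
the same for each geodesic, so it cancels between surfaces with equally many geodesics. -/
lemma tendsto_len_sub {d : ℝ} (hd : 0 < d) :
    Tendsto (fun ε => len d ε - 2 * Real.log (cutoff ε)) (𝓝[>] 0) (𝓝 (2 * Real.log d)) := by
  have h1 : Tendsto (fun x : ℝ => 2 * Real.log (d / 2 + √(d ^ 2 / 4 - (x⁻¹) ^ 2))) atTop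
      (𝓝 (2 * Real.log (d / 2 + √(d ^ 2 / 4 - 0 ^ 2)))) := by
    have h2 : Tendsto (fun x : ℝ => d / 2 + √(d ^ 2 / 4 - (x⁻¹) ^ 2)) atTop
        (𝓝 (d / 2 + √(d ^ 2 / 4 - 0 ^ 2))) :=
      (((tendsto_inv_atTop_zero.pow 2).const_sub _).sqrt).const_add _
    exact (h2.log (by positivity)).const_mul 2
  have h3 : d / 2 + √(d ^ 2 / 4 - 0 ^ 2) = d := by
    rw [show d ^ 2 / 4 - 0 ^ 2 = (d / 2) ^ 2 by ring, Real.sqrt_sq (by positivity)]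
    ring
  rw [h3] at h1
  refine (h1.comp tendsto_cutoff).congr' ?_
  filter_upwards [tendsto_cutoff.eventually_ge_atTop (2 / d)] with ε hε
  have hK := cutoff_pos ε
  have h4 : 1 ≤ d * cutoff ε / 2 := by
    rw [div_le_iff₀ hd] at hε
    linarith
  have h5 : d ^ 2 / 4 - ((cutoff ε)⁻¹) ^ 2 = ((d * cutoff ε / 2) ^ 2 - 1) / cutoff ε ^ 2 := by
    field_simp
    ring
  have h6 : d / 2 + √(d ^ 2 / 4 - ((cutoff ε)⁻¹) ^ 2) =
      (d * cutoff ε / 2 + √((d * cutoff ε / 2) ^ 2 - 1)) / cutoff ε := by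
    rw [h5, Real.sqrt_div' _ (by positivity), Real.sqrt_sq hK.le]
    field_simp
  simp only [Function.comp_apply]
  rw [h6, len, max_eq_right h4, Real.arcosh, Real.log_div (by positivity) hK.ne']
  ring

/-- For x < 1 the set is empty, in agreement with arcosh 1 = 0; this covers cutoffs that the
geodesic does not reach. -/
lemma volume_cosh_le (x s₀ : ℝ) :
    (volume {s : ℝ | Real.cosh (s - s₀) ≤ x}).toReal = 2 * Real.arcosh (max 1 x) := by
  rcases lt_or_ge x 1 with hx | hx
  · have : {s : ℝ | Real.cosh (s - s₀) ≤ x} = ∅ := by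
      ext s
      simp only [Set.mem_ofPred_eq, Set.mem_empty_iff_false, iff_false, not_le]
      linarith [Real.one_le_cosh (s - s₀)]
    rw [this, max_eq_left hx.le]
    simp
  · have : {s : ℝ | Real.cosh (s - s₀) ≤ x} =
        Set.Icc (s₀ - Real.arcosh x) (s₀ + Real.arcosh x) := by
      ext s
      simp only [Set.mem_ofPred_eq, Set.mem_Icc]
      rw [← Real.cosh_arcosh hx, Real.cosh_le_cosh, abs_of_nonneg (Real.arcosh_nonneg hx), abs_le,
        Real.cosh_arcosh hx]
      constructor <;> rintro ⟨h1, h2⟩ <;> constructor <;> linarith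
    have h0 := Real.arcosh_nonneg hx
    rw [this, max_eq_right hx, Real.volume_Icc, ENNReal.toReal_ofReal (by linarith)]
    ring

/-- On the unit hemisphere r² = z⁻² − 1. -/
lemma radius_le_iff {x : Slice} (hx : 0 < x.1 2) {ε : ℝ} (hε : 0 < ε) :
    radius x ≤ 1 / ε ↔ (x.1 2)⁻¹ ≤ cutoff ε := by
  have h0 : (0 : ℝ) ≤ 1 + (1 / ε) ^ 2 := by positivity
  rw [radius, cutoff, ← sq_le_sq₀ (a := _ / _) (by positivity) (by positivity),
    ← sq_le_sq₀ (a := _⁻¹) (by positivity) (by positivity), Real.sq_sqrt h0,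
    div_pow, Real.sq_sqrt (by positivity)]
  have h1 : x.1 0 ^ 2 + x.1 1 ^ 2 = 1 - x.1 2 ^ 2 := by linarith [x.sq_sum]
  have h2 : (1 - x.1 2 ^ 2) / x.1 2 ^ 2 = ((x.1 2)⁻¹) ^ 2 - 1 := by
    field_simp
  rw [h1, h2, sub_le_iff_le_add']

/-- Since P Q d² = 1, the inverse height is 2 cosh(s − s₀) / d with e^(2 s₀) = Q / P, so the part
below the cutoff is an interval centred at s₀. -/
lemma length_eq {g : ℝ → Spacetime} (hg : IsSpacelikeGeodesic g) {t₀ : ℝ}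
    (ht : ∀ s, (g s).1 = t₀) {src tgt : Spacetime} (hs : src.2 ∈ bdry) (ht' : tgt.2 ∈ bdry)
    (hsrc : Tendsto g atBot (𝓝 src)) (htgt : Tendsto g atTop (𝓝 tgt)) {ε : ℝ} (hε : 0 < ε) :
    (volume {s : ℝ | radius (g s).2 ≤ 1 / ε}).toReal = len (dist src.2 tgt.2) ε := by
  obtain ⟨P, Q, hP, hQ, hPQ, h⟩ := geodesic_form hg ht hs ht' hsrc htgt
  have hd : 0 < dist src.2 tgt.2 := by
    refine lt_of_le_of_ne dist_nonneg fun h0 => ?_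
    rw [← h0] at hPQ
    norm_num at hPQ
  set d := dist src.2 tgt.2
  set s₀ := (Real.log Q - Real.log P) / 2 with hs₀
  have hW : ∀ s, P * Real.exp s + Q * Real.exp (-s) = 2 * Real.cosh (s - s₀) / d := by
    intro s
    have e1 : Real.exp s₀ * Real.exp s₀ = Q / P := by
      rw [← Real.exp_add, hs₀, add_halves, Real.exp_sub, Real.exp_log hP, Real.exp_log hQ]
    have hE := Real.exp_pos s₀
    have e2 : P * Real.exp s₀ * d = 1 := by
      have : (P * Real.exp s₀ * d) ^ 2 = 1 := by
        rw [show (P * Real.exp s₀ * d) ^ 2 = P ^ 2 * (Real.exp s₀ * Real.exp s₀) * d ^ 2 by ring,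
          e1, ← hPQ]
        field_simp
      have h0 : 0 < P * Real.exp s₀ * d := by positivity
      nlinarith
    have e3 : Q * d = Real.exp s₀ := by
      have : P * (Q * d) = P * Real.exp s₀ := by
        apply mul_right_cancel₀ hd.ne'
        rw [e2]; linarith
      exact mul_left_cancel₀ hP.ne' this
    have e4 : P * d = Real.exp (-s₀) := by
      rw [Real.exp_neg]
      refine eq_inv_of_mul_eq_one_left ?_
      linarith
    rw [eq_div_iff hd.ne', Real.cosh_eq, neg_sub, sub_eq_add_neg, sub_eq_add_neg, Real.exp_add,
      Real.exp_add, ← e4, ← e3]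
    ring
  have hset : {s : ℝ | radius (g s).2 ≤ 1 / ε} =
      {s : ℝ | Real.cosh (s - s₀) ≤ d * cutoff ε / 2} := by
    ext s
    simp only [Set.mem_ofPred_eq]
    rw [radius_le_iff (hg.2.1 s) hε, (h s).1, hW, div_le_iff₀ hd, le_div_iff₀ two_pos]
    constructor <;> intro h <;> linarith
  rw [hset, volume_cosh_le, len]

lemma range_geodesic {g : ℝ → Spacetime} (hg : IsSpacelikeGeodesic g) {t₀ : ℝ}
    (ht : ∀ s, (g s).1 = t₀) {src tgt : Spacetime} (hs : src.2 ∈ bdry) (ht' : tgt.2 ∈ bdry)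
    (hsrc : Tendsto g atBot (𝓝 src)) (htgt : Tendsto g atTop (𝓝 tgt)) :
    Set.range g = atTime t₀ (seg src.2 tgt.2 '' Set.Ioo 0 1) := by
  obtain ⟨P, Q, hP, hQ, -, h⟩ := geodesic_form hg ht hs ht' hsrc htgt
  ext p
  constructor
  · rintro ⟨s, rfl⟩
    refine ⟨ht s, _, ⟨?_, ?_⟩, (h s).2.symm⟩
    · positivity
    · rw [div_lt_one (by positivity)]
      have := mul_pos hQ (Real.exp_pos (-s))
      linarith
  · rintro ⟨h1, r, ⟨hr0, hr1⟩, h2⟩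
    obtain ⟨s, hs⟩ := exists_exp_ratio_eq hP hQ hr0 hr1
    refine ⟨s, Prod.ext ((ht s).trans h1.symm) ?_⟩
    rw [(h s).2, hs, h2]

/-! ## Extremal surfaces from chords -/

/-- The geodesic over a chord. -/
noncomputable def chordGeodesic (t₀ : ℝ) (u v : Slice) (s : ℝ) : Spacetime :=
  (t₀, seg u v (Real.exp s / (Real.exp s + Real.exp (-s))))

lemma exp_ratio_mem (s : ℝ) : Real.exp s / (Real.exp s + Real.exp (-s)) ∈ Set.Ioo (0 : ℝ) 1 := by
  refine ⟨by positivity, ?_⟩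
  rw [div_lt_one (by positivity)]
  linarith [Real.exp_pos (-s)]

lemma chordGeodesic_coords {u v : Slice} (hu : u ∈ bdry) (hv : v ∈ bdry) (t₀ s : ℝ) :
    (chordGeodesic t₀ u v s).2.1 0 =
      (v.1 0 * Real.exp s + u.1 0 * Real.exp (-s)) / (Real.exp s + Real.exp (-s)) ∧
    (chordGeodesic t₀ u v s).2.1 1 =
      (v.1 1 * Real.exp s + u.1 1 * Real.exp (-s)) / (Real.exp s + Real.exp (-s)) ∧
    (chordGeodesic t₀ u v s).2.1 2 = dist u v / (Real.exp s + Real.exp (-s)) := by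
  obtain ⟨h0, h1⟩ := exp_ratio_mem s
  have hW : 0 < Real.exp s + Real.exp (-s) := by positivity
  have hE : Real.exp s * Real.exp (-s) = 1 := by
    rw [← Real.exp_add, add_neg_cancel, Real.exp_zero]
  have e0 : (chordGeodesic t₀ u v s).2.1 0 =
      (v.1 0 * Real.exp s + u.1 0 * Real.exp (-s)) / (Real.exp s + Real.exp (-s)) := by
    rw [chordGeodesic, seg_coord_zero _ _ h0.le h1.le]
    field_simp
    ring
  have e1 : (chordGeodesic t₀ u v s).2.1 1 =
      (v.1 1 * Real.exp s + u.1 1 * Real.exp (-s)) / (Real.exp s + Real.exp (-s)) := by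
    rw [chordGeodesic, seg_coord_one _ _ h0.le h1.le]
    field_simp
    ring
  refine ⟨e0, e1, ?_⟩
  rw [← sq_eq_sq₀ (chordGeodesic t₀ u v s).2.2.2 (by positivity), div_pow, eq_div_iff (by positivity),
    dist_sq_bdry hu hv]
  have hsq := (chordGeodesic t₀ u v s).2.sq_sum
  rw [e0, e1] at hsq
  have h2 : u.1 2 = 0 := hu
  have h3 : v.1 2 = 0 := hv
  have hu1 := u.sq_sum
  have hv1 := v.sq_sum
  rw [h2] at hu1
  rw [h3] at hv1
  field_simp at hsq
  linear_combination hsq - Real.exp s ^ 2 * hv1 - Real.exp (-s) ^ 2 * hu1 +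
    (2 - 2 * (u.1 0 * v.1 0 + u.1 1 * v.1 1)) * hE

/-- The embedded curve is a e^s + b e^(−s) with null vectors a, b of inner product −1/2, normalised
through division by the chordal distance. -/
lemma isSpacelikeGeodesic_chordGeodesic {u v : Slice} (hu : u ∈ bdry) (hv : v ∈ bdry)
    (huv : u ≠ v) (t₀ : ℝ) : IsSpacelikeGeodesic (chordGeodesic t₀ u v) := by
  have hd : 0 < dist u v := dist_pos.2 huv
  have hpos : ∀ s : ℝ, 0 < Real.exp s + Real.exp (-s) := fun s => by positivity
  have hE : ∀ s : ℝ, Real.exp s * Real.exp (-s) = 1 := fun s => by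
    rw [← Real.exp_add, add_neg_cancel, Real.exp_zero]
  have hneg : ∀ s, HasDerivAt (fun s => Real.exp (-s)) (-Real.exp (-s)) s := fun s => by
    simpa using (hasDerivAt_neg s).exp
  have hplus : ∀ (a b : ℝ) (s : ℝ), HasDerivAt (fun s => a * Real.exp s + b * Real.exp (-s))
      (a * Real.exp s - b * Real.exp (-s)) s := fun a b s =>
    (((Real.hasDerivAt_exp s).const_mul a).add ((hneg s).const_mul b)).congr_deriv (by ring)
  have hminus : ∀ (a b : ℝ) (s : ℝ), HasDerivAt (fun s => a * Real.exp s - b * Real.exp (-s))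
      (a * Real.exp s + b * Real.exp (-s)) s := fun a b s =>
    (((Real.hasDerivAt_exp s).const_mul a).sub ((hneg s).const_mul b)).congr_deriv (by ring)
  set a : Fin 4 → ℝ := ![Real.cos t₀ / dist u v, Real.sin t₀ / dist u v,
    v.1 0 / dist u v, v.1 1 / dist u v] with ha
  set b : Fin 4 → ℝ := ![Real.cos t₀ / dist u v, Real.sin t₀ / dist u v,
    u.1 0 / dist u v, u.1 1 / dist u v] with hb
  have hemb : ∀ s, embed (chordGeodesic t₀ u v s) =
      fun i => a i * Real.exp s + b i * Real.exp (-s) := by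
    intro s
    obtain ⟨e0, e1, e2⟩ := chordGeodesic_coords hu hv t₀ s
    have hW := (hpos s).ne'
    funext i
    simp only [embed, e0, e1, e2]
    fin_cases i <;> simp [ha, hb, chordGeodesic] <;> field_simp
  refine ⟨?_, fun s => ?_, fun s i => a i * Real.exp s - b i * Real.exp (-s), fun s => ⟨?_, ?_, ?_⟩⟩
  · exact continuous_const.prodMk ((continuous_seg u v).comp
      (Continuous.div (by fun_prop) (by fun_prop) fun s => (hpos s).ne'))
  · simp only [bulk, Set.mem_ofPred_eq]
    rw [(chordGeodesic_coords hu hv t₀ s).2.2]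
    exact div_pos hd (hpos s)
  · simp only [hemb]
    exact hasDerivAt_pi.2 fun i => hplus _ _ s
  · rw [hemb]
    exact hasDerivAt_pi.2 fun i => hminus _ _ s
  · have h1 := dist_sq_bdry hu hv
    have h2 : u.1 2 = 0 := hu
    have h3 : v.1 2 = 0 := hv
    have hu1 := u.sq_sum
    have hv1 := v.sq_sum
    rw [h2] at hu1
    rw [h3] at hv1
    simp only [form22, ha, hb, Matrix.cons_val]
    field_simp
    rw [h1]
    linear_combination (-(Real.exp s - Real.exp (-s)) ^ 2) * Real.sin_sq_add_cos_sq t₀ +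
      Real.exp s ^ 2 * hv1 + Real.exp (-s) ^ 2 * hu1 +
      (2 - 2 * (u.1 0 * v.1 0 + u.1 1 * v.1 1)) * hE s

lemma tendsto_chordGeodesic_atTop (t₀ : ℝ) (u v : Slice) :
    Tendsto (chordGeodesic t₀ u v) atTop (𝓝 (t₀, v)) := by
  have h : Tendsto (fun s => Real.exp s / (Real.exp s + Real.exp (-s))) atTop (𝓝 1) := by
    simpa using tendsto_exp_ratio_atTop (A := 1) (B := 0) (P := 1) (Q := 1) one_ne_zero
  have h2 := ((continuous_seg u v).tendsto 1).comp h
  rw [seg_one] at h2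
  exact tendsto_const_nhds.prodMk_nhds h2

lemma tendsto_chordGeodesic_atBot (t₀ : ℝ) (u v : Slice) :
    Tendsto (chordGeodesic t₀ u v) atBot (𝓝 (t₀, u)) := by
  have h : Tendsto (fun s => Real.exp s / (Real.exp s + Real.exp (-s))) atBot (𝓝 0) := by
    simpa using tendsto_exp_ratio_atBot (A := 1) (B := 0) (P := 1) (Q := 1) one_ne_zero
  have h2 := ((continuous_seg u v).tendsto 0).comp h
  rw [seg_zero] at h2
  exact tendsto_const_nhds.prodMk_nhds h2

/-- The extremal surface made of given chords of the slice at time `t₀`. -/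
noncomputable def ofChords (t₀ : ℝ) {n : ℕ} (u v : Fin n → Slice) (hu : ∀ i, u i ∈ bdry)
    (hv : ∀ i, v i ∈ bdry) (h : Function.Injective (Sum.elim u v)) : ExtremalSurface where
  n := n
  geo i := chordGeodesic t₀ (u i) (v i)
  src i := (t₀, u i)
  tgt i := (t₀, v i)
  isGeo i := isSpacelikeGeodesic_chordGeodesic (hu i) (hv i)
    (fun he => Sum.inl_ne_inr (h (a₁ := Sum.inl i) (a₂ := Sum.inr i) he)) t₀
  src_bdry := hu
  tgt_bdry := hv
  tendsto_src i := tendsto_chordGeodesic_atBot t₀ (u i) (v i)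
  tendsto_tgt i := tendsto_chordGeodesic_atTop t₀ (u i) (v i)
  ends_injective := by
    have h1 : Sum.elim (fun i => ((t₀, u i) : Spacetime)) (fun i => (t₀, v i)) =
        fun k => (t₀, Sum.elim u v k) := by
      funext k
      cases k <;> rfl
    rw [h1]
    exact fun k l hkl => h (Prod.ext_iff.1 hkl).2

namespace ExtremalSurface

variable (Γ : ExtremalSurface)

/-- The chords underlying an extremal surface. -/
noncomputable def chords : Set Slice := ⋃ i, chord (Γ.src i).2 (Γ.tgt i).2

variable {Γ}

lemma fst_geo {t₀ : ℝ} (ht : ∀ p ∈ Γ.carrier, p.1 = t₀) (i : Fin Γ.n) (s : ℝ) :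
    (Γ.geo i s).1 = t₀ := ht _ (Or.inl (Set.mem_iUnion.2 ⟨i, s, rfl⟩))

lemma fst_src {t₀ : ℝ} (ht : ∀ p ∈ Γ.carrier, p.1 = t₀) (i : Fin Γ.n) :
    (Γ.src i).1 = t₀ := ht _ (Or.inr (Or.inl ⟨i, rfl⟩))

lemma fst_tgt {t₀ : ℝ} (ht : ∀ p ∈ Γ.carrier, p.1 = t₀) (i : Fin Γ.n) :
    (Γ.tgt i).1 = t₀ := ht _ (Or.inr (Or.inr ⟨i, rfl⟩))

lemma carrier_eq {t₀ : ℝ} (ht : ∀ p ∈ Γ.carrier, p.1 = t₀) :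
    Γ.carrier = atTime t₀ Γ.chords := by
  have hr : ∀ i, Set.range (Γ.geo i) = _ := fun i => range_geodesic (Γ.isGeo i)
    (fst_geo ht i) (Γ.src_bdry i) (Γ.tgt_bdry i) (Γ.tendsto_src i) (Γ.tendsto_tgt i)
  ext p
  constructor
  · intro hp
    refine ⟨ht p hp, ?_⟩
    rcases hp with hp | ⟨i, rfl⟩ | ⟨i, rfl⟩
    · obtain ⟨i, hi⟩ := Set.mem_iUnion.1 hp
      rw [hr] at hi
      obtain ⟨-, r, hr, hx⟩ := hi
      exact Set.mem_iUnion.2 ⟨i, r, Set.Ioo_subset_Icc_self hr, hx⟩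
    · exact Set.mem_iUnion.2 ⟨i, left_mem_chord _ _⟩
    · exact Set.mem_iUnion.2 ⟨i, right_mem_chord _ _⟩
  · rintro ⟨h1, h2⟩
    obtain ⟨i, r, ⟨h3, h4⟩, h5⟩ := Set.mem_iUnion.1 h2
    rcases h3.eq_or_lt with rfl | h3
    · rw [seg_zero] at h5
      exact Or.inr (Or.inl ⟨i, Prod.ext ((fst_src ht i).trans h1.symm) h5⟩)
    rcases h4.eq_or_lt with rfl | h4
    · rw [seg_one] at h5
      exact Or.inr (Or.inr ⟨i, Prod.ext ((fst_tgt ht i).trans h1.symm) h5⟩)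
    refine Or.inl (Set.mem_iUnion.2 ⟨i, ?_⟩)
    rw [hr]
    exact ⟨h1, r, ⟨h3, h4⟩, h5⟩

lemma area_eq {t₀ : ℝ} (ht : ∀ p ∈ Γ.carrier, p.1 = t₀) {ε : ℝ} (hε : 0 < ε) :
    Γ.area ε = ∑ i, len (dist (Γ.src i).2 (Γ.tgt i).2) ε :=
  Finset.sum_congr rfl fun i _ => length_eq (Γ.isGeo i) (fst_geo ht i) (Γ.src_bdry i)
    (Γ.tgt_bdry i) (Γ.tendsto_src i) (Γ.tendsto_tgt i) hε

lemma ends_snd_injective {t₀ : ℝ} (ht : ∀ p ∈ Γ.carrier, p.1 = t₀) :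
    Function.Injective (Sum.elim (fun i => (Γ.src i).2) fun i => (Γ.tgt i).2) := by
  intro k l hkl
  apply Γ.ends_injective
  apply Prod.ext
  · rcases k with k | k <;> rcases l with l | l <;>
      simp [fst_src ht, fst_tgt ht]
  · rcases k with k | k <;> rcases l with l | l <;> exact hkl

lemma src_ne_tgt {t₀ : ℝ} (ht : ∀ p ∈ Γ.carrier, p.1 = t₀) (i : Fin Γ.n) :
    (Γ.src i).2 ≠ (Γ.tgt i).2 := fun h =>
  Sum.inl_ne_inr (ends_snd_injective ht (a₁ := Sum.inl i) (a₂ := Sum.inr i) h)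

end ExtremalSurface

section ofChords

variable {t₀ : ℝ} {n : ℕ} {u v : Fin n → Slice} {hu : ∀ i, u i ∈ bdry} {hv : ∀ i, v i ∈ bdry}
  {h : Function.Injective (Sum.elim u v)}

lemma fst_carrier_ofChords : ∀ p ∈ (ofChords t₀ u v hu hv h).carrier, p.1 = t₀ := by
  rintro p (hp | ⟨i, rfl⟩ | ⟨i, rfl⟩)
  · obtain ⟨i, s, rfl⟩ := Set.mem_iUnion.1 hp
    rfl
  · rfl
  · rfl

lemma isHomologyRegion_ofChords {A S : Set Slice} (h1 : closure (interior S) = S)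
    (h2 : S ∩ bdry = A) (h3 : frontier S = ⋃ i, chord (u i) (v i)) :
    IsHomologyRegion t₀ A (ofChords t₀ u v hu hv h) S :=
  ⟨h1, h2, by rw [ExtremalSurface.carrier_eq fst_carrier_ofChords, h3]; rfl⟩

end ofChords

/-! ## The end points of homologous surfaces -/

section Homology

variable {t₀ : ℝ} {A S : Set Slice} {Γ : ExtremalSurface}

lemma IsHomologyRegion.fst_carrier (h : IsHomologyRegion t₀ A Γ S) :
    ∀ p ∈ Γ.carrier, p.1 = t₀ := by
  intro p hp
  rw [h.2.2] at hp
  exact hp.1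

lemma atTime_injective : Function.Injective (atTime t₀) := by
  intro S T h
  ext x
  have h1 : (t₀, x) ∈ atTime t₀ S ↔ (t₀, x) ∈ atTime t₀ T := by rw [h]
  simpa [atTime] using h1

lemma IsHomologyRegion.frontier_eq (h : IsHomologyRegion t₀ A Γ S) : frontier S = Γ.chords :=
  atTime_injective (h.2.2.symm.trans (ExtremalSurface.carrier_eq h.fst_carrier))

lemma IsHomologyRegion.isClosed (h : IsHomologyRegion t₀ A Γ S) : IsClosed S :=
  h.1 ▸ isClosed_closure

/-- The end points within the boundary circle of a boundary region. -/
def ends (A : Set Slice) : Set Slice := {p | p ∈ A ∧ p ∈ closure (bdry \ A)}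

/-- The squared height over the segment is r (1 − r) d², which vanishes only at its ends. -/
lemma bulk_seg {u v : Slice} (hu : u ∈ bdry) (hv : v ∈ bdry) (huv : u ≠ v) {r : ℝ} (h0 : 0 < r)
    (h1 : r < 1) : seg u v r ∉ bdry := by
  intro h
  have h2 : (seg u v r).1 2 = 0 := h
  have h3 := (seg u v r).sq_sum
  rw [h2, seg_coord_zero _ _ h0.le h1.le, seg_coord_one _ _ h0.le h1.le] at h3
  have h4 := dist_sq_bdry hu hv
  have h5 : u.1 2 = 0 := hu
  have h6 : v.1 2 = 0 := hv
  have hu1 := u.sq_sum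
  have hv1 := v.sq_sum
  rw [h5] at hu1
  rw [h6] at hv1
  have h7 : r * (1 - r) * dist u v ^ 2 = 0 := by
    rw [h4]
    linear_combination -h3 + (1 - r) ^ 2 * hu1 + r ^ 2 * hv1
  have := mul_pos (mul_pos h0 (sub_pos.2 h1)) (pow_pos (dist_pos.2 huv) 2)
  linarith

lemma eq_of_mem_chord_of_mem_bdry {u v x : Slice} (hu : u ∈ bdry) (hv : v ∈ bdry) (huv : u ≠ v)
    (hx : x ∈ chord u v) (hxb : x ∈ bdry) : x = u ∨ x = v := by
  obtain ⟨r, ⟨h0, h1⟩, rfl⟩ := hx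
  rcases h0.eq_or_lt with rfl | h0
  · exact Or.inl (seg_zero u v)
  rcases h1.eq_or_lt with rfl | h1
  · exact Or.inr (seg_one u v)
  exact absurd hxb (bulk_seg hu hv huv h0 h1)

lemma bdryPoint_add_two_pi (φ : ℝ) : bdryPoint (φ + 2 * Real.pi) = bdryPoint φ :=
  Slice.ext_coords (by simp [bdryPoint]) (by simp [bdryPoint])

lemma exists_chord_angles {p q : Slice} (hp : p ∈ bdry) (hq : q ∈ bdry) (hpq : p ≠ q) :
    ∃ ψ w, 0 < w ∧ w < Real.pi ∧ p = bdryPoint (ψ - w) ∧ q = bdryPoint (ψ + w) := by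
  obtain ⟨α, rfl, -⟩ := exists_eq_bdryPoint 0 hp
  rw [zero_add] at hpq ⊢
  obtain ⟨s, rfl, hs⟩ := exists_eq_bdryPoint α hq
  have hpi := ang_le_pi (bdryPoint (α + s)) (bdryPoint α)
  rw [← hs, abs_le] at hpi
  have hp0 := Real.pi_pos
  rcases lt_trichotomy s 0 with h | rfl | h
  · refine ⟨α + (s / 2 + Real.pi), s / 2 + Real.pi, by linarith, by linarith, by congr 1; ring, ?_⟩
    rw [← bdryPoint_add_two_pi]
    congr 1
    ring
  · simp at hpq
  · exact ⟨α + s / 2, s / 2, by linarith, by linarith, by congr 1; ring, by congr 1; ring⟩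

lemma continuous_bdryPoint : Continuous bdryPoint := by
  refine Continuous.subtype_mk ?_ _
  refine (PiLp.continuous_toLp 2 _).comp (continuous_pi fun i => ?_)
  fin_cases i
  · exact Real.continuous_cos
  · exact Real.continuous_sin
  · exact continuous_const

lemma exists_lin_nhds {φ : ℝ} {N : Set Slice} (hN : IsOpen N) (hp : bdryPoint φ ∈ N) :
    ∃ δ > 0, ∀ x, 1 - δ < lin φ x → x ∈ N := by
  obtain ⟨r, hr, h⟩ := Metric.isOpen_iff.1 hN _ hp
  refine ⟨r ^ 2 / 2, by positivity, fun x hx => h ?_⟩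
  rw [Metric.mem_ball, ← sq_lt_sq₀ dist_nonneg hr.le, dist_sq_slice]
  rw [lin] at hx
  have h1 := x.sq_sum
  have h2 := Real.sin_sq_add_cos_sq φ
  simp only [bdryPoint, Matrix.cons_val]
  nlinarith

/-- Near a boundary point of a chord, a region with no other frontier nearby, and with the
boundary circle nearby, is a neighbourhood. -/
lemma mem_interior_of_chord {p q : Slice} (hp : p ∈ bdry) (hq : q ∈ bdry) (hpq : p ≠ q)
    (hS : IsClosed S) {F : Set Slice} (hF : IsClosed F) (hpF : p ∉ F)
    (hfr : frontier S ⊆ chord p q ∪ F) {N : Set Slice} (hN : IsOpen N) (hpN : p ∈ N)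
    (hNS : N ∩ bdry ⊆ S) : p ∈ interior S := by
  obtain ⟨ψ, w, hw0, hw1, rfl, rfl⟩ := exists_chord_angles hp hq hpq
  rw [chord_eq hw0 hw1] at hfr
  obtain ⟨δ, hδ, hδN⟩ := exists_lin_nhds (hN.inter hF.isOpen_compl) ⟨hpN, hpF⟩
  set φ := ψ - w with hφ
  have hs : 0 < Real.sin w := Real.sin_pos_of_pos_of_lt_pi hw0 hw1
  set U := {x : Slice | 1 - δ < lin φ x} with hU
  have hUo : IsOpen U := isOpen_lt continuous_const (continuous_lin φ)
  have hpU : bdryPoint φ ∈ U := by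
    change 1 - δ < lin φ (bdryPoint φ)
    rw [lin_bdryPoint, sub_self, Real.cos_zero]
    linarith
  have hev : ∀ᶠ r : ℝ in 𝓝 0, bdryPoint (φ + r) ∈ U := by
    have h1 : Tendsto (fun r : ℝ => bdryPoint (φ + r)) (𝓝 0) (𝓝 (bdryPoint φ)) := by
      have := (continuous_bdryPoint.comp (continuous_const_add φ)).tendsto 0
      simpa [Function.comp_def] using this
    exact h1.eventually (hUo.mem_nhds hpU)
  have hUS : ∀ x ∈ U, x ∈ frontier S → lin ψ x = Real.cos w := fun x hx hxS =>
    (hfr hxS).resolve_right fun h => (hδN x hx).2 h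
  -- The chord cuts the small cap U into two convex pieces. Each misses the frontier of S and
  -- contains points of the circle near p, which belong to S; so each piece is inside S. The chord
  -- follows since S is closed.
  have hlt : U ∩ {x | lin ψ x < Real.cos w} ⊆ interior S := by
    refine subset_of_disjoint_frontier
      ((kleinConvex_lt_lin _ _).inter (kleinConvex_lin_lt _ _)).isPreconnected
      (fun x hx h => absurd (hUS x hx.1 h) (ne_of_lt hx.2)) ?_
    have e1 : ∀ᶠ r : ℝ in 𝓝[<] 0, bdryPoint (φ + r) ∈ U := nhdsWithin_le_nhds hev
    have e2 : ∀ᶠ r : ℝ in 𝓝[<] 0, r < 0 := self_mem_nhdsWithin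
    have e3 : ∀ᶠ r : ℝ in 𝓝[<] 0, -(Real.pi - w) < r :=
      nhdsWithin_le_nhds (Ioi_mem_nhds (by linarith))
    obtain ⟨r, hr1, hr2, hr3⟩ := (e1.and (e2.and e3)).exists
    refine ⟨_, ⟨hr1, ?_⟩, hNS ⟨(hδN _ hr1).1, bdryPoint_mem_bdry _⟩⟩
    change lin ψ _ < _
    rw [lin_bdryPoint, ← Real.cos_neg]
    exact Real.cos_lt_cos_of_nonneg_of_le_pi hw0.le (by linarith) (by linarith)
  have hgt : U ∩ {x | Real.cos w < lin ψ x} ⊆ interior S := by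
    refine subset_of_disjoint_frontier
      ((kleinConvex_lt_lin _ _).inter (kleinConvex_lt_lin _ _)).isPreconnected
      (fun x hx h => absurd (hUS x hx.1 h) (ne_of_gt hx.2)) ?_
    have e1 : ∀ᶠ r : ℝ in 𝓝[>] 0, bdryPoint (φ + r) ∈ U := nhdsWithin_le_nhds hev
    have e2 : ∀ᶠ r : ℝ in 𝓝[>] 0, 0 < r := self_mem_nhdsWithin
    have e3 : ∀ᶠ r : ℝ in 𝓝[>] 0, r < w := nhdsWithin_le_nhds (Iio_mem_nhds hw0)
    obtain ⟨r, hr1, hr2, hr3⟩ := (e1.and (e2.and e3)).exists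
    refine ⟨_, ⟨hr1, ?_⟩, hNS ⟨(hδN _ hr1).1, bdryPoint_mem_bdry _⟩⟩
    change _ < lin ψ _
    rw [lin_bdryPoint, ← Real.cos_neg (φ + r - ψ)]
    exact Real.cos_lt_cos_of_nonneg_of_le_pi (by linarith) (by linarith) (by linarith)
  have hU_S : U ⊆ S := by
    intro x hx
    rcases lt_trichotomy (lin ψ x) (Real.cos w) with h | h | h
    · exact interior_subset (hlt ⟨hx, h⟩)
    · have h1 : |Real.cos w| < 1 := by
        rw [abs_lt]
        constructor
        · rw [← Real.cos_pi]; exact Real.cos_lt_cos_of_nonneg_of_le_pi hw0.le le_rfl hw1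
        · rw [← Real.cos_zero]; exact Real.cos_lt_cos_of_nonneg_of_le_pi le_rfl hw1.le hw0
      have h2 := mem_closure_mul_pos (f := fun _ => 1) continuous_const h1 h one_ne_zero
      have h3 : x ∈ closure (U ∩ {x | 0 < (lin ψ x - Real.cos w) * 1}) := by
        refine mem_closure_iff.2 fun o ho hxo => ?_
        obtain ⟨y, hy1, hy2⟩ := mem_closure_iff.1 h2 _ (ho.inter hUo) ⟨hxo, hx⟩
        exact ⟨y, hy1.1, hy1.2, hy2⟩
      refine closure_minimal (fun y hy => ?_) hS h3
      have h4 : 0 < (lin ψ y - Real.cos w) * 1 := hy.2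
      exact interior_subset (hgt ⟨hy.1, show Real.cos w < lin ψ y by linarith⟩)
    · exact interior_subset (hgt ⟨hx, h⟩)
  exact interior_maximal hU_S hUo hpU

/-- An end of A lies in S and is a limit of circle points outside S, so it is on the frontier; and a
chord meets the circle only at its ends. -/
lemma IsHomologyRegion.exists_end (h : IsHomologyRegion t₀ A Γ S) {p : Slice} (hp : p ∈ ends A) :
    ∃ i, (Γ.src i).2 = p ∨ (Γ.tgt i).2 = p := by
  obtain ⟨h1, h2⟩ := hp
  rw [← h.2.1] at h1
  have h3 : p ∈ frontier S := by
    rw [h.isClosed.frontier_eq]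
    refine ⟨h1.1, fun hi => ?_⟩
    obtain ⟨y, hy, hy'⟩ := mem_closure_iff.1 h2 _ isOpen_interior hi
    exact hy'.2 (h.2.1 ▸ ⟨interior_subset hy, hy'.1⟩)
  rw [h.frontier_eq] at h3
  obtain ⟨i, hi⟩ := Set.mem_iUnion.1 h3
  refine ⟨i, ?_⟩
  rcases eq_of_mem_chord_of_mem_bdry (Γ.src_bdry i) (Γ.tgt_bdry i)
    (ExtremalSurface.src_ne_tgt h.fst_carrier i) hi h1.2 with h4 | h4
  · exact Or.inl h4.symm
  · exact Or.inr h4.symm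

/-- If the circle near p belonged to A, then p would be interior to S, although it is on the
frontier. This needs that no other chord ends at p, which is the injectivity of the end points. -/
lemma IsHomologyRegion.mem_ends_aux (h : IsHomologyRegion t₀ A Γ S) {p q : Slice} (i : Fin Γ.n)
    (hpq : (p = (Γ.src i).2 ∧ q = (Γ.tgt i).2) ∨ (p = (Γ.tgt i).2 ∧ q = (Γ.src i).2)) :
    p ∈ ends A := by
  have ht := h.fst_carrier
  have hinj := ExtremalSurface.ends_snd_injective ht
  have hpb : p ∈ bdry := by
    rcases hpq with ⟨rfl, rfl⟩ | ⟨rfl, rfl⟩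
    exacts [Γ.src_bdry i, Γ.tgt_bdry i]
  have hqb : q ∈ bdry := by
    rcases hpq with ⟨rfl, rfl⟩ | ⟨rfl, rfl⟩
    exacts [Γ.tgt_bdry i, Γ.src_bdry i]
  have hne : p ≠ q := by
    rcases hpq with ⟨rfl, rfl⟩ | ⟨rfl, rfl⟩
    exacts [ExtremalSurface.src_ne_tgt ht i, (ExtremalSurface.src_ne_tgt ht i).symm]
  have hch : chord (Γ.src i).2 (Γ.tgt i).2 = chord p q := by
    rcases hpq with ⟨rfl, rfl⟩ | ⟨rfl, rfl⟩
    exacts [rfl, chord_comm _ _]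
  have hpf : p ∈ frontier S := by
    rw [h.frontier_eq]
    exact Set.mem_iUnion.2 ⟨i, hch ▸ left_mem_chord p q⟩
  refine ⟨h.2.1 ▸ ⟨h.isClosed.frontier_subset hpf, hpb⟩, ?_⟩
  by_contra hcl
  refine hpf.2 (mem_interior_of_chord hpb hqb hne h.isClosed
    (F := ⋃ j ∈ {j | j ≠ i}, chord (Γ.src j).2 (Γ.tgt j).2)
    ((Set.toFinite _).isClosed_biUnion fun j _ => isClosed_chord _ _) ?_ ?_
    isClosed_closure.isOpen_compl hcl ?_)
  · intro hpF
    obtain ⟨j, hj, hpj⟩ := Set.mem_iUnion₂.1 hpF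
    have hj' : j ≠ i := hj
    have key := eq_of_mem_chord_of_mem_bdry (Γ.src_bdry j) (Γ.tgt_bdry j)
      (ExtremalSurface.src_ne_tgt ht j) hpj hpb
    have k1 := @hinj (Sum.inl j) (Sum.inl i)
    have k2 := @hinj (Sum.inl j) (Sum.inr i)
    have k3 := @hinj (Sum.inr j) (Sum.inl i)
    have k4 := @hinj (Sum.inr j) (Sum.inr i)
    simp only [Sum.elim_inl, Sum.elim_inr, Sum.inl.injEq, Sum.inr.injEq, reduceCtorEq] at k1 k2 k3 k4
    rcases hpq with ⟨h1, -⟩ | ⟨h1, -⟩ <;> rcases key with h2 | h2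
    exacts [hj' (k1 (h2.symm.trans h1)), k3 (h2.symm.trans h1), k2 (h2.symm.trans h1),
      hj' (k4 (h2.symm.trans h1))]
  · rw [h.frontier_eq]
    intro x hx
    obtain ⟨j, hj⟩ := Set.mem_iUnion.1 hx
    by_cases hji : j = i
    · subst hji
      exact Or.inl (hch ▸ hj)
    · exact Or.inr (Set.mem_iUnion₂.2 ⟨j, hji, hj⟩)
  · rintro x ⟨hx1, hx2⟩
    by_contra hxS
    exact hx1 (subset_closure ⟨hx2, fun hxA => hxS ((h.2.1.symm ▸ hxA : x ∈ S ∩ bdry).1)⟩)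

/-- Thus the boundary region determines the end points and their number, and only their pairing is
left free. -/
lemma IsHomologyRegion.range_ends (h : IsHomologyRegion t₀ A Γ S) :
    Set.range (Sum.elim (fun i => (Γ.src i).2) fun i => (Γ.tgt i).2) = ends A := by
  ext p
  constructor
  · rintro ⟨i | i, rfl⟩
    · exact h.mem_ends_aux i (Or.inl ⟨rfl, rfl⟩)
    · exact h.mem_ends_aux i (Or.inr ⟨rfl, rfl⟩)
  · intro hp
    obtain ⟨i, hi | hi⟩ := h.exists_end hp
    exacts [⟨Sum.inl i, hi⟩, ⟨Sum.inr i, hi⟩]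

end Homology

/-! ## End points of arcs -/

lemma isClosed_arc (a b : ℝ) : IsClosed (arc a b) :=
  (isCompact_Icc.image continuous_bdryPoint).isClosed

lemma eq_bdryPoint_of_ang_eq {φ w : ℝ} {p : Slice} (hp : p ∈ bdry) (h : ang p (bdryPoint φ) = w) :
    p = bdryPoint (φ - w) ∨ p = bdryPoint (φ + w) := by
  obtain ⟨s, rfl, hs⟩ := exists_eq_bdryPoint φ hp
  rw [h] at hs
  rcases abs_choice s with h1 | h1
  · right; rw [← hs, h1]
  · left; rw [← hs, h1]; congr 1; ring

lemma ends_arc {φ w : ℝ} (h0 : 0 < w) (h1 : w < Real.pi) :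
    ends (arc (φ - w) (φ + w)) = {bdryPoint (φ - w), bdryPoint (φ + w)} := by
  ext p
  simp only [Set.mem_insert_iff, Set.mem_singleton_iff]
  constructor
  · rintro ⟨h2, h3⟩
    have hp : p ∈ bdry := arc_subset_bdry _ _ h2
    rw [mem_arc_iff h1.le hp] at h2
    have h4 : p ∈ {x | w ≤ ang x (bdryPoint φ)} := by
      refine closure_minimal ?_ (isClosed_le continuous_const (continuous_ang _)) h3
      rintro x ⟨hx, hx'⟩
      rw [mem_arc_iff h1.le hx, not_le] at hx'
      exact le_of_lt hx'
    exact eq_bdryPoint_of_ang_eq hp (le_antisymm h2 h4)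
  -- The sign k treats the two ends together; each is approached from outside the arc by letting r
  -- decrease to w.
  · have key : ∀ k : ℝ, |k| = 1 → bdryPoint (φ + k * w) ∈ ends (arc (φ - w) (φ + w)) := by
      intro k hk
      have hang : ∀ r, 0 ≤ r → r ≤ Real.pi → ang (bdryPoint (φ + k * r)) (bdryPoint φ) = r := by
        intro r hr0 hr1
        have h5 : |φ + k * r - φ| = r := by
          rw [add_sub_cancel_left, abs_mul, hk, one_mul, abs_of_nonneg hr0]
        rw [ang_bdryPoint_bdryPoint (h5.trans_le hr1), h5]
      refine ⟨(mem_arc_iff h1.le (bdryPoint_mem_bdry _)).2 (hang w h0.le h1.le).le, ?_⟩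
      have hmem : w ∈ closure (Set.Ioo w Real.pi) := by
        rw [closure_Ioo h1.ne]
        exact ⟨le_rfl, h1.le⟩
      refine map_mem_closure (f := fun r => bdryPoint (φ + k * r))
        (continuous_bdryPoint.comp (by fun_prop)) hmem ?_
      rintro r ⟨hr0, hr1⟩
      refine ⟨bdryPoint_mem_bdry _, ?_⟩
      rw [mem_arc_iff h1.le (bdryPoint_mem_bdry _), hang r (by linarith) hr1.le]
      exact not_le.2 hr0
    rintro (rfl | rfl)
    · have := key (-1) (by simp)
      rwa [neg_one_mul, ← sub_eq_add_neg] at this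
    · have := key 1 (by simp)
      rwa [one_mul] at this

lemma ends_union {A B : Set Slice} (hA : IsClosed A) (hB : IsClosed B) (hd : Disjoint A B) :
    ends (A ∪ B) = ends A ∪ ends B := by
  have key : ∀ {A B : Set Slice}, IsClosed B → Disjoint A B → ends A ⊆ ends (A ∪ B) := by
    rintro A B hB hd p ⟨h1, h2⟩
    refine ⟨Or.inl h1, mem_closure_iff.2 fun o ho hpo => ?_⟩
    obtain ⟨y, hy1, hy2, hy3⟩ := mem_closure_iff.1 h2 _ (ho.inter hB.isOpen_compl)
      ⟨hpo, Set.disjoint_left.1 hd h1⟩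
    exact ⟨y, hy1.1, hy2, fun h => h.elim hy3 hy1.2⟩
  apply Set.Subset.antisymm
  · rintro p ⟨h1 | h1, h2⟩
    · exact Or.inl ⟨h1, closure_mono (Set.sdiff_subset_sdiff_right Set.subset_union_left) h2⟩
    · exact Or.inr ⟨h1, closure_mono (Set.sdiff_subset_sdiff_right Set.subset_union_right) h2⟩
  · refine Set.union_subset (key hB hd) ?_
    rw [Set.union_comm]
    exact key hA hd.symm

/-! ## Homology regions of arcs -/

lemma kleinConvex_lin_le (a φ : ℝ) : KleinConvex {x | lin φ x ≤ a} := by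
  rintro x hx y hy r ⟨h0, h1⟩
  simp only [Set.mem_ofPred_eq] at *
  rw [lin_seg φ x y h0 h1]
  nlinarith [mul_nonneg (sub_nonneg.2 h1) (sub_nonneg.2 hx), mul_nonneg h0 (sub_nonneg.2 hy)]

lemma lin_bdryPoint_self (φ : ℝ) : lin φ (bdryPoint φ) = 1 := by
  rw [lin_bdryPoint, sub_self, Real.cos_zero]

lemma lin_add_pi (φ : ℝ) (x : Slice) : lin (φ + Real.pi) x = -lin φ x := by
  simp only [lin, Real.cos_add_pi, Real.sin_add_pi]
  ring

lemma abs_cos_lt_one {w : ℝ} (h0 : 0 < w) (h1 : w < Real.pi) : |Real.cos w| < 1 := by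
  rw [abs_lt]
  constructor
  · rw [← Real.cos_pi]; exact Real.cos_lt_cos_of_nonneg_of_le_pi h0.le le_rfl h1
  · rw [← Real.cos_zero]; exact Real.cos_lt_cos_of_nonneg_of_le_pi le_rfl h1.le h0

section Regions

variable {t₀ : ℝ} {A S : Set Slice} {Γ : ExtremalSurface}

lemma IsHomologyRegion.subset (h : IsHomologyRegion t₀ A Γ S) : A ⊆ S := by
  rw [← h.2.1]; exact Set.inter_subset_left

lemma IsHomologyRegion.notMem (h : IsHomologyRegion t₀ A Γ S) {x : Slice} (hx : x ∈ bdry)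
    (hxA : x ∉ A) : x ∉ S := by
  rw [← h.2.1] at hxA
  exact fun hxS => hxA ⟨hxS, hx⟩

lemma IsHomologyRegion.frontier_subset_of_ends (h : IsHomologyRegion t₀ A Γ S) {U : Set Slice}
    (hU : KleinConvex U) (hA : ends A ⊆ U) : frontier S ⊆ U := by
  rw [h.frontier_eq]
  refine Set.iUnion_subset fun i => chord_subset hU (hA ?_) (hA ?_)
  · rw [← h.range_ends]; exact ⟨Sum.inl i, rfl⟩
  · rw [← h.range_ends]; exact ⟨Sum.inr i, rfl⟩

/-- If no end of A lies in the open cap, convexity keeps all chords out of it. Being connected and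
containing a point of A, the open cap then lies in S. -/
lemma IsHomologyRegion.cap_subset (h : IsHomologyRegion t₀ A Γ S) {φ w : ℝ} (h0 : 0 < w)
    (h1 : w < Real.pi) (hφ : bdryPoint φ ∈ A) (hA : ∀ p ∈ ends A, lin φ p ≤ Real.cos w) :
    cap φ w ⊆ S := by
  have hfr := h.frontier_subset_of_ends (kleinConvex_lin_le (Real.cos w) φ) hA
  have hw := abs_cos_lt_one h0 h1
  have hU : {x | Real.cos w < lin φ x} ⊆ interior S := by
    refine subset_of_disjoint_frontier (kleinConvex_lt_lin _ _).isPreconnected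
      (fun x (hx : Real.cos w < lin φ x) hxS => ?_) ⟨bdryPoint φ, ?_, h.subset hφ⟩
    · exact absurd hx (not_lt.2 (hfr hxS))
    · change Real.cos w < lin φ (bdryPoint φ)
      rw [lin_bdryPoint_self]
      exact (abs_lt.1 hw).2
  intro x hx
  rw [mem_cap_iff_lin h0.le h1.le] at hx
  rcases hx.eq_or_lt with hx | hx
  · have h2 := mem_closure_mul_pos (f := fun _ => 1) continuous_const hw hx.symm one_ne_zero
    refine closure_minimal (fun y (hy : 0 < (lin φ y - Real.cos w) * 1) => ?_) h.isClosed h2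
    exact interior_subset (hU (show Real.cos w < lin φ y by linarith))
  · exact interior_subset (hU hx)

/-- The mirror image of `IsHomologyRegion.cap_subset`: an open half-plane free of chords and
containing a circle point outside A is disjoint from S. -/
lemma IsHomologyRegion.lin_le (h : IsHomologyRegion t₀ A Γ S) {φ a : ℝ} (ha : a < 1)
    (hφ : bdryPoint φ ∉ A) (hA : ∀ p ∈ ends A, lin φ p ≤ a) : ∀ x ∈ S, lin φ x ≤ a := by
  have hfr := h.frontier_subset_of_ends (kleinConvex_lin_le a φ) hA
  intro x hx
  by_contra! hlt
  refine notMem_of_disjoint_frontier (U := {x | a < lin φ x}) (S := S)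
    (kleinConvex_lt_lin _ _).isPreconnected
    (fun x (hx : a < lin φ x) hxS => absurd hx (not_lt.2 (hfr hxS)))
    ⟨bdryPoint φ, ?_, h.notMem (bdryPoint_mem_bdry _) hφ⟩ x hlt hx
  change a < lin φ (bdryPoint φ)
  rwa [lin_bdryPoint_self]

lemma exists_equiv_of_range_eq {α β X : Type*} {f : α → X} {P : β → X} (hf : Function.Injective f)
    (hP : Function.Injective P) (h : Set.range f = Set.range P) :
    ∃ σ : α ≃ β, ∀ k, f k = P (σ k) := by
  refine ⟨(Equiv.ofInjective f hf).trans ((Equiv.setCongr h).trans (Equiv.ofInjective P hP).symm),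
    fun k => ?_⟩
  simp only [Equiv.trans_apply]
  rw [Equiv.apply_ofInjective_symm hP]
  rfl

lemma sum_len_pair {X : Type*} {n : ℕ} {u v : Fin n → X}
    (hinj : Function.Injective (Sum.elim u v)) {p q : X} (hpq : p ≠ q)
    (hr : Set.range (Sum.elim u v) = {p, q}) {f : X → X → ℝ} (hf : ∀ x y, f x y = f y x) :
    ∑ i, f (u i) (v i) = f p q := by
  obtain ⟨σ, hσ⟩ := exists_equiv_of_range_eq (P := ![p, q]) hinj (by
    intro i j hij
    fin_cases i <;> fin_cases j
    exacts [rfl, absurd hij hpq, absurd hij hpq.symm, rfl]) (by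
      rw [hr]
      ext x
      simp [eq_comm, or_comm])
  have hn : n = 1 := by
    have := Fintype.card_congr σ
    simp at this
    omega
  subst hn
  have h1 := hσ (Sum.inl 0)
  have h2 := hσ (Sum.inr 0)
  have h3 : σ (Sum.inl 0) ≠ σ (Sum.inr 0) := σ.injective.ne (by simp)
  simp only [Sum.elim_inl, Sum.elim_inr] at h1 h2
  rw [Fin.sum_univ_one, h1, h2]
  generalize σ (Sum.inl 0) = a at *
  generalize σ (Sum.inr 0) = b at *
  clear h1 h2 hσ
  fin_cases a <;> fin_cases b
  exacts [absurd rfl h3, rfl, hf _ _, absurd rfl h3]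

lemma dist_bdryPoint {a b : ℝ} (h0 : 0 ≤ (b - a) / 2) (h1 : (b - a) / 2 ≤ Real.pi) :
    dist (bdryPoint a) (bdryPoint b) = 2 * Real.sin ((b - a) / 2) := by
  have h2 := Real.sin_nonneg_of_nonneg_of_le_pi h0 h1
  rw [← sq_eq_sq₀ dist_nonneg (by positivity), dist_sq_bdry (bdryPoint_mem_bdry _)
    (bdryPoint_mem_bdry _)]
  have h3 : Real.cos (b - a) = 1 - 2 * Real.sin ((b - a) / 2) ^ 2 := by
    have := Real.cos_two_mul ((b - a) / 2)
    rw [show 2 * ((b - a) / 2) = b - a by ring] at this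
    nlinarith [Real.sin_sq_add_cos_sq ((b - a) / 2)]
  rw [Real.cos_sub] at h3
  simp only [bdryPoint, Matrix.cons_val]
  linarith

lemma bdryPoint_ne {a b : ℝ} (h0 : 0 < (b - a) / 2) (h1 : (b - a) / 2 < Real.pi) :
    bdryPoint a ≠ bdryPoint b := by
  have := Real.sin_pos_of_pos_of_lt_pi h0 h1
  rw [← dist_pos, dist_bdryPoint h0.le h1.le]
  positivity

lemma IsHomologyRegion.area_arc {φ w : ℝ} (h0 : 0 < w) (h1 : w < Real.pi)
    (h : IsHomologyRegion t₀ (arc (φ - w) (φ + w)) Γ S) {ε : ℝ} (hε : 0 < ε) :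
    Γ.area ε = len (2 * Real.sin w) ε := by
  have h2 : (φ + w - (φ - w)) / 2 = w := by ring
  rw [ExtremalSurface.area_eq h.fst_carrier hε,
    sum_len_pair (f := fun x y => len (dist x y) ε)
      (ExtremalSurface.ends_snd_injective h.fst_carrier)
      (bdryPoint_ne (a := φ - w) (b := φ + w) (by rwa [h2]) (by rwa [h2]))
      (h.range_ends.trans (ends_arc h0 h1)) (fun x y => by rw [dist_comm]),
    dist_bdryPoint (by rw [h2]; exact h0.le) (by rw [h2]; exact h1.le), h2]

/-- The chord is forced; the side of φ is inside by `IsHomologyRegion.cap_subset` and the side of φ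
+ π is outside by `IsHomologyRegion.lin_le`. -/
lemma IsHomologyRegion.eq_cap {φ w : ℝ} (h0 : 0 < w) (h1 : w < Real.pi)
    (h : IsHomologyRegion t₀ (arc (φ - w) (φ + w)) Γ S) : S = cap φ w := by
  have hw := abs_lt.1 (abs_cos_lt_one h0 h1)
  have he : ∀ p ∈ ends (arc (φ - w) (φ + w)), lin φ p = Real.cos w := by
    rw [ends_arc h0 h1]
    rintro p (rfl | rfl) <;> rw [lin_bdryPoint]
    · rw [show φ - w - φ = -w by ring, Real.cos_neg]
    · rw [add_sub_cancel_left]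
  apply Set.Subset.antisymm
  · intro x hx
    rw [mem_cap_iff_lin h0.le h1.le]
    have := h.lin_le (φ := φ + Real.pi) (a := -Real.cos w) (by linarith) (fun hm => ?_)
      (fun p hp => by rw [lin_add_pi, he p hp]) x hx
    · rw [lin_add_pi] at this
      linarith
    · rw [mem_arc_iff h1.le (bdryPoint_mem_bdry _), ang_bdryPoint_bdryPoint] at hm <;>
        rw [add_sub_cancel_left, abs_of_pos Real.pi_pos] at *
      linarith
  · exact h.cap_subset h0 h1 ⟨φ, ⟨by linarith, by linarith⟩, rfl⟩ fun p hp => (he p hp).le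

lemma exists_homology_arc (t₀ : ℝ) {φ w : ℝ} (h0 : 0 < w) (h1 : w < Real.pi) :
    ∃ Γ, IsHomologyRegion t₀ (arc (φ - w) (φ + w)) Γ (cap φ w) := by
  have h2 : (φ + w - (φ - w)) / 2 = w := by ring
  have hne := bdryPoint_ne (a := φ - w) (b := φ + w) (by rwa [h2]) (by rwa [h2])
  have hinj : Function.Injective (Sum.elim (fun _ : Fin 1 => bdryPoint (φ - w))
      fun _ : Fin 1 => bdryPoint (φ + w)) := by
    rintro (i | i) (j | j) hij
    · rw [Subsingleton.elim i j]
    · exact absurd hij hne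
    · exact absurd hij hne.symm
    · rw [Subsingleton.elim i j]
  have hcap : cap φ w = {x | 0 ≤ lin φ x - Real.cos w} := by
    ext x
    rw [mem_cap_iff_lin h0.le h1.le]
    exact sub_nonneg.symm
  have hw := abs_cos_lt_one h0 h1
  have hc : Continuous fun x => lin φ x - Real.cos w := (continuous_lin φ).sub continuous_const
  have hpos : ∀ x, lin φ x - Real.cos w = 0 → x ∈ closure {x | 0 < lin φ x - Real.cos w} := by
    intro x hx
    simpa using mem_closure_mul_pos (f := fun _ => 1) continuous_const hw (sub_eq_zero.1 hx)
      one_ne_zero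
  have hneg : ∀ x, lin φ x - Real.cos w = 0 → x ∈ closure {x | lin φ x - Real.cos w < 0} := by
    intro x hx
    simpa using mem_closure_mul_neg (f := fun _ => 1) continuous_const hw (sub_eq_zero.1 hx)
      one_ne_zero
  refine ⟨ofChords t₀ _ _ (fun _ => bdryPoint_mem_bdry _) (fun _ => bdryPoint_mem_bdry _) hinj,
    isHomologyRegion_ofChords ?_ ?_ ?_⟩
  · rw [hcap]
    exact closure_interior_setOf_nonneg hc hpos hneg
  · ext x
    constructor
    · rintro ⟨hx, hb⟩
      exact (mem_arc_iff h1.le hb).2 hx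
    · intro hx
      have hb := arc_subset_bdry _ _ hx
      exact ⟨(mem_arc_iff h1.le hb).1 hx, hb⟩
  · rw [hcap, frontier_setOf_nonneg hc hneg, Set.iUnion_const, chord_eq h0 h1]
    ext x
    exact sub_eq_zero

/-! ## Surfaces with four end points -/

/-- The surface `Γ` consists of the chords `p q` and `p' q'`. -/
def IsMatched (Γ : ExtremalSurface) (S : Set Slice) (p q p' q' : Slice) : Prop :=
  (∀ ε > 0, Γ.area ε = len (dist p q) ε + len (dist p' q') ε) ∧
    frontier S = chord p q ∪ chord p' q'

-- Four points have three perfect matchings. Allowing any symmetric f yields the areas and the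
-- carriers from the same matching.
set_option synthInstance.maxSize 2000 in
set_option synthInstance.maxHeartbeats 400000 in
lemma exists_matching {X : Type*} {n : ℕ} {u v : Fin n → X}
    (hinj : Function.Injective (Sum.elim u v)) {P : Fin 4 → X} (hP : Function.Injective P)
    (hr : Set.range (Sum.elim u v) = Set.range P) :
    ∃ a b c d : Fin 4, ((a = 0 ∧ b = 1 ∧ c = 2 ∧ d = 3) ∨ (a = 1 ∧ b = 2 ∧ c = 3 ∧ d = 0) ∨
      (a = 0 ∧ b = 2 ∧ c = 1 ∧ d = 3)) ∧
      (∀ f : X → X → ℝ, (∀ x y, f x y = f y x) →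
        ∑ i, f (u i) (v i) = f (P a) (P b) + f (P c) (P d)) ∧
      (∀ f : X → X → Set X, (∀ x y, f x y = f y x) →
        ⋃ i, f (u i) (v i) = f (P a) (P b) ∪ f (P c) (P d)) := by
  obtain ⟨σ, hσ⟩ := exists_equiv_of_range_eq hinj hP hr
  have hn : n = 2 := by
    have := Fintype.card_congr σ
    simp at this
    omega
  subst hn
  have hu : ∀ i, u i = P (σ (Sum.inl i)) := fun i => hσ (Sum.inl i)
  have hv : ∀ i, v i = P (σ (Sum.inr i)) := fun i => hσ (Sum.inr i)
  -- A finite check: up to the orientation and the order of the two pairs, only the three matchings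
  -- occur.
  have key : ∀ a b c d : Fin 4, a ≠ b → a ≠ c → a ≠ d → b ≠ c → b ≠ d → c ≠ d →
      ∃ a' b' c' d' : Fin 4, ((a' = 0 ∧ b' = 1 ∧ c' = 2 ∧ d' = 3) ∨
        (a' = 1 ∧ b' = 2 ∧ c' = 3 ∧ d' = 0) ∨ (a' = 0 ∧ b' = 2 ∧ c' = 1 ∧ d' = 3)) ∧
        ((((a = a' ∧ b = b') ∨ (a = b' ∧ b = a')) ∧ ((c = c' ∧ d = d') ∨ (c = d' ∧ d = c'))) ∨
        (((c = a' ∧ d = b') ∨ (c = b' ∧ d = a')) ∧ ((a = c' ∧ b = d') ∨ (a = d' ∧ b = c')))) := by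
    decide
  have hne : ∀ k l, k ≠ l → σ k ≠ σ l := fun k l h => σ.injective.ne h
  obtain ⟨a, b, c, d, h1, h2⟩ := key (σ (Sum.inl 0)) (σ (Sum.inr 0)) (σ (Sum.inl 1))
    (σ (Sum.inr 1)) (hne _ _ (by simp)) (hne _ _ (by simp)) (hne _ _ (by simp))
    (hne _ _ (by simp)) (hne _ _ (by simp)) (hne _ _ (by simp))
  have hU : ∀ s : Fin 2 → Set X, ⋃ i, s i = s 0 ∪ s 1 := fun s => by
    ext x
    simp [Fin.exists_fin_two]
  refine ⟨a, b, c, d, h1, fun f hf => ?_, fun f hf => ?_⟩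
  · rw [Fin.sum_univ_two, hu, hu, hv, hv]
    rcases h2 with ⟨⟨h3, h4⟩ | ⟨h3, h4⟩, ⟨h5, h6⟩ | ⟨h5, h6⟩⟩ |
      ⟨⟨h3, h4⟩ | ⟨h3, h4⟩, ⟨h5, h6⟩ | ⟨h5, h6⟩⟩ <;> rw [h3, h4, h5, h6]
    · rw [hf (P d)]
    · rw [hf (P b)]
    · rw [hf (P b), hf (P d)]
    · rw [add_comm]
    · rw [add_comm, hf (P d)]
    · rw [add_comm, hf (P b)]
    · rw [add_comm, hf (P b), hf (P d)]
  · rw [hU, hu, hu, hv, hv]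
    rcases h2 with ⟨⟨h3, h4⟩ | ⟨h3, h4⟩, ⟨h5, h6⟩ | ⟨h5, h6⟩⟩ |
      ⟨⟨h3, h4⟩ | ⟨h3, h4⟩, ⟨h5, h6⟩ | ⟨h5, h6⟩⟩ <;> rw [h3, h4, h5, h6]
    · rw [hf (P d)]
    · rw [hf (P b)]
    · rw [hf (P b), hf (P d)]
    · rw [Set.union_comm]
    · rw [Set.union_comm, hf (P d)]
    · rw [Set.union_comm, hf (P b)]
    · rw [Set.union_comm, hf (P b), hf (P d)]

lemma IsHomologyRegion.isMatched (h : IsHomologyRegion t₀ A Γ S) {p₀ p₁ p₂ p₃ : Slice}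
    (hP : Function.Injective ![p₀, p₁, p₂, p₃]) (hA : ends A = {p₀, p₁, p₂, p₃}) :
    IsMatched Γ S p₀ p₁ p₂ p₃ ∨ IsMatched Γ S p₁ p₂ p₃ p₀ ∨ IsMatched Γ S p₀ p₂ p₁ p₃ := by
  obtain ⟨a, b, c, d, h1, h2, h3⟩ := exists_matching
    (ExtremalSurface.ends_snd_injective h.fst_carrier) hP (by
      rw [h.range_ends, hA]
      ext x
      simp only [Set.mem_insert_iff, Set.mem_singleton_iff, Set.mem_range, Fin.exists_fin_succ]
      simp [eq_comm])
  have h4 : ∀ ε > 0, Γ.area ε = len (dist (![p₀, p₁, p₂, p₃] a) (![p₀, p₁, p₂, p₃] b)) ε +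
      len (dist (![p₀, p₁, p₂, p₃] c) (![p₀, p₁, p₂, p₃] d)) ε := fun ε hε => by
    rw [ExtremalSurface.area_eq h.fst_carrier hε]
    exact h2 (fun x y => len (dist x y) ε) fun x y => by rw [dist_comm]
  have h5 := h.frontier_eq.trans (h3 chord chord_comm)
  rcases h1 with ⟨rfl, rfl, rfl, rfl⟩ | ⟨rfl, rfl, rfl, rfl⟩ | ⟨rfl, rfl, rfl, rfl⟩
  · exact Or.inl ⟨h4, h5⟩
  · exact Or.inr (Or.inl ⟨h4, h5⟩)
  · exact Or.inr (Or.inr ⟨h4, h5⟩)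

/-- Regions bounded by two chords. -/
lemma exists_homology_product (t₀ : ℝ) {p q p' q' : Slice} (hp : p ∈ bdry) (hq : q ∈ bdry)
    (hp' : p' ∈ bdry) (hq' : q' ∈ bdry) (hinj : Function.Injective ![p, p', q, q'])
    {φ a ψ b k : ℝ} (ha : |a| < 1) (hb : |b| < 1) (hk : k ≠ 0)
    (h1 : chord p q = {x | lin φ x = a}) (h2 : chord p' q' = {x | lin ψ x = b})
    (hcross : ∀ x, lin φ x = a → lin ψ x = b →
      x ∈ closure {x | 0 < (lin φ x - a) * (k * (lin ψ x - b))} ∧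
      x ∈ closure {x | (lin φ x - a) * (k * (lin ψ x - b)) < 0})
    (hA : ∀ x ∈ bdry, 0 ≤ (lin φ x - a) * (k * (lin ψ x - b)) ↔ x ∈ A) (hAb : A ⊆ bdry) :
    ∃ Γ, IsHomologyRegion t₀ A Γ {x | 0 ≤ (lin φ x - a) * (k * (lin ψ x - b))} ∧
      IsMatched Γ {x | 0 ≤ (lin φ x - a) * (k * (lin ψ x - b))} p q p' q' := by
  have hcφ := continuous_lin φ
  have hcψ := continuous_lin ψ
  set g : Slice → ℝ := fun x => (lin φ x - a) * (k * (lin ψ x - b)) with hg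
  have hgc : Continuous g := by fun_prop
  -- Away from a crossing only one factor vanishes, and it changes sign across its chord. The
  -- crossing point, if any, is left to `hcross`.
  have hcl : ∀ x, g x = 0 → x ∈ closure {x | 0 < g x} ∧ x ∈ closure {x | g x < 0} := by
    intro x hx
    by_cases e1 : lin φ x = a
    · by_cases e2 : lin ψ x = b
      · exact hcross x e1 e2
      · have e3 : k * (lin ψ x - b) ≠ 0 := mul_ne_zero hk (sub_ne_zero.2 e2)
        exact ⟨mem_closure_mul_pos (f := fun x => k * (lin ψ x - b)) (by fun_prop) ha e1 e3,
          mem_closure_mul_neg (f := fun x => k * (lin ψ x - b)) (by fun_prop) ha e1 e3⟩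
    · have e2 : lin ψ x = b := by
        rcases mul_eq_zero.1 hx with h | h
        · exact absurd (sub_eq_zero.1 h) e1
        · exact sub_eq_zero.1 ((mul_eq_zero.1 h).resolve_left hk)
      have e3 : k * (lin φ x - a) ≠ 0 := mul_ne_zero hk (sub_ne_zero.2 e1)
      have e4 : g = fun x => (lin ψ x - b) * (k * (lin φ x - a)) := by
        funext x
        simp only [hg]
        ring
      rw [e4]
      exact ⟨mem_closure_mul_pos (f := fun x => k * (lin φ x - a)) (by fun_prop) hb e2 e3,
        mem_closure_mul_neg (f := fun x => k * (lin φ x - a)) (by fun_prop) hb e2 e3⟩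
  have hfr : frontier {x | 0 ≤ g x} = chord p q ∪ chord p' q' := by
    rw [frontier_setOf_nonneg hgc fun x hx => (hcl x hx).2, h1, h2]
    ext x
    simp [hg, sub_eq_zero, hk]
  have hinj' : Function.Injective (Sum.elim ![p, p'] ![q, q']) := by
    have e : Sum.elim ![p, p'] ![q, q'] =
        fun k => ![p, p', q, q'] (Sum.elim ![0, 1] ![2, 3] k) := by
      funext k
      rcases k with k | k <;> fin_cases k <;> rfl
    rw [e]
    refine hinj.comp ?_
    decide
  have hu : ∀ i, ![p, p'] i ∈ bdry := Fin.forall_fin_two.2 ⟨hp, hp'⟩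
  have hv : ∀ i, ![q, q'] i ∈ bdry := Fin.forall_fin_two.2 ⟨hq, hq'⟩
  refine ⟨ofChords t₀ _ _ hu hv hinj', isHomologyRegion_ofChords ?_ ?_ ?_, fun ε hε => ?_, hfr⟩
  · exact closure_interior_setOf_nonneg hgc (fun x hx => (hcl x hx).1) fun x hx => (hcl x hx).2
  · ext x
    exact ⟨fun hx => (hA x hx.2).1 hx.1, fun hx => ⟨(hA x (hAb hx)).2 hx, hAb hx⟩⟩
  · rw [hfr]
    ext x
    simp [Fin.exists_fin_two]
  · rw [ExtremalSurface.area_eq fst_carrier_ofChords hε]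
    exact Fin.sum_univ_two _

/-! ### Nesting of wedges, and the wedges of one arc -/

lemma outerWedge_subset_iff {S T : Set Slice} : outerWedge t₀ S ⊆ outerWedge t₀ T ↔ S ⊆ T := by
  constructor
  · intro h x hx
    have h1 : (t₀, x) ∈ outerWedge t₀ S :=
      ⟨trivial, fun c _ hcx => ⟨t₀, rfl, by rw [hcx]; exact hx⟩⟩
    -- The static curve at x meets the slice only at x, so a wedge remembers its region.
    obtain ⟨t, ht, hc⟩ := (h h1).2 (fun _ => x)
      ⟨LipschitzWith.const' x, fun _ => trivial⟩ rfl
    exact hc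
  · rintro h p ⟨hp, h1⟩
    refine ⟨hp, fun c hc hcp => ?_⟩
    obtain ⟨t, ht1, ht2⟩ := h1 c hc hcp
    exact ⟨t, ht1, h ht2⟩

/-- Two appetizers are each outermost, so their outer wedges coincide. -/
lemma IsAppetizer.easyWedge_eq (h : IsAppetizer t₀ A Γ S) : easyWedge t₀ A = outerWedge t₀ S := by
  apply Set.Subset.antisymm
  · rintro p ⟨Γ', S', h1, h2⟩
    exact h1.2 Γ S h.1 h2
  · intro p hp
    exact ⟨Γ, S, h, hp⟩

lemma entanglementWedge_arc {φ w : ℝ} (h0 : 0 < w) (h1 : w < Real.pi) :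
    entanglementWedge t₀ (arc (φ - w) (φ + w)) = outerWedge t₀ (cap φ w) := by
  apply Set.Subset.antisymm
  · rintro p ⟨Γ, S, -, h, hp⟩
    rwa [h.eq_cap h0 h1] at hp
  · intro p hp
    obtain ⟨Γ, hΓ⟩ := exists_homology_arc t₀ (φ := φ) h0 h1
    refine ⟨Γ, _, ⟨⟨_, hΓ⟩, ?_⟩, hΓ, hp⟩
    rintro Γ' ⟨S', h'⟩
    filter_upwards [self_mem_nhdsWithin] with ε hε
    rw [hΓ.area_arc h0 h1 hε, h'.area_arc h0 h1 hε]

lemma easyWedge_arc {φ w : ℝ} (h0 : 0 < w) (h1 : w < Real.pi) :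
    easyWedge t₀ (arc (φ - w) (φ + w)) = outerWedge t₀ (cap φ w) := by
  obtain ⟨Γ, hΓ⟩ := exists_homology_arc t₀ (φ := φ) h0 h1
  refine IsAppetizer.easyWedge_eq (Γ := Γ) ⟨⟨hΓ, fun Γ' S' h' _ => ?_⟩, fun Γ' S' h' => ?_⟩
  · filter_upwards [self_mem_nhdsWithin] with ε hε
    rw [hΓ.area_arc h0 h1 hε, h'.area_arc h0 h1 hε]
  · rw [h'.1.eq_cap h0 h1]

end Regions

/-! ## Two arcs -/

lemma injective_vec_four {X : Type*} {p q r s : X} (h1 : p ≠ q) (h2 : p ≠ r) (h3 : p ≠ s)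
    (h4 : q ≠ r) (h5 : q ≠ s) (h6 : r ≠ s) : Function.Injective ![p, q, r, s] := by
  intro i j hij
  fin_cases i <;> fin_cases j
  exacts [rfl, absurd hij h1, absurd hij h2, absurd hij h3, absurd hij h1.symm, rfl,
    absurd hij h4, absurd hij h5, absurd hij h2.symm, absurd hij h4.symm, rfl, absurd hij h6,
    absurd hij h3.symm, absurd hij h5.symm, absurd hij h6.symm, rfl]

lemma chord_bdryPoint {a b φ w : ℝ} (ha : a = φ - w) (hb : b = φ + w) (h0 : 0 < w)
    (h1 : w < Real.pi) : chord (bdryPoint a) (bdryPoint b) = {x | lin φ x = Real.cos w} := by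
  rw [ha, hb, chord_eq h0 h1]

lemma sq_add_sq_of_mem_bdry {x : Slice} (hx : x ∈ bdry) : x.1 0 ^ 2 + x.1 1 ^ 2 = 1 := by
  have h := x.sq_sum
  have h2 : x.1 2 = 0 := hx
  rw [h2] at h
  linarith

lemma lin_zero (x : Slice) : lin 0 x = x.1 0 := by simp [lin]

lemma lin_pi (x : Slice) : lin Real.pi x = -x.1 0 := by simp [lin]

lemma lin_pi_div_two (x : Slice) : lin (Real.pi / 2) x = x.1 1 := by simp [lin]

lemma lin_three_pi_div_two (x : Slice) : lin (Real.pi / 2 + Real.pi) x = -x.1 1 := by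
  rw [lin_add_pi, lin_pi_div_two]

lemma lin_pi_div_two_sub (m : ℝ) (x : Slice) :
    lin (Real.pi / 2 - m) x = x.1 0 * Real.sin m + x.1 1 * Real.cos m := by
  simp [lin, Real.cos_pi_div_two_sub, Real.sin_pi_div_two_sub]

lemma lin_pi_div_two_add (m : ℝ) (x : Slice) :
    lin (Real.pi / 2 + m) x = -x.1 0 * Real.sin m + x.1 1 * Real.cos m := by
  rw [add_comm, lin, Real.cos_add_pi_div_two, Real.sin_add_pi_div_two]
  ring

lemma arc_disjoint {φ φ' w : ℝ} (h0 : 0 ≤ w) (h1 : w ≤ Real.pi)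
    (h : ∀ x : Slice, Real.cos w ≤ lin φ x → Real.cos w ≤ lin φ' x → False) :
    Disjoint (arc (φ - w) (φ + w)) (arc (φ' - w) (φ' + w)) := by
  rw [Set.disjoint_left]
  intro x hx hx'
  have hb := arc_subset_bdry _ _ hx
  rw [mem_arc_iff h1 hb, ← mem_cap, mem_cap_iff_lin h0 h1] at hx hx'
  exact h x hx hx'

/-! ### The region of the referee -/

section RegionR

variable {μ : ℝ}

lemma regionR_eq (μ : ℝ) : regionR μ =
    arc (0 - μ / 2) (0 + μ / 2) ∪ arc (Real.pi - μ / 2) (Real.pi + μ / 2) := by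
  rw [regionR, zero_sub, zero_add]

lemma cos_half_pos (h0 : 0 < μ) (h1 : μ < Real.pi) : 0 < Real.cos (μ / 2) :=
  Real.cos_pos_of_mem_Ioo ⟨by linarith, by linarith⟩

lemma sin_half_pos (h0 : 0 < μ) (h1 : μ < Real.pi) : 0 < Real.sin (μ / 2) :=
  Real.sin_pos_of_pos_of_lt_pi (by linarith) (by linarith)

lemma mem_regionR_iff_sq (h0 : 0 < μ) (h1 : μ < Real.pi) {x : Slice} (hx : x ∈ bdry) :
    x ∈ regionR μ ↔ 0 ≤ x.1 0 ^ 2 - Real.cos (μ / 2) ^ 2 := by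
  have hc := cos_half_pos h0 h1
  rw [regionR_eq, Set.mem_union, mem_arc_iff (by linarith) hx, mem_arc_iff (by linarith) hx,
    ← mem_cap, ← mem_cap, mem_cap_iff_lin (by linarith) (by linarith),
    mem_cap_iff_lin (by linarith) (by linarith), lin_zero, lin_pi, sub_nonneg, sq_le_sq,
    abs_of_pos hc, le_abs]

lemma ends_regionR (h0 : 0 < μ) (h1 : μ < Real.pi) : ends (regionR μ) =
    {bdryPoint (0 - μ / 2), bdryPoint (0 + μ / 2), bdryPoint (Real.pi - μ / 2),
      bdryPoint (Real.pi + μ / 2)} := by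
  have hc := cos_half_pos h0 h1
  rw [regionR_eq, ends_union (isClosed_arc _ _) (isClosed_arc _ _)
    (arc_disjoint (by linarith) (by linarith) fun x h2 h3 => ?_),
    ends_arc (by linarith) (by linarith), ends_arc (by linarith) (by linarith)]
  · ext x
    simp only [Set.mem_union, Set.mem_insert_iff, Set.mem_singleton_iff, or_assoc]
  · rw [lin_zero] at h2
    rw [lin_pi] at h3
    linarith

lemma injective_ends_regionR (h0 : 0 < μ) (h1 : μ < Real.pi) :
    Function.Injective ![bdryPoint (0 - μ / 2), bdryPoint (0 + μ / 2),
      bdryPoint (Real.pi - μ / 2), bdryPoint (Real.pi + μ / 2)] := by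
  apply injective_vec_four <;> exact bdryPoint_ne (by linarith) (by linarith)

lemma regionR_subset_bdry (μ : ℝ) : regionR μ ⊆ bdry :=
  Set.union_subset (arc_subset_bdry _ _) (arc_subset_bdry _ _)

/-- The chords join the ends of each interval of `regionR`. -/
def IsOuter (μ : ℝ) (Γ : ExtremalSurface) (S : Set Slice) : Prop :=
  IsMatched Γ S (bdryPoint (0 - μ / 2)) (bdryPoint (0 + μ / 2)) (bdryPoint (Real.pi - μ / 2))
    (bdryPoint (Real.pi + μ / 2))

/-- The chords join the ends of each complementary interval of `regionR`. -/
def IsInner (μ : ℝ) (Γ : ExtremalSurface) (S : Set Slice) : Prop :=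
  IsMatched Γ S (bdryPoint (0 + μ / 2)) (bdryPoint (Real.pi - μ / 2)) (bdryPoint (Real.pi + μ / 2))
    (bdryPoint (0 - μ / 2))

/-- The chords join opposite ends of `regionR`. -/
def IsCross (μ : ℝ) (Γ : ExtremalSurface) (S : Set Slice) : Prop :=
  IsMatched Γ S (bdryPoint (0 - μ / 2)) (bdryPoint (Real.pi - μ / 2)) (bdryPoint (0 + μ / 2))
    (bdryPoint (Real.pi + μ / 2))

variable {t₀ : ℝ} {Γ : ExtremalSurface} {S : Set Slice}

lemma IsHomologyRegion.cases_regionR (h0 : 0 < μ) (h1 : μ < Real.pi)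
    (h : IsHomologyRegion t₀ (regionR μ) Γ S) :
    IsOuter μ Γ S ∨ IsInner μ Γ S ∨ IsCross μ Γ S :=
  h.isMatched (injective_ends_regionR h0 h1) (ends_regionR h0 h1)

lemma IsOuter.area (h0 : 0 < μ) (h1 : μ < Real.pi) (h : IsOuter μ Γ S) {ε : ℝ} (hε : 0 < ε) :
    Γ.area ε = 2 * len (2 * Real.sin (μ / 2)) ε := by
  rw [h.1 ε hε, dist_bdryPoint (by linarith) (by linarith),
    dist_bdryPoint (by linarith) (by linarith), show (0 + μ / 2 - (0 - μ / 2)) / 2 = μ / 2 by ring,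
    show (Real.pi + μ / 2 - (Real.pi - μ / 2)) / 2 = μ / 2 by ring]
  ring

lemma bdryPoint_two_pi_sub (a : ℝ) : bdryPoint (2 * Real.pi - a) = bdryPoint (0 - a) := by
  rw [← bdryPoint_add_two_pi (0 - a)]
  congr 1
  ring

lemma IsInner.area (h0 : 0 < μ) (h1 : μ < Real.pi) (h : IsInner μ Γ S) {ε : ℝ} (hε : 0 < ε) :
    Γ.area ε = 2 * len (2 * Real.cos (μ / 2)) ε := by
  rw [h.1 ε hε, ← bdryPoint_two_pi_sub, dist_bdryPoint (by linarith) (by linarith),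
    dist_bdryPoint (by linarith) (by linarith),
    show (Real.pi - μ / 2 - (0 + μ / 2)) / 2 = Real.pi / 2 - μ / 2 by ring,
    show (2 * Real.pi - μ / 2 - (Real.pi + μ / 2)) / 2 = Real.pi / 2 - μ / 2 by ring,
    Real.sin_pi_div_two_sub]
  ring

/-- Opposite ends of the region are antipodal: both chords are diameters, whatever μ is. -/
lemma IsCross.area (h : IsCross μ Γ S) {ε : ℝ} (hε : 0 < ε) : Γ.area ε = 2 * len 2 ε := by
  have hp := Real.pi_pos
  rw [h.1 ε hε, dist_bdryPoint (by linarith) (by linarith),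
    dist_bdryPoint (by linarith) (by linarith),
    show (Real.pi - μ / 2 - (0 - μ / 2)) / 2 = Real.pi / 2 by ring,
    show (Real.pi + μ / 2 - (0 + μ / 2)) / 2 = Real.pi / 2 by ring, Real.sin_pi_div_two, mul_one]
  ring

lemma IsOuter.frontier_eq (h0 : 0 < μ) (h1 : μ < Real.pi) (h : IsOuter μ Γ S) :
    frontier S = {x | lin 0 x = Real.cos (μ / 2)} ∪ {x | lin Real.pi x = Real.cos (μ / 2)} := by
  rw [h.2, chord_eq (by linarith) (by linarith), chord_eq (by linarith) (by linarith)]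

lemma IsCross.frontier_eq (h : IsCross μ Γ S) :
    frontier S = {x | lin (Real.pi / 2 - μ / 2) x = 0} ∪ {x | lin (Real.pi / 2 + μ / 2) x = 0} := by
  have hp := Real.pi_pos
  rw [h.2, chord_bdryPoint (φ := Real.pi / 2 - μ / 2) (w := Real.pi / 2) (by ring) (by ring)
    (by linarith) (by linarith), chord_bdryPoint (φ := Real.pi / 2 + μ / 2) (w := Real.pi / 2)
    (by ring) (by ring) (by linarith) (by linarith), Real.cos_pi_div_two]

lemma exists_isOuter (t₀ : ℝ) (h0 : 0 < μ) (h1 : μ < Real.pi) :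
    ∃ Γ, IsHomologyRegion t₀ (regionR μ) Γ (cap 0 (μ / 2) ∪ cap (0 + Real.pi) (μ / 2)) ∧
      IsOuter μ Γ (cap 0 (μ / 2) ∪ cap (0 + Real.pi) (μ / 2)) := by
  have hc := cos_half_pos h0 h1
  have hw := abs_cos_lt_one (w := μ / 2) (by linarith) (by linarith)
  have hS : cap 0 (μ / 2) ∪ cap (0 + Real.pi) (μ / 2) = {x | 0 ≤ (lin 0 x - Real.cos (μ / 2)) *
      (-1 * (lin Real.pi x - Real.cos (μ / 2)))} := by
    ext x
    rw [Set.mem_union, mem_cap_iff_lin (by linarith) (by linarith),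
      mem_cap_iff_lin (by linarith) (by linarith), zero_add, Set.mem_ofPred_eq, lin_zero, lin_pi,
      show (x.1 0 - Real.cos (μ / 2)) * (-1 * (-x.1 0 - Real.cos (μ / 2))) =
        x.1 0 ^ 2 - Real.cos (μ / 2) ^ 2 by ring, sub_nonneg, sq_le_sq, abs_of_pos hc, le_abs]
  rw [hS]
  refine exists_homology_product t₀ (bdryPoint_mem_bdry _) (bdryPoint_mem_bdry _)
    (bdryPoint_mem_bdry _) (bdryPoint_mem_bdry _) ?_ hw hw (by norm_num)
    (chord_eq (by linarith) (by linarith)) (chord_eq (by linarith) (by linarith)) ?_ ?_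
    (regionR_subset_bdry μ)
  · apply injective_vec_four <;> first
      | exact bdryPoint_ne (by linarith) (by linarith)
      | exact (bdryPoint_ne (by linarith) (by linarith)).symm
  · intro x h2 h3
    rw [lin_zero] at h2
    rw [lin_pi] at h3
    linarith
  · intro x hx
    rw [mem_regionR_iff_sq h0 h1 hx, lin_zero, lin_pi]
    ring_nf

lemma exists_isInner (t₀ : ℝ) (h0 : 0 < μ) (h1 : μ < Real.pi) :
    ∃ Γ, IsHomologyRegion t₀ (regionR μ) Γ {x | x.1 1 ^ 2 ≤ Real.sin (μ / 2) ^ 2} ∧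
      IsInner μ Γ {x | x.1 1 ^ 2 ≤ Real.sin (μ / 2) ^ 2} := by
  have hs := sin_half_pos h0 h1
  have hw := abs_cos_lt_one (w := Real.pi / 2 - μ / 2) (by linarith) (by linarith)
  have hS : {x : Slice | x.1 1 ^ 2 ≤ Real.sin (μ / 2) ^ 2} =
      {x | 0 ≤ (lin (Real.pi / 2) x - Real.cos (Real.pi / 2 - μ / 2)) *
        (1 * (lin (Real.pi / 2 + Real.pi) x - Real.cos (Real.pi / 2 - μ / 2)))} := by
    ext x
    rw [Set.mem_ofPred_eq, Set.mem_ofPred_eq, lin_three_pi_div_two, lin_pi_div_two,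
      Real.cos_pi_div_two_sub, ← sub_nonneg]
    ring_nf
  rw [hS]
  refine exists_homology_product t₀ (bdryPoint_mem_bdry _) (bdryPoint_mem_bdry _)
    (bdryPoint_mem_bdry _) (bdryPoint_mem_bdry _) ?_ hw hw (by norm_num)
    (chord_bdryPoint (by ring) (by ring) (by linarith) (by linarith))
    (by rw [← bdryPoint_two_pi_sub]
        exact chord_bdryPoint (by ring) (by ring) (by linarith) (by linarith)) ?_ ?_
    (regionR_subset_bdry μ)
  · apply injective_vec_four <;> first
      | exact bdryPoint_ne (by linarith) (by linarith)
      | exact (bdryPoint_ne (by linarith) (by linarith)).symm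
  · intro x h2 h3
    rw [Real.cos_pi_div_two_sub] at h2 h3
    rw [lin_pi_div_two] at h2
    rw [lin_three_pi_div_two] at h3
    linarith
  · intro x hx
    rw [mem_regionR_iff_sq h0 h1 hx, lin_pi_div_two, lin_three_pi_div_two,
      Real.cos_pi_div_two_sub]
    have e : (x.1 1 - Real.sin (μ / 2)) * (1 * (-x.1 1 - Real.sin (μ / 2))) =
        x.1 0 ^ 2 - Real.cos (μ / 2) ^ 2 := by
      linear_combination Real.sin_sq_add_cos_sq (μ / 2) - sq_add_sq_of_mem_bdry hx
    rw [e]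

lemma exists_isCross (t₀ : ℝ) (h0 : 0 < μ) (h1 : μ < Real.pi) :
    ∃ Γ, IsHomologyRegion t₀ (regionR μ) Γ
        {x | x.1 1 ^ 2 * Real.cos (μ / 2) ^ 2 ≤ x.1 0 ^ 2 * Real.sin (μ / 2) ^ 2} ∧
      IsCross μ Γ {x | x.1 1 ^ 2 * Real.cos (μ / 2) ^ 2 ≤ x.1 0 ^ 2 * Real.sin (μ / 2) ^ 2} := by
  have hs := sin_half_pos h0 h1
  have hc := cos_half_pos h0 h1
  have hp := Real.pi_pos
  have hS : {x : Slice | x.1 1 ^ 2 * Real.cos (μ / 2) ^ 2 ≤ x.1 0 ^ 2 * Real.sin (μ / 2) ^ 2} =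
      {x | 0 ≤ (lin (Real.pi / 2 - μ / 2) x - 0) *
        (-1 * (lin (Real.pi / 2 + μ / 2) x - 0))} := by
    ext x
    rw [Set.mem_ofPred_eq, Set.mem_ofPred_eq, lin_pi_div_two_sub, lin_pi_div_two_add,
      ← sub_nonneg]
    ring_nf
  rw [hS]
  refine exists_homology_product t₀ (bdryPoint_mem_bdry _) (bdryPoint_mem_bdry _)
    (bdryPoint_mem_bdry _) (bdryPoint_mem_bdry _) ?_ (by simp) (by simp) (by norm_num)
    ((chord_bdryPoint (φ := Real.pi / 2 - μ / 2) (w := Real.pi / 2) (by ring) (by ring)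
      (by linarith) (by linarith)).trans (by rw [Real.cos_pi_div_two]))
    ((chord_bdryPoint (φ := Real.pi / 2 + μ / 2) (w := Real.pi / 2) (by ring) (by ring)
      (by linarith) (by linarith)).trans (by rw [Real.cos_pi_div_two])) ?_ ?_
    (regionR_subset_bdry μ)
  · apply injective_vec_four <;> exact bdryPoint_ne (by linarith) (by linarith)
  · intro x h2 h3
    rw [lin_pi_div_two_sub] at h2
    rw [lin_pi_div_two_add] at h3
    have hx0 : x.1 0 = 0 := by
      have : x.1 0 * Real.sin (μ / 2) = 0 := by linarith
      exact (mul_eq_zero.1 this).resolve_right hs.ne'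
    have hx1 : x.1 1 = 0 := by
      have : x.1 1 * Real.cos (μ / 2) = 0 := by linarith
      exact (mul_eq_zero.1 this).resolve_right hc.ne'
    -- At the centre, where the diameters cross, the product is the quadratic form x₀² sin² − x₁²
    -- cos² in the half-width μ/2; it is positive along φ = 0 and negative along φ = π/2.
    constructor
    · refine mem_closure_of_seg (y := bdryPoint 0) ?_
      filter_upwards [self_mem_nhdsWithin, nhdsWithin_le_nhds (Iio_mem_nhds one_pos)]
        with r (h4 : 0 < r) (h5 : r < 1)
      rw [lin_pi_div_two_sub, lin_pi_div_two_add, seg_coord_zero _ _ h4.le h5.le,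
        seg_coord_one _ _ h4.le h5.le, hx0, hx1]
      simp only [bdryPoint, Matrix.cons_val, Real.cos_zero, Real.sin_zero]
      have : 0 < (r * Real.sin (μ / 2)) ^ 2 := by positivity
      linarith
    · refine mem_closure_of_seg (y := bdryPoint (Real.pi / 2)) ?_
      filter_upwards [self_mem_nhdsWithin, nhdsWithin_le_nhds (Iio_mem_nhds one_pos)]
        with r (h4 : 0 < r) (h5 : r < 1)
      rw [lin_pi_div_two_sub, lin_pi_div_two_add, seg_coord_zero _ _ h4.le h5.le,
        seg_coord_one _ _ h4.le h5.le, hx0, hx1]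
      simp only [bdryPoint, Matrix.cons_val, Real.cos_pi_div_two, Real.sin_pi_div_two]
      have : 0 < (r * Real.cos (μ / 2)) ^ 2 := by positivity
      linarith
  · intro x hx
    rw [mem_regionR_iff_sq h0 h1 hx, lin_pi_div_two_sub, lin_pi_div_two_add]
    have e : (x.1 0 * Real.sin (μ / 2) + x.1 1 * Real.cos (μ / 2) - 0) *
        (-1 * (-x.1 0 * Real.sin (μ / 2) + x.1 1 * Real.cos (μ / 2) - 0)) =
        x.1 0 ^ 2 - Real.cos (μ / 2) ^ 2 := by
      linear_combination x.1 0 ^ 2 * Real.sin_sq_add_cos_sq (μ / 2) -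
        Real.cos (μ / 2) ^ 2 * sq_add_sq_of_mem_bdry hx
    rw [e]

/-! ### Telling the three pairings apart -/

/-- The midpoint of a chord of the connected configuration. -/
noncomputable def gapPoint (μ : ℝ) : Slice :=
  seg (bdryPoint (0 + μ / 2)) (bdryPoint (Real.pi - μ / 2)) (1 / 2)

lemma gapPoint_zero (μ : ℝ) : (gapPoint μ).1 0 = 0 := by
  rw [gapPoint, seg_coord_zero _ _ (by norm_num) (by norm_num)]
  simp only [bdryPoint, Matrix.cons_val, Real.cos_pi_sub, zero_add]
  ring

lemma gapPoint_one (μ : ℝ) : (gapPoint μ).1 1 = Real.sin (μ / 2) := by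
  rw [gapPoint, seg_coord_one _ _ (by norm_num) (by norm_num)]
  simp only [bdryPoint, Matrix.cons_val, Real.sin_pi_sub, zero_add]
  ring

/-- This point lies on a chord of the inner pairing. For the other two it is joined, without meeting
the frontier, to the angle π/2 outside the region, so it detects which regions can be nested. -/
lemma IsInner.gapPoint_mem (h : IsInner μ Γ S) (hS : IsClosed S) : gapPoint μ ∈ S := by
  apply hS.frontier_subset
  rw [h.2]
  exact Or.inl ⟨1 / 2, ⟨by norm_num, by norm_num⟩, rfl⟩

lemma bdryPoint_pi_div_two_notMem_regionR (h0 : 0 < μ) (h1 : μ < Real.pi) :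
    bdryPoint (Real.pi / 2) ∉ regionR μ := by
  rw [mem_regionR_iff_sq h0 h1 (bdryPoint_mem_bdry _)]
  have := cos_half_pos h0 h1
  simp only [bdryPoint, Matrix.cons_val, Real.cos_pi_div_two]
  have : 0 < Real.cos (μ / 2) ^ 2 := by positivity
  linarith

lemma IsOuter.gapPoint_notMem (h0 : 0 < μ) (h1 : μ < Real.pi)
    (hS : IsHomologyRegion t₀ (regionR μ) Γ S) (h : IsOuter μ Γ S) : gapPoint μ ∉ S := by
  have hc := cos_half_pos h0 h1
  refine notMem_of_disjoint_frontier
    (U := {x | lin 0 x < Real.cos (μ / 2)} ∩ {x | lin Real.pi x < Real.cos (μ / 2)})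
    ((kleinConvex_lin_lt _ _).inter (kleinConvex_lin_lt _ _)).isPreconnected ?_
    ⟨bdryPoint (Real.pi / 2), ⟨?_, ?_⟩, hS.notMem (bdryPoint_mem_bdry _)
      (bdryPoint_pi_div_two_notMem_regionR h0 h1)⟩ _ ⟨?_, ?_⟩
  · rw [h.frontier_eq h0 h1]
    rintro x ⟨h2, h3⟩ (h4 | h4)
    · exact absurd h4 (ne_of_lt h2)
    · exact absurd h4 (ne_of_lt h3)
  · rw [Set.mem_ofPred_eq, lin_zero]; simpa [bdryPoint] using hc
  · rw [Set.mem_ofPred_eq, lin_pi]; simpa [bdryPoint] using hc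
  · rw [Set.mem_ofPred_eq, lin_zero, gapPoint_zero]; exact hc
  · rw [Set.mem_ofPred_eq, lin_pi, gapPoint_zero, neg_zero]; exact hc

lemma IsCross.gapPoint_notMem (h0 : 0 < μ) (h1 : μ < Real.pi)
    (hS : IsHomologyRegion t₀ (regionR μ) Γ S) (h : IsCross μ Γ S) : gapPoint μ ∉ S := by
  have hc := cos_half_pos h0 h1
  have hs := sin_half_pos h0 h1
  refine notMem_of_disjoint_frontier
    (U := {x | 0 < lin (Real.pi / 2 - μ / 2) x} ∩ {x | 0 < lin (Real.pi / 2 + μ / 2) x})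
    ((kleinConvex_lt_lin _ _).inter (kleinConvex_lt_lin _ _)).isPreconnected ?_
    ⟨bdryPoint (Real.pi / 2), ⟨?_, ?_⟩, hS.notMem (bdryPoint_mem_bdry _)
      (bdryPoint_pi_div_two_notMem_regionR h0 h1)⟩ _ ⟨?_, ?_⟩
  · rw [h.frontier_eq]
    rintro x ⟨h2, h3⟩ (h4 | h4)
    · exact absurd h4 (ne_of_gt h2)
    · exact absurd h4 (ne_of_gt h3)
  · rw [Set.mem_ofPred_eq, lin_pi_div_two_sub]; simpa [bdryPoint] using hc
  · rw [Set.mem_ofPred_eq, lin_pi_div_two_add]; simpa [bdryPoint] using hc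
  · rw [Set.mem_ofPred_eq, lin_pi_div_two_sub, gapPoint_zero, gapPoint_one, zero_mul, zero_add]
    positivity
  · rw [Set.mem_ofPred_eq, lin_pi_div_two_add, gapPoint_zero, gapPoint_one, neg_zero, zero_mul,
      zero_add]
    positivity

/-- All ends have |x₀| = cos(μ/2), so none lies inside the two caps. Hence the outer surface is
outermost among all homologous ones. -/
lemma IsHomologyRegion.caps_subset (h0 : 0 < μ) (h1 : μ < Real.pi)
    (h : IsHomologyRegion t₀ (regionR μ) Γ S) :
    cap 0 (μ / 2) ∪ cap (0 + Real.pi) (μ / 2) ⊆ S := by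
  have hc := cos_half_pos h0 h1
  have he : ∀ p ∈ ends (regionR μ), p.1 0 ^ 2 = Real.cos (μ / 2) ^ 2 := by
    rw [ends_regionR h0 h1]
    rintro p (rfl | rfl | rfl | rfl) <;> simp [bdryPoint, Real.cos_add]
  have he' : ∀ p ∈ ends (regionR μ), |p.1 0| ≤ Real.cos (μ / 2) := fun p hp =>
    abs_le_of_sq_le_sq (he p hp).le hc.le
  refine Set.union_subset (h.cap_subset (by linarith) (by linarith) ?_ fun p hp => ?_)
    (h.cap_subset (by linarith) (by linarith) ?_ fun p hp => ?_)
  · rw [regionR_eq]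
    exact Or.inl ⟨0, ⟨by linarith, by linarith⟩, rfl⟩
  · rw [lin_zero]
    exact (abs_le.1 (he' p hp)).2
  · rw [regionR_eq]
    exact Or.inr ⟨Real.pi, ⟨by linarith, by linarith⟩, by rw [zero_add]⟩
  · rw [zero_add, lin_pi]
    linarith [(abs_le.1 (he' p hp)).1]

/-! ### Area comparisons, the appetizer and the lunch -/

lemma len_inner_le_outer (hμ : Real.pi / 2 ≤ μ) (h1 : μ < Real.pi) (ε : ℝ) :
    len (2 * Real.cos (μ / 2)) ε ≤ len (2 * Real.sin (μ / 2)) ε := by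
  apply len_mono
  -- Here μ ≥ π/2 enters the comparison of areas; it makes the inner surface RT and leaves room for
  -- a lunch.
  have : Real.cos (μ / 2) ≤ Real.sin (μ / 2) := by
    rw [← Real.cos_pi_div_two_sub]
    exact Real.cos_le_cos_of_nonneg_of_le_pi (by linarith) (by linarith) (by linarith)
  linarith

lemma len_outer_le_cross (μ ε : ℝ) : len (2 * Real.sin (μ / 2)) ε ≤ len 2 ε := by
  apply len_mono
  linarith [Real.sin_le_one (μ / 2)]

/-- The gap point excludes inner surfaces from this wedge, so its only competitors are of outer type
or crossing, and the crossing ones are longer. -/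
lemma IsOuter.isAppetizer (h0 : 0 < μ) (h1 : μ < Real.pi)
    (hS : IsHomologyRegion t₀ (regionR μ) Γ (cap 0 (μ / 2) ∪ cap (0 + Real.pi) (μ / 2)))
    (h : IsOuter μ Γ (cap 0 (μ / 2) ∪ cap (0 + Real.pi) (μ / 2))) :
    IsAppetizer t₀ (regionR μ) Γ (cap 0 (μ / 2) ∪ cap (0 + Real.pi) (μ / 2)) := by
  refine ⟨⟨hS, fun Γ' S' hS' hsub => ?_⟩,
    fun Γ' S' h' => outerWedge_subset_iff.2 (h'.1.caps_subset h0 h1)⟩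
  filter_upwards [self_mem_nhdsWithin] with ε (hε : 0 < ε)
  rw [h.area h0 h1 hε]
  rcases hS'.cases_regionR h0 h1 with h' | h' | h'
  · rw [h'.area h0 h1 hε]
  · exact absurd (outerWedge_subset_iff.1 hsub (h'.gapPoint_mem hS'.isClosed))
      (h.gapPoint_notMem h0 h1 hS)
  · rw [h'.area hε]
    linarith [len_outer_le_cross μ ε]

lemma easyWedge_regionR (h0 : 0 < μ) (h1 : μ < Real.pi) : easyWedge t₀ (regionR μ) =
    outerWedge t₀ (cap 0 (μ / 2) ∪ cap (0 + Real.pi) (μ / 2)) := by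
  obtain ⟨Γ, hS, h⟩ := exists_isOuter t₀ h0 h1
  exact (h.isAppetizer h0 h1 hS).easyWedge_eq

lemma IsHomologyRegion.area_le_cross (hμ : Real.pi / 2 ≤ μ) (h1 : μ < Real.pi)
    (h : IsHomologyRegion t₀ (regionR μ) Γ S) {ε : ℝ} (hε : 0 < ε) : Γ.area ε ≤ 2 * len 2 ε := by
  have h0 : 0 < μ := by linarith [Real.pi_pos]
  have e1 := len_inner_le_outer hμ h1 ε
  have e2 := len_outer_le_cross μ ε
  rcases h.cases_regionR h0 h1 with h' | h' | h'
  · rw [h'.area h0 h1 hε]; linarith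
  · rw [h'.area h0 h1 hε]; linarith
  · rw [h'.area hε]

/-- The areas are ordered as inner ≤ outer ≤ cross, with the inner surface RT, the crossing one the
bulge and the outer one the appetizer. The limit is 4 log 2 − 4 log(2 sin(μ/2)). -/
lemma hasLunchArea_regionR (hμ : Real.pi / 2 ≤ μ) (h1 : μ < Real.pi) :
    HasLunchArea 0 (regionR μ) (areaPL μ) := by
  have h0 : 0 < μ := by linarith [Real.pi_pos]
  have hs := sin_half_pos h0 h1
  have hc := cos_half_pos h0 h1
  have hsc := Real.sin_sq_add_cos_sq (μ / 2)
  obtain ⟨Γa, hSa, ha⟩ := exists_isOuter 0 h0 h1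
  obtain ⟨Γb, hSb, hb⟩ := exists_isCross 0 h0 h1
  obtain ⟨Γc, hSc, hc'⟩ := exists_isInner 0 h0 h1
  -- At μ = π/2 the outer surface is RT as well. The entanglement wedge includes the wedges of all
  -- RT surfaces, so it contains the inner one in either case.
  have hRT : IsRT 0 (regionR μ) Γc := by
    refine ⟨⟨_, hSc⟩, ?_⟩
    rintro Γ' ⟨S', h'⟩
    filter_upwards [self_mem_nhdsWithin] with ε (hε : 0 < ε)
    have e1 := len_inner_le_outer hμ h1 ε
    have e2 := len_outer_le_cross μ ε
    rw [hc'.area h0 h1 hε]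
    rcases h'.cases_regionR h0 h1 with h' | h' | h'
    · rw [h'.area h0 h1 hε]; linarith
    · rw [h'.area h0 h1 hε]
    · rw [h'.area hε]; linarith
  refine ⟨Γb, Γa, ⟨⟨_, _, hSb, hSa, outerWedge_subset_iff.2 (hSb.caps_subset h0 h1), ?_⟩,
    ⟨_, ha.isAppetizer h0 h1 hSa⟩, ?_⟩, ?_⟩
  · intro p hp
    refine ⟨Γc, _, hRT, hSc, outerWedge_subset_iff.2 (fun x hx => ?_) hp⟩
    rw [Set.mem_ofPred_eq] at hx ⊢
    nlinarith [x.sq_le_one, mul_le_mul_of_nonneg_right x.sq_le_one (sq_nonneg (Real.sin (μ / 2)))]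
  · rintro Γi Γj ⟨Si, Sj, hi, hj, hsub, -⟩
    filter_upwards [self_mem_nhdsWithin] with ε (hε : 0 < ε)
    have e1 := len_outer_le_cross μ ε
    have e2 := hi.area_le_cross hμ h1 hε
    rw [hb.area hε, ha.area h0 h1 hε]
    -- Only an inner outermost surface could beat the claimed difference; but then the gap point
    -- makes the other surface inner too, and the difference is zero.
    rcases hj.cases_regionR h0 h1 with h' | h' | h'
    · rw [h'.area h0 h1 hε]; linarith
    · have hg := outerWedge_subset_iff.1 hsub (h'.gapPoint_mem hj.isClosed)
      rw [h'.area h0 h1 hε]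
      rcases hi.cases_regionR h0 h1 with h'' | h'' | h''
      · exact absurd hg (h''.gapPoint_notMem h0 h1 hi)
      · rw [h''.area h0 h1 hε]; linarith
      · exact absurd hg (h''.gapPoint_notMem h0 h1 hi)
    · rw [h'.area hε]; linarith
  · have hl := ((tendsto_len_sub two_pos).sub
      (tendsto_len_sub (mul_pos two_pos hs))).const_mul 2
    have e : 2 * (2 * Real.log 2 - 2 * Real.log (2 * Real.sin (μ / 2))) = areaPL μ := by
      rw [areaPL, Real.log_pow, Real.log_inv, Real.log_mul two_ne_zero hs.ne']
      push_cast
      ring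
    rw [e] at hl
    refine hl.congr' ?_
    filter_upwards [self_mem_nhdsWithin] with ε (hε : 0 < ε)
    rw [hb.area hε, ha.area h0 h1 hε]
    ring

lemma areaPL_pos (h0 : 0 < μ) (h1 : μ < Real.pi) : 0 < areaPL μ := by
  have hs := sin_half_pos h0 h1
  have hc := cos_half_pos h0 h1
  have hs1 : Real.sin (μ / 2) < 1 := by nlinarith [Real.sin_sq_add_cos_sq (μ / 2)]
  have : 1 < (Real.sin (μ / 2))⁻¹ := (one_lt_inv₀ hs).2 hs1
  exact mul_pos two_pos (Real.log_pos (one_lt_pow₀ this two_ne_zero))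

end RegionR

/-! ### The input intervals -/

section Inputs

variable {μ τ : ℝ}

/-- The two linear forms sum to 2 x₀ cos(μ/2) < 2 cos(τ/2), so a point is never in both half-planes
and the sign of a product can express their union. -/
lemma mem_inputs_iff (h0 : 0 < τ) (h1 : τ < μ) (h2 : μ + τ ≤ Real.pi) {x : Slice}
    (hx : x ∈ bdry) : x ∈ V₁ μ τ ∪ V₂ μ τ ↔
      0 ≤ (lin (-(μ / 2)) x - Real.cos (τ / 2)) * (-1 * (lin (μ / 2) x - Real.cos (τ / 2))) := by
  rw [V₁_eq, V₂_eq, Set.mem_union, mem_arc_iff (by linarith) hx, mem_arc_iff (by linarith) hx,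
    ← mem_cap, ← mem_cap, mem_cap_iff_lin (by linarith) (by linarith),
    mem_cap_iff_lin (by linarith) (by linarith)]
  have hc : 0 ≤ Real.cos (μ / 2) := Real.cos_nonneg_of_mem_Icc ⟨by linarith, by linarith⟩
  have hcc : Real.cos (μ / 2) < Real.cos (τ / 2) :=
    Real.cos_lt_cos_of_nonneg_of_le_pi (by linarith) (by linarith) (by linarith)
  have hsum : lin (-(μ / 2)) x + lin (μ / 2) x < 2 * Real.cos (τ / 2) := by
    have h3 : x.1 0 ≤ 1 := by nlinarith [x.sq_le_one, sq_nonneg (x.1 1), sq_nonneg (x.1 0 - 1)]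
    simp only [lin, Real.cos_neg, Real.sin_neg]
    nlinarith
  constructor
  · rintro (h | h)
    · exact mul_nonneg (by linarith) (by linarith)
    · exact mul_nonneg_of_nonpos_of_nonpos (by linarith) (by linarith)
  · intro h
    by_contra! hlt
    have := mul_pos_of_neg_of_neg (sub_neg.2 hlt.1) (sub_neg.2 hlt.2)
    linarith

lemma inputs_disjoint (h0 : 0 < τ) (h1 : τ < μ) (h2 : μ + τ ≤ Real.pi) :
    Disjoint (V₁ μ τ) (V₂ μ τ) := by
  rw [V₁_eq, V₂_eq]
  refine arc_disjoint (by linarith) (by linarith) fun x h3 h4 => ?_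
  have hc : 0 ≤ Real.cos (μ / 2) := Real.cos_nonneg_of_mem_Icc ⟨by linarith, by linarith⟩
  have hcc : Real.cos (μ / 2) < Real.cos (τ / 2) :=
    Real.cos_lt_cos_of_nonneg_of_le_pi (by linarith) (by linarith) (by linarith)
  have h5 : x.1 0 ≤ 1 := by nlinarith [x.sq_le_one, sq_nonneg (x.1 1), sq_nonneg (x.1 0 - 1)]
  simp only [lin, Real.cos_neg, Real.sin_neg] at h3 h4
  nlinarith

lemma ends_inputs (h0 : 0 < τ) (h1 : τ < μ) (h2 : μ + τ ≤ Real.pi) :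
    ends (V₁ μ τ ∪ V₂ μ τ) = {bdryPoint (-(μ / 2) - τ / 2), bdryPoint (-(μ / 2) + τ / 2),
      bdryPoint (μ / 2 - τ / 2), bdryPoint (μ / 2 + τ / 2)} := by
  have hV₁ : IsClosed (V₁ μ τ) := isClosed_arc _ _
  have hV₂ : IsClosed (V₂ μ τ) := isClosed_arc _ _
  rw [ends_union hV₁ hV₂ (inputs_disjoint h0 h1 h2), V₁_eq, V₂_eq,
    ends_arc (by linarith) (by linarith), ends_arc (by linarith) (by linarith)]
  ext x
  simp only [Set.mem_union, Set.mem_insert_iff, Set.mem_singleton_iff, or_assoc]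

lemma injective_ends_inputs (h0 : 0 < τ) (h1 : τ < μ) (h2 : μ + τ ≤ Real.pi) :
    Function.Injective ![bdryPoint (-(μ / 2) - τ / 2), bdryPoint (-(μ / 2) + τ / 2),
      bdryPoint (μ / 2 - τ / 2), bdryPoint (μ / 2 + τ / 2)] := by
  apply injective_vec_four <;> exact bdryPoint_ne (by linarith) (by linarith)

lemma inputs_subset_bdry (μ τ : ℝ) : V₁ μ τ ∪ V₂ μ τ ⊆ bdry :=
  Set.union_subset (arc_subset_bdry _ _) (arc_subset_bdry _ _)

/-- The regularised area of the disconnected surface of the input intervals. -/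
noncomputable def areaDisconnected (τ ε : ℝ) : ℝ := 2 * len (2 * Real.sin (τ / 2)) ε

/-- The regularised area of the connected surface of the input intervals. -/
noncomputable def areaConnected (μ τ ε : ℝ) : ℝ :=
  len (2 * Real.sin ((μ - τ) / 2)) ε + len (2 * Real.sin ((μ + τ) / 2)) ε

lemma exists_disconnected (t₀ : ℝ) (h0 : 0 < τ) (h1 : τ < μ) (h2 : μ + τ ≤ Real.pi) :
    ∃ Γ ∈ homologous t₀ (V₁ μ τ ∪ V₂ μ τ), ∀ ε > 0, Γ.area ε = areaDisconnected τ ε := by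
  have hw := abs_cos_lt_one (w := τ / 2) (by linarith) (by linarith)
  obtain ⟨Γ, hΓ, hm, -⟩ := exists_homology_product t₀ (A := V₁ μ τ ∪ V₂ μ τ)
    (p := bdryPoint (-(μ / 2) - τ / 2)) (q := bdryPoint (-(μ / 2) + τ / 2))
    (p' := bdryPoint (μ / 2 - τ / 2)) (q' := bdryPoint (μ / 2 + τ / 2)) (k := -1)
    (bdryPoint_mem_bdry _) (bdryPoint_mem_bdry _)
    (bdryPoint_mem_bdry _) (bdryPoint_mem_bdry _) (by
      apply injective_vec_four <;> first
        | exact bdryPoint_ne (by linarith) (by linarith)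
        | exact (bdryPoint_ne (by linarith) (by linarith)).symm) hw hw (by norm_num)
    (chord_eq (by linarith) (by linarith)) (chord_eq (by linarith) (by linarith))
    (by
      intro x h3 h4
      exfalso
      have hc : 0 ≤ Real.cos (μ / 2) := Real.cos_nonneg_of_mem_Icc ⟨by linarith, by linarith⟩
      have hcc : Real.cos (μ / 2) < Real.cos (τ / 2) :=
        Real.cos_lt_cos_of_nonneg_of_le_pi (by linarith) (by linarith) (by linarith)
      have h5 : x.1 0 ≤ 1 := by nlinarith [x.sq_le_one, sq_nonneg (x.1 1), sq_nonneg (x.1 0 - 1)]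
      simp only [lin, Real.cos_neg, Real.sin_neg] at h3 h4
      nlinarith)
    (fun x hx => (mem_inputs_iff h0 h1 h2 hx).symm) (inputs_subset_bdry μ τ)
  refine ⟨Γ, ⟨_, hΓ⟩, fun ε hε => ?_⟩
  rw [hm ε hε, dist_bdryPoint (by linarith) (by linarith), dist_bdryPoint (by linarith)
    (by linarith), show (-(μ / 2) + τ / 2 - (-(μ / 2) - τ / 2)) / 2 = τ / 2 by ring,
    show (μ / 2 + τ / 2 - (μ / 2 - τ / 2)) / 2 = τ / 2 by ring, areaDisconnected]
  ring

lemma area_connected_eq {Γ : ExtremalSurface} {S : Set Slice} (h0 : 0 < τ) (h1 : τ < μ)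
    (h2 : μ + τ ≤ Real.pi)
    (h : IsMatched Γ S (bdryPoint (-(μ / 2) + τ / 2)) (bdryPoint (μ / 2 - τ / 2))
      (bdryPoint (μ / 2 + τ / 2)) (bdryPoint (-(μ / 2) - τ / 2))) {ε : ℝ} (hε : 0 < ε) :
    Γ.area ε = areaConnected μ τ ε := by
  rw [h.1 ε hε, dist_comm (bdryPoint (μ / 2 + τ / 2)), dist_bdryPoint (by linarith) (by linarith),
    dist_bdryPoint (by linarith) (by linarith), areaConnected,
    show (μ / 2 - τ / 2 - (-(μ / 2) + τ / 2)) / 2 = (μ - τ) / 2 by ring,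
    show (μ / 2 + τ / 2 - (-(μ / 2) - τ / 2)) / 2 = (μ + τ) / 2 by ring]

lemma exists_connected (t₀ : ℝ) (h0 : 0 < τ) (h1 : τ < μ) (h2 : μ + τ ≤ Real.pi) :
    ∃ Γ ∈ homologous t₀ (V₁ μ τ ∪ V₂ μ τ), ∀ ε > 0, Γ.area ε = areaConnected μ τ ε := by
  have hcc : Real.cos (μ / 2 + τ / 2) < Real.cos (μ / 2 - τ / 2) :=
    Real.cos_lt_cos_of_nonneg_of_le_pi (by linarith) (by linarith) (by linarith)
  obtain ⟨Γ, hΓ, hm⟩ := exists_homology_product t₀ (A := V₁ μ τ ∪ V₂ μ τ)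
    (p := bdryPoint (-(μ / 2) + τ / 2)) (q := bdryPoint (μ / 2 - τ / 2))
    (p' := bdryPoint (μ / 2 + τ / 2)) (q' := bdryPoint (-(μ / 2) - τ / 2)) (k := -1)
    (φ := 0) (ψ := 0) (a := Real.cos (μ / 2 - τ / 2)) (b := Real.cos (μ / 2 + τ / 2))
    (bdryPoint_mem_bdry _) (bdryPoint_mem_bdry _)
    (bdryPoint_mem_bdry _) (bdryPoint_mem_bdry _) (by
      apply injective_vec_four <;> first
        | exact bdryPoint_ne (by linarith) (by linarith)
        | exact (bdryPoint_ne (by linarith) (by linarith)).symm)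
    (abs_cos_lt_one (by linarith) (by linarith)) (abs_cos_lt_one (by linarith) (by linarith))
    (by norm_num)
    (chord_bdryPoint (by ring) (by ring) (by linarith) (by linarith))
    (by rw [chord_comm]; exact chord_bdryPoint (by ring) (by ring) (by linarith) (by linarith))
    (by
      intro x h3 h4
      linarith)
    (by
      intro x hx
      rw [mem_inputs_iff h0 h1 h2 hx]
      -- On the unit circle the products for the two pairs of lines through the same four points
      -- agree, so both surfaces bound the same boundary region.
      have e : (lin 0 x - Real.cos (μ / 2 - τ / 2)) *
          (-1 * (lin 0 x - Real.cos (μ / 2 + τ / 2))) =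
          (lin (-(μ / 2)) x - Real.cos (τ / 2)) * (-1 * (lin (μ / 2) x - Real.cos (τ / 2))) := by
        rw [lin_zero]
        simp only [lin, Real.cos_neg, Real.sin_neg, Real.cos_add, Real.cos_sub]
        have e1 := sq_add_sq_of_mem_bdry hx
        have e2 := Real.sin_sq_add_cos_sq (μ / 2)
        have e3 := Real.sin_sq_add_cos_sq (τ / 2)
        linear_combination (-Real.sin (μ / 2) ^ 2) * e1 + (x.1 0 ^ 2 - Real.cos (τ / 2) ^ 2) * e2 +
          Real.sin (μ / 2) ^ 2 * e3
      rw [e])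
    (inputs_subset_bdry μ τ)
  exact ⟨Γ, ⟨_, hΓ⟩, fun ε hε => area_connected_eq h0 h1 h2 hm hε⟩

/-- Each crossing chord has length 2 sin(μ/2) ≥ 2 sin(τ/2) in the Euclidean sense, so the crossing
surface never beats the disconnected one. -/
lemma min_le_area_inputs {t₀ : ℝ} (h0 : 0 < τ) (h1 : τ < μ) (h2 : μ + τ ≤ Real.pi)
    {Γ : ExtremalSurface} (hΓ : Γ ∈ homologous t₀ (V₁ μ τ ∪ V₂ μ τ)) {ε : ℝ} (hε : 0 < ε) :
    min (areaDisconnected τ ε) (areaConnected μ τ ε) ≤ Γ.area ε := by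
  obtain ⟨S, hS⟩ := hΓ
  rcases hS.isMatched (injective_ends_inputs h0 h1 h2) (ends_inputs h0 h1 h2) with h | h | h
  · refine min_le_of_left_le (le_of_eq ?_)
    rw [h.1 ε hε, dist_bdryPoint (by linarith) (by linarith), dist_bdryPoint (by linarith)
      (by linarith), show (-(μ / 2) + τ / 2 - (-(μ / 2) - τ / 2)) / 2 = τ / 2 by ring,
      show (μ / 2 + τ / 2 - (μ / 2 - τ / 2)) / 2 = τ / 2 by ring, areaDisconnected]
    ring
  · exact min_le_of_right_le (area_connected_eq h0 h1 h2 h hε).ge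
  · refine min_le_of_left_le ?_
    rw [h.1 ε hε, dist_bdryPoint (by linarith) (by linarith), dist_bdryPoint (by linarith)
      (by linarith), show (μ / 2 - τ / 2 - (-(μ / 2) - τ / 2)) / 2 = μ / 2 by ring,
      show (μ / 2 + τ / 2 - (-(μ / 2) + τ / 2)) / 2 = μ / 2 by ring, areaDisconnected]
    have hs : Real.sin (τ / 2) ≤ Real.sin (μ / 2) :=
      Real.sin_le_sin_of_le_of_le_pi_div_two (by linarith) (by linarith) (by linarith)
    have := len_mono (mul_le_mul_of_nonneg_left hs two_pos.le) ε
    linarith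

lemma entropy_inputs {t₀ G : ℝ} (h0 : 0 < τ) (h1 : τ < μ) (h2 : μ + τ ≤ Real.pi) {ε : ℝ}
    (hε : 0 < ε) : entropy G t₀ (V₁ μ τ ∪ V₂ μ τ) ε =
      min (areaDisconnected τ ε) (areaConnected μ τ ε) / (4 * G) := by
  rw [entropy]
  congr 1
  refine IsLeast.csInf_eq ⟨?_, ?_⟩
  · obtain ⟨Γ, hΓ, h3⟩ := exists_disconnected t₀ h0 h1 h2
    obtain ⟨Γ', hΓ', h3'⟩ := exists_connected t₀ h0 h1 h2
    rcases min_choice (areaDisconnected τ ε) (areaConnected μ τ ε) with h | h <;> rw [h]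
    · exact ⟨Γ, hΓ, h3 ε hε⟩
    · exact ⟨Γ', hΓ', h3' ε hε⟩
  · rintro _ ⟨Γ, hΓ, rfl⟩
    exact min_le_area_inputs h0 h1 h2 hΓ hε

lemma entropy_arc {t₀ G φ w : ℝ} (h0 : 0 < w) (h1 : w < Real.pi) {ε : ℝ} (hε : 0 < ε) :
    entropy G t₀ (arc (φ - w) (φ + w)) ε = len (2 * Real.sin w) ε / (4 * G) := by
  rw [entropy]
  congr 1
  refine IsLeast.csInf_eq ⟨?_, ?_⟩
  · obtain ⟨Γ, hΓ⟩ := exists_homology_arc t₀ (φ := φ) h0 h1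
    exact ⟨Γ, ⟨_, hΓ⟩, hΓ.area_arc h0 h1 hε⟩
  · rintro _ ⟨Γ, ⟨S, hS⟩, rfl⟩
    exact (hS.area_arc h0 h1 hε).ge

lemma sin_inputs_pos (h0 : 0 < τ) (h1 : τ < μ) (h2 : μ + τ ≤ Real.pi) :
    0 < Real.sin (τ / 2) ∧ 0 < Real.sin ((μ - τ) / 2) ∧ 0 < Real.sin ((μ + τ) / 2) :=
  ⟨Real.sin_pos_of_pos_of_lt_pi (by linarith) (by linarith),
    Real.sin_pos_of_pos_of_lt_pi (by linarith) (by linarith),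
    Real.sin_pos_of_pos_of_lt_pi (by linarith) (by linarith)⟩

/-- At each cutoff the entropies combine to the positive part of disconnected minus connected area.
Both have two geodesics, so the difference converges. -/
lemma hasMutualInfo_inputs {t₀ : ℝ} (G : ℝ) (h0 : 0 < τ) (h1 : τ < μ) (h2 : μ + τ ≤ Real.pi) :
    HasMutualInfo G t₀ (V₁ μ τ) (V₂ μ τ) (max 0 (areaMI μ τ) / (4 * G)) := by
  obtain ⟨hs0, hs1, hs2⟩ := sin_inputs_pos h0 h1 h2
  have e1 := tendsto_len_sub (mul_pos two_pos hs0)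
  have e2 := tendsto_len_sub (mul_pos two_pos hs1)
  have e3 := tendsto_len_sub (mul_pos two_pos hs2)
  have e4 := (e1.const_mul 2).sub (e2.add e3)
  have e5 : 2 * (2 * Real.log (2 * Real.sin (τ / 2))) -
      (2 * Real.log (2 * Real.sin ((μ - τ) / 2)) + 2 * Real.log (2 * Real.sin ((μ + τ) / 2))) =
      areaMI μ τ := by
    rw [areaMI, Real.log_div (by positivity) (by positivity), Real.log_pow,
      Real.log_mul hs1.ne' hs2.ne', Real.log_mul two_ne_zero hs0.ne',
      Real.log_mul two_ne_zero hs1.ne', Real.log_mul two_ne_zero hs2.ne']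
    push_cast
    ring
  rw [e5] at e4
  have e6 := ((tendsto_const_nhds (x := (0 : ℝ))).max e4).div_const (4 * G)
  refine e6.congr' ?_
  filter_upwards [self_mem_nhdsWithin] with ε (hε : 0 < ε)
  rw [entropy_inputs h0 h1 h2 hε, V₁_eq, V₂_eq, entropy_arc (by linarith) (by linarith) hε,
    entropy_arc (by linarith) (by linarith) hε, ← add_div, ← sub_div, ← two_mul]
  congr 1
  rw [areaDisconnected, areaConnected]
  rcases le_total (2 * len (2 * Real.sin (τ / 2)) ε)
    (len (2 * Real.sin ((μ - τ) / 2)) ε + len (2 * Real.sin ((μ + τ) / 2)) ε) with h | h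
  · rw [min_eq_left h, max_eq_left (by linarith)]
    ring
  · rw [min_eq_right h, max_eq_right (by linarith)]
    ring

/-- The denominator is sin²(μ/2) − sin²(τ/2), so the logarithm is nonnegative when 2 sin²(τ/2) ≥
sin²(μ/2), which in terms of cosines is the scattering condition. -/
lemma areaMI_nonneg_iff (h0 : 0 < τ) (h1 : τ < μ) (h2 : μ + τ ≤ Real.pi) :
    0 ≤ areaMI μ τ ↔ Real.cos τ ≤ Real.cos (μ / 2) ^ 2 := by
  obtain ⟨hs0, hs1, hs2⟩ := sin_inputs_pos h0 h1 h2
  have e1 : Real.sin (τ / 2) ^ 2 = (1 - Real.cos τ) / 2 := by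
    have := Real.cos_two_mul (τ / 2)
    rw [show 2 * (τ / 2) = τ by ring] at this
    nlinarith [Real.sin_sq_add_cos_sq (τ / 2)]
  have e2 : Real.sin ((μ - τ) / 2) * Real.sin ((μ + τ) / 2) =
      (Real.cos τ - (2 * Real.cos (μ / 2) ^ 2 - 1)) / 2 := by
    have h3 : Real.sin ((μ - τ) / 2) * Real.sin ((μ + τ) / 2) =
        Real.sin (μ / 2) ^ 2 - Real.sin (τ / 2) ^ 2 := by
      rw [sub_div, add_div, Real.sin_sub, Real.sin_add]
      linear_combination Real.sin (μ / 2) ^ 2 * Real.sin_sq_add_cos_sq (τ / 2) -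
        Real.sin (τ / 2) ^ 2 * Real.sin_sq_add_cos_sq (μ / 2)
    rw [h3, e1]
    linear_combination Real.sin_sq_add_cos_sq (μ / 2)
  rw [areaMI, mul_nonneg_iff_of_pos_left two_pos, Real.log_nonneg_iff (by positivity),
    one_le_div (by positivity), e1, e2]
  constructor <;> intro h <;> linarith

end Inputs

/-! ## The critical time -/

lemma continuousAt_areaMI {μ τ : ℝ} (h0 : 0 < τ) (h1 : τ < μ) (h2 : μ + τ ≤ Real.pi) :
    ContinuousAt (areaMI μ) τ := by
  obtain ⟨hs0, hs1, hs2⟩ := sin_inputs_pos h0 h1 h2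
  unfold areaMI
  refine continuousAt_const.mul (ContinuousAt.log (ContinuousAt.div ?_ ?_ ?_) ?_)
  · fun_prop
  · fun_prop
  · positivity
  · positivity

lemma cos_half_sq_lt_one {μ : ℝ} (h0 : 0 < μ) (h1 : μ < Real.pi) : Real.cos (μ / 2) ^ 2 < 1 := by
  have := sin_half_pos h0 h1
  nlinarith [Real.sin_sq_add_cos_sq (μ / 2)]

lemma τcrit_pos {μ : ℝ} (h0 : 0 < μ) (h1 : μ < Real.pi) : 0 < τcrit μ :=
  Real.arccos_pos.2 (cos_half_sq_lt_one h0 h1)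

lemma cos_τcrit {μ : ℝ} (h0 : 0 < μ) (h1 : μ < Real.pi) :
    Real.cos (τcrit μ) = Real.cos (μ / 2) ^ 2 :=
  Real.cos_arccos (by linarith [sq_nonneg (Real.cos (μ / 2))]) (cos_half_sq_lt_one h0 h1).le

lemma areaMI_τcrit {μ : ℝ} (h0 : 0 < μ) (h1 : μ < Real.pi) (h2 : τcrit μ < μ)
    (h3 : μ + τcrit μ ≤ Real.pi) : areaMI μ (τcrit μ) = 0 := by
  have hτ := τcrit_pos h0 h1
  obtain ⟨hs0, hs1, hs2⟩ := sin_inputs_pos hτ h2 h3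
  have hc := cos_τcrit h0 h1
  have e1 : Real.sin (τcrit μ / 2) ^ 2 = Real.sin ((μ - τcrit μ) / 2) *
      Real.sin ((μ + τcrit μ) / 2) := by
    have h4 := Real.cos_two_mul (τcrit μ / 2)
    rw [show 2 * (τcrit μ / 2) = τcrit μ by ring, hc] at h4
    have e2 := Real.sin_sq_add_cos_sq (τcrit μ / 2)
    have e3 := Real.sin_sq_add_cos_sq (μ / 2)
    rw [sub_div, add_div, Real.sin_sub, Real.sin_add]
    have h5 : 2 * Real.sin (τcrit μ / 2) ^ 2 = Real.sin (μ / 2) ^ 2 := by linarith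
    linear_combination h5 - Real.sin (μ / 2) ^ 2 * e2 + Real.sin (τcrit μ / 2) ^ 2 * e3
  rw [areaMI, e1, div_self (by positivity), Real.log_one, mul_zero]

/-! ### Assembling the theorem -/

lemma scatteringRegion_iff {μ τ : ℝ} (hμ : Real.pi / 2 ≤ μ) (h0 : 0 < τ)
    (hτ : τ ≤ Real.pi - μ) :
    (scatteringRegion μ τ).Nonempty ↔ Real.cos τ ≤ Real.cos (μ / 2) ^ 2 := by
  have hp := Real.pi_pos
  apply scatteringRegion_nonempty_iff hμ h0 hτ
  · rw [V₁_eq, entanglementWedge_arc (by linarith) (by linarith), outerWedge]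
  · rw [V₂_eq, easyWedge_arc (by linarith) (by linarith), outerWedge]
  · rw [easyWedge_regionR (by linarith) (by linarith), outerWedge]

lemma tendsto_areaMI_τcrit {μ : ℝ} (hμ : Real.pi / 2 ≤ μ) (h : τcrit μ < Real.pi - μ) :
    Tendsto (areaMI μ) (𝓝 (τcrit μ)) (𝓝 0) := by
  have hp := Real.pi_pos
  have h0 : 0 ≤ τcrit μ := Real.arccos_nonneg _
  have h1 : μ < Real.pi := by linarith
  have hc := continuousAt_areaMI (τcrit_pos (by linarith) h1) (show τcrit μ < μ by linarith)
    (by linarith)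
  have h2 := hc.tendsto
  rwa [areaMI_τcrit (by linarith) h1 (by linarith) (by linarith)] at h2

lemma tendsto_max_areaMI_τcrit {G μ : ℝ} (hμ : Real.pi / 2 ≤ μ) (h : τcrit μ < Real.pi - μ) :
    Tendsto (fun τ => max 0 (areaMI μ τ) / (4 * G)) (𝓝 (τcrit μ)) (𝓝 0) := by
  have := ((tendsto_const_nhds (x := (0 : ℝ))).max
    (tendsto_areaMI_τcrit hμ h)).div_const (4 * G)
  simpa only [max_self, zero_div] using this

lemma tendsto_mutualInfo_τcrit {G μ : ℝ} (hμ : Real.pi / 2 ≤ μ) (h : τcrit μ < Real.pi - μ)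
    {I : ℝ → ℝ} (hI : ∀ τ, 0 < τ → τ < Real.pi - μ →
      HasMutualInfo G (-(τ / 2)) (V₁ μ τ) (V₂ μ τ) (I τ)) :
    Tendsto I (𝓝 (τcrit μ)) (𝓝 0) := by
  have hp := Real.pi_pos
  have h0' : 0 ≤ τcrit μ := Real.arccos_nonneg _
  have h0 : 0 < τcrit μ := τcrit_pos (by linarith) (by linarith)
  refine Tendsto.congr' ?_ (tendsto_max_areaMI_τcrit (G := G) hμ h)
  filter_upwards [Ioo_mem_nhds h0 h] with τ hτ
  exact tendsto_nhds_unique (hasMutualInfo_inputs G hτ.1 (by linarith [hτ.2]) (by linarith [hτ.2]))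
    (hI τ hτ.1 hτ.2)

/-- At μ = π/2 the critical cosine is positive, so the critical time is below π/2 = π − μ. This
supplies an admissible configuration for the final claim. -/
lemma τcrit_pi_div_two : τcrit (Real.pi / 2) < Real.pi - Real.pi / 2 := by
  have hp := Real.pi_pos
  rw [τcrit, show Real.pi / 2 / 2 = Real.pi / 4 by ring, Real.cos_pi_div_four, sub_half,
    Real.arccos_lt_pi_div_two]
  positivity

/-- Just above the critical time scattering is possible, because the cosine decreases, while the
mutual information is still below the fixed positive number α₀ `areaPL` / (4G). -/
lemma eventually_counterexample {G μ α₀ : ℝ} (hG : 0 < G) (hμ : Real.pi / 2 ≤ μ)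
    (h : τcrit μ < Real.pi - μ) (hα : 0 < α₀) :
    ∀ᶠ τ in 𝓝[>] (τcrit μ), 0 < τ ∧ τ < Real.pi - μ ∧ (scatteringRegion μ τ).Nonempty ∧
      ∃ I Δ : ℝ, HasMutualInfo G (-(τ / 2)) (V₁ μ τ) (V₂ μ τ) I ∧
        HasLunchArea 0 (regionR μ) Δ ∧ I < α₀ * (Δ / (4 * G)) := by
  have hp := Real.pi_pos
  have h0 : 0 ≤ τcrit μ := Real.arccos_nonneg _
  have h1 : μ < Real.pi := by linarith
  have hPL := areaPL_pos (show 0 < μ by linarith) h1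
  have hlim := (tendsto_max_areaMI_τcrit (G := G) hμ h).mono_left
    (nhdsWithin_le_nhds (s := Set.Ioi (τcrit μ)))
  have hpos : 0 < α₀ * (areaPL μ / (4 * G)) := by positivity
  filter_upwards [self_mem_nhdsWithin, nhdsWithin_le_nhds (Iio_mem_nhds h),
    hlim.eventually_lt_const hpos] with τ (h2 : τcrit μ < τ) (h3 : τ < Real.pi - μ) h4
  have h5 : 0 < τ := by linarith
  refine ⟨h5, h3, (scatteringRegion_iff hμ h5 h3.le).2 ?_, _, _,
    hasMutualInfo_inputs G h5 (by linarith) (by linarith), hasLunchArea_regionR hμ h1, h4⟩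
  rw [← cos_τcrit (by linarith) h1]
  exact Real.cos_le_cos_of_nonneg_of_le_pi h0 (by linarith) h2.le

lemma decisionRegion_c₁_c₂ {μ τ : ℝ} (hμ : Real.pi / 2 ≤ μ) (h0 : 0 < τ) (hτ : τ < Real.pi - μ) :
    decisionRegion μ (c₁ μ τ) = domainOfDependence bdry (atTime (-(τ / 2)) (V₁ μ τ)) ∧
      decisionRegion μ (c₂ μ τ) = domainOfDependence bdry (atTime (-(τ / 2)) (V₂ μ τ)) := by
  have hp := Real.pi_pos
  rw [V₁_eq, V₂_eq, c₁, c₂]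
  constructor <;> refine decisionRegion_eq h0 hτ (by linarith) ?_
  · rw [abs_neg, abs_of_pos (by linarith)]
  · rw [abs_of_pos (by linarith)]

end TwoIntervals

theorem mainTheorem5 :
    -- the decision regions of the input points are the domains of dependence of the input intervals
    (∀ μ τ : ℝ, Real.pi / 2 ≤ μ → 0 < τ → τ < Real.pi - μ →
      decisionRegion μ (c₁ μ τ) = domainOfDependence bdry (atTime (-(τ / 2)) (V₁ μ τ)) ∧
      decisionRegion μ (c₂ μ τ) = domainOfDependence bdry (atTime (-(τ / 2)) (V₂ μ τ))) ∧
    -- the scattering condition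
    (∀ μ τ : ℝ, Real.pi / 2 ≤ μ → 0 < τ → τ ≤ Real.pi - μ →
      ((scatteringRegion μ τ).Nonempty ↔ Real.cos τ ≤ Real.cos (μ / 2) ^ 2)) ∧
    -- the mutual information
    (∀ G μ τ : ℝ, 0 < G → Real.pi / 2 ≤ μ → 0 < τ → τ ≤ Real.pi - μ → τ < μ →
      (Real.cos τ ≤ Real.cos (μ / 2) ^ 2 →
        HasMutualInfo G (-(τ / 2)) (V₁ μ τ) (V₂ μ τ) (areaMI μ τ / (4 * G))) ∧
      (Real.cos (μ / 2) ^ 2 < Real.cos τ →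
        HasMutualInfo G (-(τ / 2)) (V₁ μ τ) (V₂ μ τ) 0)) ∧
    -- the lunch area difference
    (∀ μ : ℝ, Real.pi / 2 ≤ μ → μ < Real.pi →
      HasLunchArea 0 (regionR μ) (areaPL μ) ∧ 0 < areaPL μ) ∧
    -- the mutual information vanishes at the critical time
    (∀ G μ : ℝ, 0 < G → Real.pi / 2 ≤ μ → τcrit μ < Real.pi - μ →
      Tendsto (areaMI μ) (𝓝 (τcrit μ)) (𝓝 0) ∧
      ∀ I : ℝ → ℝ, (∀ τ, 0 < τ → τ < Real.pi - μ →
          HasMutualInfo G (-(τ / 2)) (V₁ μ τ) (V₂ μ τ) (I τ)) →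
        Tendsto I (𝓝 (τcrit μ)) (𝓝 0)) ∧
    -- the bound `I ≥ α₀ ΔA_PL / (4 G)` fails, for every `α₀`, at times slightly above critical
    (∀ G μ α₀ : ℝ, 0 < G → Real.pi / 2 ≤ μ → τcrit μ < Real.pi - μ → 0 < α₀ →
      ∀ᶠ τ in 𝓝[>] (τcrit μ), 0 < τ ∧ τ < Real.pi - μ ∧ (scatteringRegion μ τ).Nonempty ∧
        ∃ I Δ : ℝ, HasMutualInfo G (-(τ / 2)) (V₁ μ τ) (V₂ μ τ) I ∧
          HasLunchArea 0 (regionR μ) Δ ∧ I < α₀ * (Δ / (4 * G))) ∧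
    -- so there is no universal constant
    (∀ G : ℝ, 0 < G → ¬ ∃ α₀ : ℝ, 0 < α₀ ∧ ∀ μ τ I Δ : ℝ,
      Real.pi / 2 ≤ μ → 0 < τ → τ < Real.pi - μ → (scatteringRegion μ τ).Nonempty →
      HasMutualInfo G (-(τ / 2)) (V₁ μ τ) (V₂ μ τ) I → HasLunchArea 0 (regionR μ) Δ →
      α₀ * (Δ / (4 * G)) ≤ I) := by
  refine ⟨fun μ τ => decisionRegion_c₁_c₂, fun μ τ => scatteringRegion_iff, ?_,
    fun μ hμ h1 => ⟨hasLunchArea_regionR hμ h1,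
      areaPL_pos (by linarith [Real.pi_pos]) h1⟩,
    fun G μ _ hμ h => ⟨tendsto_areaMI_τcrit hμ h, fun I => tendsto_mutualInfo_τcrit hμ h⟩,
    fun G μ α₀ hG hμ h hα => eventually_counterexample hG hμ h hα, ?_⟩
  · intro G μ τ _ _ h0 h1 h2
    have hI := hasMutualInfo_inputs (t₀ := -(τ / 2)) G h0 h2 (by linarith)
    have hiff := areaMI_nonneg_iff h0 h2 (by linarith)
    constructor <;> intro h
    · rwa [max_eq_right (hiff.2 h)] at hI
    · rwa [max_eq_left (not_le.1 fun h3 => h.not_ge (hiff.1 h3)).le, zero_div] at hI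
  -- The single width μ = π/2 already refutes every constant.
  · rintro G hG ⟨α₀, hα, h⟩
    obtain ⟨τ, h0, h1, hJ, I, Δ, hI, hΔ, hlt⟩ :=
      (eventually_counterexample hG le_rfl τcrit_pi_div_two hα).exists
    exact (h _ τ I Δ le_rfl h0 h1 hJ hI hΔ).not_gt hlt
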